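/- Let $m,n,q$ be non-negative integers. Let $B_0=\{1,\overline1,\dots,m,\overline m\}$, $B_1=\{1^\circ,\dots,n^\circ\}$, and order $B_0\cup B_1$ by $1<\overline1<2<\overline2<\cdots<m<\overline m<1^\circ<\cdots<n^\circ$. An *spo-tableau* of shape $\lambda$ is a filling of the Young diagram of a (possibly empty) partition $\lambda$ with letters from $B_0\cup B_1$ such that rows and columns are weakly increasing, a letter of $B_1$ occurs at most once in each row, a letter of $B_0$ occurs at most once in each column, and every entry $k$ or $\overline k$ of $B_0$ in row $i$ satisfies $k\ge i$ (otherwise it is a *symplectic violation*). A *semistandard tableau* has weakly increasing rows and strictly increasing columns; here its entries are in $\{1,\dots,q\}$. Let $\mathcal A$ be the set of two-line arrays $\binom{a_1\ \cdots\ a_t}{b_1\ \cdots\ b_t}$, $t\ge 0$, with $a_i\in\{1,\dots,q\}$, $b_i\in B_0\cup B_1$, such that $a_i\le a_{i+1}$, $b_i\le b_{i+1}$ whenever $a_i=a_{i+1}$, and every column $\binom{a}{b}$ with $b\in B_1$ occurs at most once. A *Burge two-line array* has $a_i\in\{1,\dots,q\}$, $b_i\in\{1,\dots,q-1\}$, $a_i\le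 a_{i+1}$, $b_i\le b_{i+1}$ whenever $a_i=a_{i+1}$, and $a_i>b_i$ for all $i$. *spo-insertion* $T\leftarrow x$: starting with the first row, $x$ replaces the leftmost entry $y$ of the row with $y>x$ (if $x\in B_0$), respectively $y\ge x$ (if $x\in B_1$), and $y$ is inserted in the same way into the next row; if there is no such $y$, then $x$ is put in a new box at the end of the row, and the insertion ends. If, however, $y$ would be a symplectic violation in the next row, then $x$ is not placed; instead $y$ is removed and the empty box is moved by forward slides until it has no box to its right or below, where it is deleted (a *cancellation*). In a forward slide, if $x$ is the entry to the right of the empty box and $y$ the entry below it, $x$ moves left if $x<y$ or $x=y\in B_1$, and $y$ moves up if $y<x$ or $x=y\in B_0$; if only one of them exists, it moves. *spo-correspondence*: start with $\tilde P=P=L=\emptyset$ and process the columns $\binom ij$ of $\pi\in\mathcal A$ from left to right. Replace $\tilde P$ by $\tilde P\leftarrow j$. If a box was added, add a box containing $i$ to $P$ at the same position. If a box was removed, remove the box of $P$ at that position and apply reverse column bumping to its entry (in each column to the left, from right to left, the current entry $y$ replaces the lowest entry that is $\le y$, which becomes the current entry); if $a$ is the entry bumped out of the first column, append the column $\binom ia$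 on the right of $L$. **Theorem.** (1) For every $\pi\in\mathcal A$ the spo-correspondence yields a triple $(\tilde P_\lambda,P_\lambda,L)$, where $\tilde P_\lambda$ is an spo-tableau, $P_\lambda$ is a semistandard tableau of the same shape $\lambda$ with entries in $\{1,\dots,q\}$, and $L$ is a Burge two-line array. (2) The map is invertible: $\pi\in\mathcal A$ is determined by its triple, that is, the map is injective on $\mathcal A$; and if $q\le m+1$, it is a bijection from $\mathcal A$ onto the set of all such triples. -/

import Mathlib

/-!
Letters, tableaux, two-line arrays, spo-insertion and the spo-correspondence.
A tableau is stored as the list of its rows, from top to bottom; rows, columns and the indices of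
letters are counted from `0`, so that `plain i`, `barred i`, `circ j` stand for the letters
`i+1`, `\overline{i+1}`, `(j+1)^∘`.  The entries of the top lines are the honest numbers `1, …, q`.
-/

namespace Spo

/-- The alphabet `B₀ ∪ B₁`: `plain` and `barred` letters form `B₀`, `circ` letters form `B₁`. -/
inductive Letter (m n : ℕ) : Type
  | plain (i : Fin m) : Letter m n
  | barred (i : Fin m) : Letter m n
  | circ (j : Fin n) : Letter m n

namespace Letter

variable {m n : ℕ}

/-- The position of a letter in `1 < 1̄ < 2 < 2̄ < ⋯ < m < m̄ < 1° < ⋯ < n°`. -/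
def rank : Letter m n → ℕ
  | plain i => 2 * i
  | barred i => 2 * i + 1
  | circ j => 2 * m + j

theorem rank_injective : Function.Injective (rank (m := m) (n := n)) := by
  intro a b h
  cases a <;> cases b <;> simp only [rank] at h <;> first
    | (congr 1; apply Fin.ext; omega)
    | omega

instance : LinearOrder (Letter m n) := LinearOrder.lift' rank rank_injective

/-- Membership in `B₁`. -/
def IsB1 : Letter m n → Prop
  | plain _ => False
  | barred _ => False
  | circ _ => True

instance : DecidablePred (IsB1 (m := m) (n := n)) := fun x => by
  cases x <;> unfold IsB1 <;> infer_instance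

/-- `x` may stand immediately to the left of `y` in an spo-tableau:
rows increase weakly on `B₀` and strictly on `B₁`. -/
def RowRel (x y : Letter m n) : Prop := x < y ∨ (x = y ∧ ¬ x.IsB1)

/-- `x` may stand immediately above `y` in an spo-tableau:
columns increase strictly on `B₀` and weakly on `B₁`. -/
def ColRel (x y : Letter m n) : Prop := x < y ∨ (x = y ∧ x.IsB1)

instance (x y : Letter m n) : Decidable (ColRel x y) := by unfold ColRel; infer_instance

/-- The letter is a symplectic violation in row `r` (counted from `0`): it is `k` or `k̄` with `k`
less than the number of the row. -/
def Violates (r : ℕ) : Letter m n → Prop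
  | plain i => (i : ℕ) < r
  | barred i => (i : ℕ) < r
  | circ _ => False

instance (r : ℕ) : DecidablePred (Violates (m := m) (n := n) r) := fun x => by
  cases x <;> unfold Violates <;> infer_instance

end Letter

/-- A filling of left-justified rows of boxes, given as the list of its rows. -/
abbrev Tableau (α : Type) := List (List α)

namespace Tableau

variable {α : Type}

/-- The entry in row `r` and column `c`, if there is such a box. -/
def entry (T : Tableau α) (r c : ℕ) : Option α := (T.getD r [])[c]?

/-- The list of row lengths. -/
def shape (T : Tableau α) : List ℕ := T.map List.length

/-- The number of boxes. -/
def size (T : Tableau α) : ℕ := T.shape.sum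

/-- Overwrite the entry in row `r` and column `c`. -/
def setEntry (T : Tableau α) (r c : ℕ) (x : α) : Tableau α := T.modify r (fun row => row.set c x)

/-- Add a box containing `x` at the end of row `r`; if `r` is the number of rows, this starts a new
row at the bottom. -/
def addBox (T : Tableau α) (r : ℕ) (x : α) : Tableau α :=
  if r < T.length then T.modify r (fun row => row ++ [x]) else T ++ [[x]]

/-- Remove the last box of row `r`, and the row itself if nothing is left of it. -/
def removeBox (T : Tableau α) (r : ℕ) : Tableau α :=
  (T.modify r List.dropLast).filter (fun row => !row.isEmpty)

/-- The shape is a partition (the empty one allowed), entries that are adjacent in a row are related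
by `R`, and entries that are adjacent in a column are related by `C`. -/
structure IsTableau (R C : α → α → Prop) (T : Tableau α) : Prop where
  shape_pos : ∀ l ∈ T.shape, 0 < l
  shape_anti : T.shape.Pairwise (fun k l => l ≤ k)
  row : ∀ r c x y, T.entry r c = some x → T.entry r (c + 1) = some y → R x y
  col : ∀ r c x y, T.entry r c = some x → T.entry (r + 1) c = some y → C x y

end Tableau

open Tableau

/-- `T` is an `spo(2m,n)`-tableau. -/
structure IsSpoTableau {m n : ℕ} (T : Tableau (Letter m n)) : Prop where
  isTableau : IsTableau Letter.RowRel Letter.ColRel T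
  symplectic : ∀ r c x, T.entry r c = some x → ¬ x.Violates r

/-- `P` is a semistandard tableau with entries in `{1, …, q}`. -/
structure IsSemistandard (q : ℕ) (P : Tableau ℕ) : Prop where
  isTableau : IsTableau (fun a b : ℕ => a ≤ b) (fun a b : ℕ => a < b) P
  entries : ∀ r c a, P.entry r c = some a → 1 ≤ a ∧ a ≤ q

/-- A two-line array, as the list of its columns `(top, bottom)`. -/
abbrev TwoLine (β : Type) := List (ℕ × β)

/-- `aᵢ ≤ aᵢ₊₁`, and `bᵢ ≤ bᵢ₊₁` if `aᵢ = aᵢ₊₁`. -/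
def IsSortedArray {β : Type} [LE β] (π : TwoLine β) : Prop :=
  π.IsChain (fun p p' => p.1 ≤ p'.1 ∧ (p.1 = p'.1 → p.2 ≤ p'.2))

/-- The set `𝒜` of two-line arrays with top entries in `{1, …, q}`. -/
def arrays (m n q : ℕ) : Set (TwoLine (Letter m n)) :=
  {π | (∀ p ∈ π, 1 ≤ p.1 ∧ p.1 ≤ q) ∧ IsSortedArray π ∧ ∀ p ∈ π, p.2.IsB1 → π.count p ≤ 1}

/-- The Burge two-line arrays. -/
def burgeArrays (q : ℕ) : Set (TwoLine ℕ) :=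
  {L | (∀ p ∈ L, 1 ≤ p.1 ∧ p.1 ≤ q ∧ 1 ≤ p.2 ∧ p.2 ≤ q - 1) ∧ IsSortedArray L ∧
    ∀ p ∈ L, p.2 < p.1}

/-- The row in which an spo-insertion has added, or removed, a box (always the end of that row). -/
inductive Change : Type
  | added (r : ℕ) : Change
  | removed (r : ℕ) : Change

/-- The jeu de taquin: the box in row `r` and column `c` is regarded as empty (whatever entry is
stored there), and forward slides are applied until the empty box has no box below it and none to
its right; then it is removed.  Also returns the row from which the box has been removed.
The first argument bounds the number of slides. -/
def jeuDeTaquin {m n : ℕ} : ℕ → Tableau (Letter m n) → ℕ → ℕ → Tableau (Letter m n) × ℕ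
  | 0, T, r, _ => (T.removeBox r, r)
  | fuel + 1, T, r, c =>
    match T.entry r (c + 1), T.entry (r + 1) c with
    | none, none => (T.removeBox r, r)
    | some x, none => jeuDeTaquin fuel (T.setEntry r c x) r (c + 1)
    | none, some y => jeuDeTaquin fuel (T.setEntry r c y) (r + 1) c
    | some x, some y =>
      if x.ColRel y then jeuDeTaquin fuel (T.setEntry r c x) r (c + 1)
      else jeuDeTaquin fuel (T.setEntry r c y) (r + 1) c

/-- How the bumping stage of an spo-insertion ends: with a new box at the end of row `r`, or with
the box in row `r` and column `c` being emptied. -/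
inductive BumpEnd : Type
  | newBox (r : ℕ) : BumpEnd
  | hole (r c : ℕ) : BumpEnd

/-- The bumping stage: insert `x` into the list of rows, the first of which is row `r` of the whole
tableau.  A letter `x` bumps the leftmost `y` with `x < y`, or with `x = y ∈ B₁`; if there is no
such `y` it is appended to the row.  If the bumped letter would be a symplectic violation in the
next row, `x` is not placed and the box of the bumped letter becomes the hole. -/
def bump {m n : ℕ} :
    ℕ → Letter m n → Tableau (Letter m n) → Tableau (Letter m n) × BumpEnd
  | r, x, [] => ([[x]], .newBox r)
  | r, x, row :: rows =>
    let c := row.findIdx (fun y => decide (x.ColRel y))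
    match row[c]? with
    | none => ((row ++ [x]) :: rows, .newBox r)
    | some y =>
      if y.Violates (r + 1) then (row :: rows, .hole r c)
      else ((row.set c x) :: (bump (r + 1) y rows).1, (bump (r + 1) y rows).2)

/-- The spo-insertion `T ← x`, together with the position of the box that it adds or removes. -/
def spoInsert {m n : ℕ} (T : Tableau (Letter m n)) (x : Letter m n) :
    Tableau (Letter m n) × Change :=
  match bump 0 x T with
  | (T', .newBox r) => (T', .added r)
  | (T', .hole r c) =>
    ((jeuDeTaquin T'.size T' r c).1, .removed (jeuDeTaquin T'.size T' r c).2)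

/-- Reverse column bumping of `y` through the columns `c - 1, …, 1, 0`: in each of them `y` replaces
the lowest entry that is at most `y`, which is bumped further to the left.  Returns the new tableau
and the entry bumped out of the first column. -/
def reverseColumns : ℕ → Tableau ℕ → ℕ → Tableau ℕ × ℕ
  | 0, P, y => (P, y)
  | c + 1, P, y =>
    let k := Nat.findGreatest (fun k => (P.entry k c).any (fun z => decide (z ≤ y))) P.length
    reverseColumns c (P.setEntry k c y) ((P.entry k c).getD 0)

/-- Reverse column bumping that starts by removing the last box of row `r`. -/
def reverseColumnBump (P : Tableau ℕ) (r : ℕ) : Tableau ℕ × ℕ :=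
  let c := (P.getD r []).length - 1
  reverseColumns c (P.removeBox r) ((P.entry r c).getD 0)

/-- The triples `(P̃, P, L)`. -/
abbrev Triple (m n : ℕ) := Tableau (Letter m n) × Tableau ℕ × TwoLine ℕ

/-- One step of the spo-correspondence, for a column with top entry `p.1` and bottom entry `p.2`. -/
def correspondenceStep {m n : ℕ} (t : Triple m n) (p : ℕ × Letter m n) : Triple m n :=
  match spoInsert t.1 p.2 with
  | (T', .added r) => (T', t.2.1.addBox r p.1, t.2.2)
  | (T', .removed r) =>
    (T', (reverseColumnBump t.2.1 r).1, t.2.2 ++ [(p.1, (reverseColumnBump t.2.1 r).2)])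

/-- The spo-correspondence: the columns of `π` are processed from left to right. -/
def correspondence {m n : ℕ} (π : TwoLine (Letter m n)) : Triple m n :=
  π.foldl correspondenceStep ([], [], [])

/-- The triples of an spo-tableau, a semistandard tableau of the same shape with entries in
`{1, …, q}`, and a Burge two-line array. -/
def triples (m n q : ℕ) : Set (Triple m n) :=
  {t | IsSpoTableau t.1 ∧ IsSemistandard q t.2.1 ∧ t.2.1.shape = t.1.shape ∧
    t.2.2 ∈ burgeArrays q}

end Spo

/-! Record a tableau by the shapes `μ k` formed by its letters of rank less than `k`. An spo-tableau
becomes a chain of partitions growing by horizontal strips for letters of `B₀` and by vertical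
strips for letters of `B₁`, with a bound on the number of rows of the early shapes (`IsPattern`).
One insertion changes each of these shapes by at most one box: a box is gained while letters bump,
nothing changes at the level where two letters cancel, and a box is lost during the slides. As in a
growth diagram, the change at level `k + 1` is tied to the change at level `k` by local rules
(`Trans`), and `spoInsert_isPath` shows that the insertion follows them.

Statements about insertion thus become checks of the local rules. Read upwards the rules are
deterministic (`IsPath.state_unique`). Read downwards from the last state they are deterministic too
(`IsPath.source_unique`), so the result and the position of the changed box determine the tableau
and the letter. Every corner can be the box just added, and every addable position in the first `m`
rows can be that of the box just removed (`exists_isPath`). Running two paths side by side gives the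
analogue of the row bumping lemma (`IsPath.rowOrdered`, `IsPath.colOrdered`).

Reverse column bumping needs no theory of its own. Columns of a semistandard tableau, read as rows,
form a filling over an alphabet with empty `B₀`, and undoing a reverse column bumping is an
insertion there, so the same path lemmas apply with `m = 0`.

The array is handled from its last column. Among the columns with top entry `i` the cancellations
precede the additions. While they last, `P` contains no `i`, so the expelled entries are smaller
than `i`, and they increase weakly; afterwards the boxes `i` are added in rows that move weakly
upwards. This is the predicate `Fits`, and `fits_correspondenceStep_iff` says that it encodes
exactly the order of the bottom entries. Hence the last column can be read off from the triple,
which gives injectivity. For surjectivity a cancellation must be undone: the box that returns to `P`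
lies in a tableau with entries at most `i - 1 ≤ m` and strictly increasing columns, hence in the
first `m` rows. This is where `q ≤ m + 1` enters. -/

namespace Spo

/-! ### Patterns, local rules and paths of states -/

/-- The change of the shape of the letters below a given level caused by one insertion. -/
inductive LevelState : Type
  | idle : LevelState
  | plus (i : ℕ) : LevelState
  | pend : LevelState
  | minus (i : ℕ) : LevelState

namespace LevelState

/-- `s.Apply α α'` says that `α'` is the result of applying the change `s` to the shape `α`. -/
def Apply : LevelState → (ℕ → ℕ) → (ℕ → ℕ) → Prop
  | idle, α, α' => ∀ j, α' j = α j
  | pend, α, α' => ∀ j, α' j = α j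
  | plus i, α, α' => α' i = α i + 1 ∧ ∀ j, j ≠ i → α' j = α j
  | minus i, α, α' => α i = α' i + 1 ∧ ∀ j, j ≠ i → α' j = α j

/-- The local rule of the spo-insertion of the letter of rank `x`: how the change of the shape `α`
of the letters of rank less than `k` determines that of the shape `β` of the letters of rank at
most `k`. The state `pend` means that the letter `k` is about to enter a row where it meets the next
letter, and that both will be cancelled. -/
inductive Trans (m x k : ℕ) (α β : ℕ → ℕ) : LevelState → LevelState → Prop
  | idle : k < x → Trans m x k α β idle idle
  | start : k = x → k < 2 * m → Trans m x k α β idle (plus 0)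
  | startPend : k = x → k = 0 → k < 2 * m → Trans m x k α β idle pend
  | startOdd (j : ℕ) : k = x → 2 * m ≤ k → (∀ l, l < j → α l < β l) → α j = β j →
      Trans m x k α β idle (plus j)
  | stay (i : ℕ) : k < 2 * m → α i = β i → Trans m x k α β (plus i) (plus i)
  | bump (i : ℕ) : k < 2 * m → α i < β i → 2 * (i + 1) ≤ k →
      Trans m x k α β (plus i) (plus (i + 1))
  | bumpPend (i : ℕ) : k < 2 * m → α i < β i → 2 * (i + 1) = k → Trans m x k α β (plus i) pend
  | plusOdd (i j : ℕ) : 2 * m ≤ k → i ≤ j → (∀ l, i ≤ l → l < j → α l < β l) → α j = β j →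
      Trans m x k α β (plus i) (plus j)
  | cancel (r : ℕ) : k < 2 * m → k = 2 * r + 1 → α r < β r → Trans m x k α β pend (minus r)
  | slideRight (i : ℕ) : k < 2 * m → β (i + 1) < α i → Trans m x k α β (minus i) (minus i)
  | slideDown (i : ℕ) : k < 2 * m → β (i + 1) = α i → Trans m x k α β (minus i) (minus (i + 1))
  | slideRightOdd (i : ℕ) : 2 * m ≤ k → α i < β i → Trans m x k α β (minus i) (minus i)
  | slideDownOdd (i j : ℕ) : 2 * m ≤ k → α i = β i → i ≤ j → β j = β i → β (j + 1) < β i →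
      Trans m x k α β (minus i) (minus j)

end LevelState

open LevelState

/-- Consecutive shapes `α`, `β` differ by a horizontal strip if the letter `k` belongs to `B₀`,
and by a vertical strip otherwise. -/
structure IsStrip (m k : ℕ) (α β : ℕ → ℕ) : Prop where
  le : ∀ i, α i ≤ β i
  horiz : k < 2 * m → ∀ i, β (i + 1) ≤ α i
  vert : 2 * m ≤ k → ∀ i, β i ≤ α i + 1

/-- The sequence of the shapes formed by the letters of rank less than `k` in an spo-tableau, for
`k = 0, …, N`. -/
structure IsPattern (m N : ℕ) (μ : ℕ → ℕ → ℕ) : Prop where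
  zero : ∀ i, μ 0 i = 0
  anti : ∀ k, k ≤ N → Antitone (μ k)
  strip : ∀ k, k < N → IsStrip m k (μ k) (μ (k + 1))
  symplectic : ∀ k, k ≤ N → k ≤ 2 * m → ∀ i, 0 < μ k i → 2 * i < k

/-- `σ` is a sequence of states that leads from `μ` to `μ'` by the insertion of `x`. -/
structure IsPath (m N x : ℕ) (μ μ' : ℕ → ℕ → ℕ) (σ : ℕ → LevelState) : Prop where
  zero : σ 0 = idle
  apply : ∀ k, k ≤ N → (σ k).Apply (μ k) (μ' k)
  trans : ∀ k, k < N → Trans m x k (μ k) (μ (k + 1)) (σ k) (σ (k + 1))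

section Local

variable {m x k : ℕ} {α β α' β' : ℕ → ℕ} {s t : LevelState}

theorem isStrip_of_trans (hs : IsStrip m k α β) (hα : Antitone α)
    (hα' : Antitone α') (h : Trans m x k α β s t) (a : s.Apply α α') (b : t.Apply β β') :
    IsStrip m k α' β' := by
  have h1 := hs.le
  have h2 := hs.horiz
  have h3 := hs.vert
  have ha : ∀ i, α (i + 1) ≤ α i := fun i => hα (Nat.le_succ i)
  have ha' : ∀ i, α' (i + 1) ≤ α' i := fun i => hα' (Nat.le_succ i)
  refine ⟨fun i => ?_, fun hk i => ?_, fun hk i => ?_⟩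
  · have := h1 i
    cases h <;> simp only [Apply] at a b <;> grind [Antitone]
  · have := h2 hk i
    cases h <;> simp only [Apply] at a b <;> grind
  · have := h3 hk i
    cases h <;> simp only [Apply] at a b <;> grind

/-- For a horizontal strip, interlacing with the new smaller shape already forces the new larger
shape to be a partition. For a vertical strip it does not, and the rules are inspected one by one.
-/
theorem antitone_of_trans (hs : IsStrip m k α β) (hα : Antitone α) (hβ : Antitone β)
    (hα' : Antitone α') (h : Trans m x k α β s t) (a : s.Apply α α') (b : t.Apply β β') :
    Antitone β' := by
  have hs' := isStrip_of_trans hs hα hα' h a b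
  apply antitone_nat_of_succ_le
  intro i
  rcases Nat.lt_or_ge k (2 * m) with hk | hk
  · exact (hs'.horiz hk i).trans (hs'.le i)
  · have h1 := hs.le
    have h3 := hs.vert hk
    have ha : ∀ i, α (i + 1) ≤ α i := fun i => hα (Nat.le_succ i)
    have ha' : ∀ i, α' (i + 1) ≤ α' i := fun i => hα' (Nat.le_succ i)
    have hb : ∀ i, β (i + 1) ≤ β i := fun i => hβ (Nat.le_succ i)
    cases h <;> simp only [Apply] at a b <;> grind

end Local

/-- Induction on the level. The symplectic condition survives since `bump` demands `2 * (i + 1) ≤ k`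
before a letter enters row `i + 1`, while the other rules below `2 * m` gain a box only in row `0`
or in a row that has gained one already. -/
theorem IsPath.isPattern {m N x : ℕ} {μ μ' : ℕ → ℕ → ℕ} {σ : ℕ → LevelState}
    (h : IsPath m N x μ μ' σ) (hμ : IsPattern m N μ) : IsPattern m N μ' := by
  have hzero : ∀ i, μ' 0 i = 0 := by
    intro i
    have := h.apply 0 (Nat.zero_le _)
    rw [h.zero] at this
    rw [this i, hμ.zero]
  have hanti : ∀ k, k ≤ N → Antitone (μ' k) := by
    intro k
    induction k with
    | zero => intro _ i j _; simp [hzero]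
    | succ k ih =>
      intro hk
      exact antitone_of_trans (hμ.strip k hk) (hμ.anti k (by omega)) (hμ.anti _ hk) (ih (by omega))
        (h.trans k hk) (h.apply k (by omega)) (h.apply _ hk)
  refine ⟨hzero, hanti, fun k hk => ?_, fun k => ?_⟩
  · exact isStrip_of_trans (hμ.strip k hk) (hμ.anti k (by omega)) (hanti k (by omega))
        (h.trans k hk) (h.apply k (by omega)) (h.apply _ hk)
  · induction k with
    | zero => intro _ _ i hi; simp [hzero] at hi
    | succ k ih =>
      intro hk hm i hi
      have h1 := ih (by omega) (by omega)
      have h2 := hμ.symplectic (k + 1) hk hm i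
      have h3 := h.trans k hk
      have a := h.apply k (by omega)
      have b := h.apply _ hk
      revert h3 a b
      generalize σ k = s
      generalize σ (k + 1) = t
      intro h3 a b
      have := h1 i
      cases h3 <;> simp only [Apply] at a b <;> grind

end Spo

/-! ### Paths are deterministic in both directions -/

namespace Spo

open LevelState

namespace IsPath

variable {m N x y : ℕ} {μ ν μ' ν' μ'' : ℕ → ℕ → ℕ} {σ τ : ℕ → LevelState}

theorem le_of_idle (h : IsPath m N x μ μ' σ) {k : ℕ} (hk : k ≤ N) (hi : σ k = idle) : k ≤ x := by
  cases k with
  | zero => exact Nat.zero_le _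
  | succ k =>
    have h3 := h.trans k hk
    rw [hi] at h3
    generalize σ k = s at h3
    cases h3
    omega

theorem parity_of_pend (h : IsPath m N x μ μ' σ) {k : ℕ} (hk : k ≤ N) (hi : σ k = pend) :
    k < 2 * m ∧ ∃ r, k = 2 * r + 1 := by
  cases k with
  | zero => rw [h.zero] at hi; cases hi
  | succ k =>
    have h3 := h.trans k hk
    rw [hi] at h3
    generalize σ k = s at h3
    cases h3 with
    | startPend h1 h2 h3 => exact ⟨by omega, 0, by omega⟩
    | bumpPend i h1 h2 h3 => exact ⟨by omega, i + 1, by omega⟩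

theorem last (h : IsPath m N x μ μ' σ) (hm : 2 * m ≤ N) (hx : x < N) :
    (∃ i, σ N = plus i) ∨ ∃ i, σ N = minus i := by
  rcases hs : σ N with _ | i | _ | i
  · have := h.le_of_idle le_rfl hs
    omega
  · exact Or.inl ⟨i, rfl⟩
  · have := h.parity_of_pend le_rfl hs
    omega
  · exact Or.inr ⟨i, rfl⟩

/-- The rules leave a choice only for an unbarred letter that may settle in a row or wait there for
its cancellation. The next level decides; it exists because `2 * m ≤ N`. -/
theorem state_unique (h : IsPath m N x μ μ' σ) (h' : IsPath m N x μ ν' τ) (hm : 2 * m ≤ N)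
    (hμ : IsPattern m N μ) : ∀ k, k ≤ N → σ k = τ k := by
  intro k
  induction k with
  | zero => intro _; rw [h.zero, h'.zero]
  | succ k ih =>
    intro hk
    have e := ih (by omega)
    have h1 := h.trans k hk
    have h2 := h'.trans k hk
    have h3 := fun hk => h.trans (k + 1) hk
    have h4 := fun hk => h'.trans (k + 1) hk
    rw [e] at h1
    generalize τ k = s at h1 h2
    generalize τ (k + 1) = t at h2 h4
    generalize σ (k + 1) = t' at h1 h3
    -- At level `2 * r + 1` the state `plus r` can only `stay`, which needs row `r` to be free of
    -- the letter `2 * r + 1`, because bumping that letter would create a violation. `cancel` needs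
    -- this letter in row `r`.
    have key : k + 1 < 2 * m → ∀ r, k = 2 * r → ¬ (t = plus r ∧ t' = pend) ∧
        ¬ (t = pend ∧ t' = plus r) := by
      intro hk r hr
      have h3 := h3 (by omega)
      have h4 := h4 (by omega)
      generalize τ (k + 1 + 1) = u at h4
      generalize σ (k + 1 + 1) = u' at h3
      clear h1 h2
      constructor <;> rintro ⟨rfl, rfl⟩ <;> cases h3 <;> cases h4 <;> grind
    clear h3 h4
    -- The hole of `slideDownOdd` stops in the last row of the given length, and this row is unique.
    have c : ∀ i j l, μ (k + 1) (j + 1) < μ (k + 1) i → μ (k + 1) l = μ (k + 1) i → l ≤ j := by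
      intro i j l h1 h2
      by_contra hl
      have : μ (k + 1) l ≤ μ (k + 1) (j + 1) := hμ.anti (k + 1) hk (by omega)
      omega
    cases h1 with
    | slideDownOdd i j h1 h2 h3 h4 h5 =>
      cases h2 with
      | slideRight | slideDown => omega
      | slideRightOdd => omega
      | slideDownOdd _ j' g1 g2 g3 g4 g5 =>
        rw [le_antisymm (c i j' j g5 h4) (c i j j' h5 g4)]
    | _ => cases h2 <;> grind

theorem result_unique (h : IsPath m N x μ μ' σ) (h' : IsPath m N x μ ν' τ) (hm : 2 * m ≤ N)
    (hμ : IsPattern m N μ) {k : ℕ} (hk : k ≤ N) : μ' k = ν' k := by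
  have h1 := h.apply k hk
  have h2 := h'.apply k hk
  rw [h.state_unique h' hm hμ k hk] at h1
  generalize τ k = s at h1 h2
  funext j
  cases s <;> simp only [Apply] at h1 h2 <;> grind

theorem source_unique_of_state (h : IsPath m N x μ μ' σ) (h' : IsPath m N y ν μ' τ)
    {k : ℕ} (hk : k ≤ N) (e : σ k = τ k) : μ k = ν k := by
  have h1 := h.apply k hk
  have h2 := h'.apply k hk
  rw [e] at h1
  generalize τ k = s at h1 h2
  funext j
  cases s <;> simp only [Apply] at h1 h2 <;> grind

/-- Going down one level, the new shapes and the upper state leave no choice once it is known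
whether the lower state is `pend`. -/
theorem state_unique_below_even (h : IsPath m N x μ μ' σ) (h' : IsPath m N y ν μ' τ)
    (hμ : IsPattern m N μ) (hν : IsPattern m N ν) {k : ℕ} (hk : k < N)
    (hm : k < 2 * m)
    (e : σ (k + 1) = τ (k + 1)) (hp : σ k = pend ↔ τ k = pend) : σ k = τ k := by
  have eβ := h.source_unique_of_state h' hk e
  have h1 := h.trans k hk
  have h2 := h'.trans k hk
  have a1 := h.apply k hk.le
  have a2 := h'.apply k hk.le
  have b1 := h.apply _ hk
  have b2 := h'.apply _ hk
  have s1 := hμ.strip k hk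
  have s2 := hν.strip k hk
  rw [e] at h1 b1
  rw [← eβ] at h2 b2 s2
  revert hp
  generalize σ k = s at *
  generalize τ k = s' at *
  generalize τ (k + 1) = t at *
  clear e eβ h h' hμ hν
  generalize μ k = α at *
  generalize ν k = γ at *
  generalize μ (k + 1) = β at *
  generalize μ' k = α' at *
  generalize μ' (k + 1) = β' at *
  intro hp
  have l1 := s1.le
  have l2 := s2.le
  have q1 := s1.horiz hm
  have q2 := s2.horiz hm
  clear s1 s2
  cases h1 <;> cases h2 <;> simp only [Apply] at a1 a2 b1 b2 <;> grind

theorem state_unique_below_odd (h : IsPath m N x μ μ' σ) (h' : IsPath m N y ν μ' τ)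
    (hμ : IsPattern m N μ) (hν : IsPattern m N ν) {k : ℕ} (hk : k < N)
    (hm : 2 * m ≤ k) (e : σ (k + 1) = τ (k + 1)) : σ k = τ k := by
  have eβ := h.source_unique_of_state h' hk e
  have h1 := h.trans k hk
  have h2 := h'.trans k hk
  have a1 := h.apply k hk.le
  have a2 := h'.apply k hk.le
  have b1 := h.apply _ hk
  have b2 := h'.apply _ hk
  have s1 := hμ.strip k hk
  have s2 := hν.strip k hk
  have c1 := hμ.anti k hk.le
  have c2 := hν.anti k hk.le
  have c3 := (h.isPattern hμ).anti k hk.le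
  rw [e] at h1 b1
  rw [← eβ] at h2 b2 s2
  generalize σ k = s at *
  generalize τ k = s' at *
  generalize τ (k + 1) = t at *
  clear e eβ h h' hμ hν
  generalize μ k = α at *
  generalize ν k = γ at *
  generalize μ (k + 1) = β at *
  generalize μ' k = α' at *
  generalize μ' (k + 1) = β' at *
  have l1 := s1.le
  have l2 := s2.le
  have q1 := s1.vert hm
  have q2 := s2.vert hm
  clear s1 s2
  have d1 : ∀ i j, i ≤ j → α j ≤ α i := fun i j h => c1 h
  have d2 : ∀ i j, i ≤ j → γ j ≤ γ i := fun i j h => c2 h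
  have d3 : ∀ i j, i ≤ j → α' j ≤ α' i := fun i j h => c3 h
  cases h1 <;> cases h2 <;> simp only [Apply] at a1 a2 b1 b2 <;> grind

/-- After `pend` at level `2 * r + 1` the state is `minus r`. A competing path would have to be at
`minus r` or `minus (r - 1)` on that level. The latter contradicts interlacing with the common upper
shape. For the former one looks a level lower: the path through `pend` makes row `r` of the new
shape strictly shorter than row `r - 1` one level below, whereas a hole that has just come down from
row `r - 1` makes them equal. -/
theorem pend_of_pend (h : IsPath m N x μ μ' σ) (h' : IsPath m N y ν μ' τ)
    (hμ : IsPattern m N μ) (hν : IsPattern m N ν) {k : ℕ} (hk : k < N)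
    (hm : k < 2 * m) (e : σ (k + 1) = τ (k + 1)) (hp : σ k = pend) : τ k = pend := by
  obtain ⟨-, r, rfl⟩ := h.parity_of_pend hk.le hp
  have eβ := h.source_unique_of_state h' hk e
  have h1 := h.trans _ hk
  have h2 := h'.trans _ hk
  have g1 := h.trans (2 * r) (by omega)
  have g2 := h'.trans (2 * r) (by omega)
  have a1 := h.apply (2 * r + 1) hk.le
  have a2 := h'.apply (2 * r + 1) hk.le
  have b2 := h'.apply _ hk
  have d1 := h.apply (2 * r) (by omega)
  have d2 := h'.apply (2 * r) (by omega)
  have s1 := (hμ.strip _ hk).horiz hm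
  have s2 := (hμ.strip (2 * r) (by omega)).horiz (by omega)
  -- No letter of rank less than `2 * r` lies in row `r`, so the competing hole cannot already be in
  -- row `r` at level `2 * r`.
  have z := hν.symplectic (2 * r) (by omega) (by omega)
  rw [e, hp] at h1
  rw [hp] at g1 a1
  rw [← eβ] at h2 b2
  generalize τ (2 * r + 1) = s' at *
  generalize τ (2 * r + 1 + 1) = t at *
  generalize σ (2 * r) = u at *
  generalize τ (2 * r) = u' at *
  clear e eβ h h' hμ hν
  generalize μ (2 * r + 1) = α at *
  generalize ν (2 * r + 1) = γ at *
  generalize μ (2 * r + 1 + 1) = β at *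
  generalize μ' (2 * r + 1) = α' at *
  generalize μ' (2 * r + 1 + 1) = β' at *
  generalize μ (2 * r) = ε at *
  generalize ν (2 * r) = ζ at *
  generalize μ' (2 * r) = ε' at *
  have zz := z r
  cases h1
  cases h2 <;> first | rfl | skip
  all_goals cases g1 <;> cases g2 <;> simp only [Apply] at a1 a2 b2 d1 d2 <;> grind

/-- Descending from the last level, all states agree, so all shapes agree. The inserted letter is
the level at which the state stops being `idle`. -/
theorem source_unique (h : IsPath m N x μ μ' σ) (h' : IsPath m N y ν μ' τ)
    (hμ : IsPattern m N μ) (hν : IsPattern m N ν) (hx : x < N)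
    (e : σ N = τ N) : x = y ∧ ∀ k, k ≤ N → μ k = ν k := by
  have key : ∀ d, d ≤ N → σ (N - d) = τ (N - d) := by
    intro d
    induction d with
    | zero => intro _; exact e
    | succ d ih =>
      intro hd
      have ih := ih (by omega)
      obtain ⟨k, hk⟩ : ∃ k, N - (d + 1) = k := ⟨_, rfl⟩
      have hk' : N - d = k + 1 := by omega
      rw [hk'] at ih
      rw [hk]
      rcases Nat.lt_or_ge k (2 * m) with hm | hm
      · exact h.state_unique_below_even h' hμ hν (by omega) hm ih
          ⟨h.pend_of_pend h' hμ hν (by omega) hm ih,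
            h'.pend_of_pend h hν hμ (by omega) hm ih.symm⟩
      · exact h.state_unique_below_odd h' hμ hν (by omega) hm ih
  have key : ∀ k, k ≤ N → σ k = τ k := by
    intro k hk
    have := key (N - k) (by omega)
    rwa [Nat.sub_sub_self hk] at this
  refine ⟨?_, fun k hk => h.source_unique_of_state h' hk (key k hk)⟩
  have start : ∀ {x μ μ' σ}, IsPath m N x μ μ' σ → ∀ k, k < N → σ k = idle →
      σ (k + 1) ≠ idle → k = x := by
    intro x μ μ' σ h k hk h1 h2
    have h3 := h.trans k hk
    rw [h1] at h3
    generalize σ (k + 1) = t at h3 h2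
    cases h3 <;> first | assumption | exact absurd rfl h2
  have hN' : σ N ≠ idle := fun h0 => absurd (h.le_of_idle le_rfl h0) (by omega)
  obtain ⟨k, hk, h1, h2⟩ : ∃ k, k < N ∧ σ k = idle ∧ σ (k + 1) ≠ idle := by
    by_contra hcon
    push Not at hcon
    have : ∀ k, k ≤ N → σ k = idle := by
      intro k
      induction k with
      | zero => intro _; exact h.zero
      | succ k ih => intro hk; exact hcon k hk (ih (by omega))
    exact hN' (this N le_rfl)
  rw [← start h k hk h1 h2]
  exact start h' k hk (key k hk.le ▸ h1) (key (k + 1) hk ▸ h2)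

end IsPath
end Spo

/-! ### Two successive insertions: the row bumping lemma -/

namespace Spo

open LevelState

/-- The relation between the states of two successive insertions whose letters may stand next to
each other in a row. -/
def LevelState.RowOrdered (k : ℕ) : LevelState → LevelState → Prop
  | idle, idle => True
  | idle, _ => False
  | plus _, idle => True
  | plus i, plus j => j ≤ i
  | plus i, pend => k = 2 * i + 1
  | plus _, minus _ => False
  | pend, minus _ => False
  | pend, _ => True
  | minus i, minus j => i ≤ j
  | minus _, _ => True

/-- The relation between the states of two successive insertions of which the second letter may
stand above the first one in a column. -/
def LevelState.ColOrdered (k : ℕ) : LevelState → LevelState → Prop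
  | idle, _ => True
  | plus _, idle => False
  | plus i, plus j => i < j
  | plus _, pend => True
  | plus _, minus _ => True
  | pend, minus j => 2 * j + 1 < k
  | pend, _ => False
  | minus i, minus j => j < i
  | minus _, _ => False

namespace IsPath

variable {m N x y : ℕ} {μ μ' μ'' : ℕ → ℕ → ℕ} {σ τ : ℕ → LevelState}

/-- The comparison of the two changes is carried from level to level. At the last level it says that
additions move weakly up, removals move weakly down, and a removal never follows an addition. -/
theorem rowOrdered (h : IsPath m N x μ μ' σ) (h' : IsPath m N y μ' μ'' τ)
    (hμ : IsPattern m N μ) (hxy : x < y ∨ x = y ∧ x < 2 * m) :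
    ∀ k, k ≤ N → RowOrdered k (σ k) (τ k) := by
  intro k
  induction k with
  | zero => intro _; rw [h.zero, h'.zero]; trivial
  | succ k ih =>
    intro hk
    have ih := ih (by omega)
    have h1 := h.trans k hk
    have h2 := h'.trans k hk
    have a1 := h.apply k (by omega)
    have b1 := h.apply _ hk
    have a2 := h'.apply k (by omega)
    have b2 := h'.apply _ hk
    have hμ' := h.isPattern hμ
    have s1 := hμ.strip k hk
    have s2 := hμ'.strip k hk
    have z1 := hμ.symplectic (k + 1) hk
    have z2 := hμ'.symplectic k (by omega)
    have c1 := hμ'.anti k (by omega)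
    have c2 := (h'.isPattern hμ').anti k (by omega)
    clear h h' hμ hμ'
    generalize σ k = s at *
    generalize σ (k + 1) = t at *
    generalize τ k = s' at *
    generalize τ (k + 1) = t' at *
    generalize μ k = α at *
    generalize μ (k + 1) = β at *
    generalize μ' k = α' at *
    generalize μ' (k + 1) = β' at *
    generalize μ'' k = α'' at *
    generalize μ'' (k + 1) = β'' at *
    rcases s1 with ⟨l1, q1, p1⟩
    rcases s2 with ⟨l2, q2, p2⟩
    -- If the second hole were above row `j`, its row would have lost enough boxes to be shorter
    -- than row `j`, which has at most one letter `k`.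
    have key : ∀ i j l, 2 * m ≤ k → (minus i).Apply α α' → (minus l).Apply α' α'' → α i = β i →
        β j = β i → i ≤ l → i ≤ j → j ≤ l := by
      intro i j l hm a1 a2 h1 h2 h3 h4
      simp only [Apply] at a1 a2
      by_contra hl
      have := p1 hm j
      have := a1.2 j (by omega)
      have := a2.2 j (by omega)
      have := c1 h3
      have := c2 (show l ≤ j by omega)
      omega
    clear c1 c2
    cases h1 with
    | slideDownOdd i j g1 g2 g3 g4 g5 =>
      cases h2 <;> simp only [RowOrdered] at ih ⊢ <;> first | trivial | omega | skip
      all_goals have := key _ _ _ g1 a1 a2 g2 g4 ih g3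
      all_goals omega
    | _ =>
      clear key
      cases h2 <;> simp only [RowOrdered] at ih ⊢ <;> simp only [Apply] at a1 a2 b1 b2 <;> grind

/-- The counterpart for the opposite order of the letters. The two conclusions exclude each other at
the last level, so the changes of shape reveal the order of the letters. -/
theorem colOrdered (h : IsPath m N x μ μ' σ) (h' : IsPath m N y μ' μ'' τ)
    (hμ : IsPattern m N μ) (hxy : y < x ∨ x = y ∧ 2 * m ≤ x) :
    ∀ k, k ≤ N → ColOrdered k (σ k) (τ k) := by
  intro k
  induction k with
  | zero => intro _; rw [h.zero, h'.zero]; trivial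
  | succ k ih =>
    intro hk
    have ih := ih (by omega)
    have h1 := h.trans k hk
    have h2 := h'.trans k hk
    have a1 := h.apply k (by omega)
    have b1 := h.apply _ hk
    have a2 := h'.apply k (by omega)
    have b2 := h'.apply _ hk
    have hμ' := h.isPattern hμ
    have s1 := hμ.strip k hk
    have s2 := hμ'.strip k hk
    have z1 := hμ'.symplectic k (by omega)
    have z2 := (h'.isPattern hμ').symplectic k (by omega)
    have c1 := hμ.anti (k + 1) (by omega)
    have c2 := hμ'.anti (k + 1) (by omega)
    clear h h' hμ hμ'
    generalize σ k = s at *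
    generalize σ (k + 1) = t at *
    generalize τ k = s' at *
    generalize τ (k + 1) = t' at *
    generalize μ k = α at *
    generalize μ (k + 1) = β at *
    generalize μ' k = α' at *
    generalize μ' (k + 1) = β' at *
    generalize μ'' k = α'' at *
    generalize μ'' (k + 1) = β'' at *
    rcases s1 with ⟨l1, q1, p1⟩
    rcases s2 with ⟨l2, q2, p2⟩
    -- A row that has just lost a box is strictly shorter than every row above it. So the run of
    -- equal rows through which the second hole descends ends above row `j`.
    have key : ∀ i j l, (minus j).Apply β β' → l < i → i ≤ j → β' j < β' l := by
      intro i j l b1 h1 h2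
      simp only [Apply] at b1
      have := b1.2 l (by omega)
      have := c1 (show l ≤ j by omega)
      omega
    have key' : ∀ i j l l', (minus j).Apply β β' → l < i → i ≤ j → β' l' = β' l → l' < j := by
      intro i j l l' b1 h1 h2 h3
      simp only [Apply] at b1
      by_contra hl
      have := key i j l b1 h1 h2
      have := c2 (show j ≤ l' by omega)
      omega
    clear c1 c2
    cases h2 with
    | slideDownOdd l l' h2 h3 h4 h5 h6 =>
      cases h1 with
      | slideRight | slideDown => omega
      | slideRightOdd i => exact key' i i l l' b1 ih le_rfl h5
      | slideDownOdd i j h7 h8 h9 => exact key' i j l l' b1 ih h9 h5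
      | _ => simp only [ColOrdered] at ih ⊢; try omega
    | _ =>
      clear key key'
      cases h1 <;> simp only [ColOrdered] at ih ⊢ <;> simp only [Apply] at a1 a2 b1 b2 <;> grind

end IsPath
end Spo

/-! ### Every admissible last state is reached by a path -/

namespace Spo

open LevelState

/-- The states that can occur at level `k` of a path with end `μ`. -/
def LevelState.Admissible (m : ℕ) (μ : ℕ → ℕ → ℕ) (k : ℕ) : LevelState → Prop
  | idle => True
  | plus i => μ k (i + 1) < μ k i
  | pend => k < 2 * m ∧ ∃ r, k = 2 * r + 1 ∧ ∀ l, r = l + 1 → μ k r < μ (2 * r) l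
  | minus i => i < m ∧ (k ≤ 2 * m → 2 * i < k) ∧ (∀ l, i = l + 1 → μ k i < μ k l) ∧
      (k = 2 * i + 1 → ∃ l, i = l + 1 ∧ μ (2 * i) l = μ k i)

/-- The shape to which a change has to be applied in order to obtain a given shape. -/
def LevelState.source : LevelState → (ℕ → ℕ) → ℕ → ℕ
  | idle, γ, j => γ j
  | pend, γ, j => γ j
  | plus i, γ, j => if j = i then γ j - 1 else γ j
  | minus i, γ, j => if j = i then γ j + 1 else γ j

/-- `s` is a possible predecessor of the state `t` in a path. -/
def LevelState.Precedes (m k : ℕ) (s t : LevelState) (γ δ : ℕ → ℕ) : Prop :=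
  ∀ x, (s = idle → x = k) → IsStrip m k (s.source γ) (t.source δ) ∧
    Trans m x k (s.source γ) (t.source δ) s t

section

variable {m N k : ℕ} {μ : ℕ → ℕ → ℕ} {s t : LevelState}

/-- An admissible `plus i` has a nonempty row `i`, so the truncated subtraction in `source` is a
true one. -/
theorem LevelState.Admissible.apply_source (h : s.Admissible m μ k) :
    s.Apply (s.source (μ k)) (μ k) := by
  cases s <;> simp only [Admissible, Apply, source] at * <;> grind

theorem LevelState.Admissible.antitone_source (hμ : Antitone (μ k)) (h : s.Admissible m μ k) :
    Antitone (s.source (μ k)) := by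
  apply antitone_nat_of_succ_le
  intro i
  have : μ k (i + 1) ≤ μ k i := hμ (Nat.le_succ i)
  cases s <;> simp only [Admissible, source] at * <;> grind

theorem exists_precedes_plus (hμ : IsPattern m N μ) (hk : k < N) (hm : k < 2 * m) (j : ℕ)
    (ht : (plus j).Admissible m μ (k + 1)) :
    ∃ s, s.Admissible m μ k ∧ Precedes m k s (plus j) (μ k) (μ (k + 1)) := by
  obtain ⟨l, q, -⟩ := hμ.strip k hk
  have q := q hm
  have z := hμ.symplectic (k + 1) hk (by omega)
  simp only [Admissible] at ht
  -- If the new row `j` contains no letter `k`, the change was already there. Otherwise its last `k`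
  -- arrived from the row above, or is the inserted letter when `j = 0`.
  by_cases h1 : μ k j = μ (k + 1) j
  · refine ⟨plus j, ?_, fun x hx => ⟨⟨fun i => ?_, fun _ i => ?_, fun _ => by omega⟩,
      .stay j hm ?_⟩⟩ <;> simp only [Admissible, source] <;> grind
  · rcases j with _ | j
    · refine ⟨idle, ?_, fun x hx => ⟨⟨fun i => ?_, fun _ i => ?_, fun _ => by omega⟩,
        .start (hx rfl).symm hm⟩⟩ <;> simp only [Admissible, source] <;> grind
    · refine ⟨plus j, ?_, fun x hx => ⟨⟨fun i => ?_, fun _ i => ?_, fun _ => by omega⟩,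
        .bump j hm ?_ ?_⟩⟩ <;> (try simp only [Admissible, source]) <;> grind

theorem exists_precedes_pend (hμ : IsPattern m N μ) (hk : k < N) (hm : k < 2 * m)
    (ht : pend.Admissible m μ (k + 1)) :
    ∃ s, s.Admissible m μ k ∧ Precedes m k s pend (μ k) (μ (k + 1)) := by
  obtain ⟨l, q, -⟩ := hμ.strip k hk
  have q := q hm
  have z := hμ.symplectic k hk.le (by omega)
  simp only [Admissible] at ht
  obtain ⟨h1, r, hr, h2⟩ := ht
  obtain rfl : k = 2 * r := by omega
  rcases r with _ | r
  · refine ⟨idle, ?_, fun x hx => ⟨⟨fun i => ?_, fun _ i => ?_, fun _ => by omega⟩,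
      .startPend (hx rfl).symm rfl hm⟩⟩ <;> simp only [Admissible, source] <;> grind
  · have h2 := h2 r rfl
    have := z (r + 1)
    have := l r
    have := q r
    have := l (r + 1)
    refine ⟨plus r, ?_, fun x hx => ⟨⟨fun i => ?_, fun _ i => ?_, fun _ => by omega⟩,
      .bumpPend r hm ?_ rfl⟩⟩ <;> simp only [Admissible, source] <;> grind

theorem exists_precedes_minus (hμ : IsPattern m N μ) (hk : k < N) (hm : k < 2 * m) (j : ℕ)
    (ht : (minus j).Admissible m μ (k + 1)) :
    ∃ s, s.Admissible m μ k ∧ Precedes m k s (minus j) (μ k) (μ (k + 1)) := by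
  obtain ⟨l, q, -⟩ := hμ.strip k hk
  have q := q hm
  have q2 := fun h => (hμ.strip (2 * j) h).horiz
  simp only [Admissible] at ht
  obtain ⟨h1, h2, h3, h4⟩ := ht
  have h2 := h2 (by omega)
  -- Tight interlacing with the row above means that a letter `k` has moved up out of row `j`, so
  -- the hole came down.
  by_cases hd : ∃ i, j = i + 1 ∧ μ k i = μ (k + 1) j
  · obtain ⟨i, rfl, hi⟩ := hd
    refine ⟨minus i, ?_, fun x hx => ⟨⟨fun i => ?_, fun _ i => ?_, fun _ => by omega⟩,
      .slideDown i hm ?_⟩⟩ <;> simp only [Admissible, source] <;> grind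
  · have hne : k ≠ 2 * j := by
      rintro rfl
      exact hd (h4 rfl)
    have hd' : ∀ i, j = i + 1 → μ (k + 1) j < μ k i := by
      rintro i rfl
      exact lt_of_le_of_ne (q i) fun h => hd ⟨i, rfl, h.symm⟩
    -- At level `2 * j + 1` a hole in row `j` can be older only if it came down from the row above,
    -- which shows as tight interlacing one level lower. Otherwise the hole is created here by a
    -- cancellation.
    by_cases hc : k = 2 * j + 1 ∧ ¬ ∃ i, j = i + 1 ∧ μ (2 * j) i = μ k j
    · obtain ⟨rfl, hc⟩ := hc
      refine ⟨pend, ?_, fun x hx => ⟨⟨fun i => ?_, fun _ i => ?_, fun _ => by omega⟩,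
        .cancel j hm rfl ?_⟩⟩ <;> simp only [Admissible, source] <;> grind
    · refine ⟨minus j, ?_, fun x hx => ⟨⟨fun i => ?_, fun _ i => ?_, fun _ => by omega⟩,
        .slideRight j hm ?_⟩⟩ <;> simp only [Admissible, source] <;> grind

theorem exists_precedes_plus_odd (hμ : IsPattern m N μ) (hk : k < N) (hm : 2 * m ≤ k) (j : ℕ)
    (ht : (plus j).Admissible m μ (k + 1)) :
    ∃ s, s.Admissible m μ k ∧ Precedes m k s (plus j) (μ k) (μ (k + 1)) := by
  obtain ⟨l, -, p⟩ := hμ.strip k hk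
  have p := p hm
  have c : ∀ i, μ (k + 1) (i + 1) ≤ μ (k + 1) i := fun i => hμ.anti (k + 1) hk (Nat.le_succ i)
  simp only [Admissible] at ht
  by_cases h1 : ∃ i, i ≤ j ∧ μ k i = μ (k + 1) i
  -- The change came through the lowest row not below `j` that has no letter `k`; every row from
  -- there to `j` has passed a `k` downwards. If there is no such row, `k` itself was inserted.
  · obtain ⟨i, hi, h2, h3⟩ : ∃ i, i ≤ j ∧ μ k i = μ (k + 1) i ∧
        ∀ a, i < a → a ≤ j → μ k a < μ (k + 1) a := by
      obtain ⟨i, hi, h2⟩ := h1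
      refine ⟨Nat.findGreatest (fun i => μ k i = μ (k + 1) i) j, Nat.findGreatest_le _,
        Nat.findGreatest_spec (P := fun i => μ k i = μ (k + 1) i) hi h2, fun a h4 h5 => ?_⟩
      exact lt_of_le_of_ne (l a) (Nat.findGreatest_is_greatest (P := fun i => μ k i = μ (k + 1) i) h4 h5)
    refine ⟨plus i, ?_, fun x hx => ⟨⟨fun i => ?_, fun _ => by omega, fun _ i => ?_⟩,
      .plusOdd i j hm hi ?_ ?_⟩⟩ <;> simp only [Admissible, source] <;> grind
  · push Not at h1
    refine ⟨idle, ?_, fun x hx => ⟨⟨fun i => ?_, fun _ => by omega, fun _ i => ?_⟩,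
      .startOdd j (hx rfl).symm hm ?_ ?_⟩⟩ <;> simp only [Admissible, source] <;> grind

theorem exists_precedes_minus_odd (hμ : IsPattern m N μ) (hk : k < N) (hm : 2 * m ≤ k) (j : ℕ)
    (ht : (minus j).Admissible m μ (k + 1)) :
    ∃ s, s.Admissible m μ k ∧ Precedes m k s (minus j) (μ k) (μ (k + 1)) := by
  obtain ⟨l, -, p⟩ := hμ.strip k hk
  have p := p hm
  have c : ∀ i, μ (k + 1) (i + 1) ≤ μ (k + 1) i := fun i => hμ.anti (k + 1) hk (Nat.le_succ i)
  have c1 := hμ.anti (k + 1) hk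
  have c2 := hμ.anti k hk.le
  simp only [Admissible] at ht
  obtain ⟨h1, -, h3, -⟩ := ht
  by_cases hj : μ k j < μ (k + 1) j
  · refine ⟨minus j, ?_, fun x hx => ⟨⟨fun i => ?_, fun _ => by omega, fun _ i => ?_⟩,
      .slideRightOdd j hm ?_⟩⟩ <;> simp only [Admissible, source] <;> grind
  · have hj : μ k j = μ (k + 1) j := le_antisymm (l j) (by omega)
    -- The hole descended from the top of the run of rows of equal length at level `k`; only there
    -- can the smaller shape regain a box.
    obtain ⟨i, hi, h4, h5⟩ : ∃ i, i ≤ j ∧ μ k i = μ k j ∧ ∀ a, i = a + 1 → μ k i < μ k a := by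
      classical
      have hex : ∃ i, μ k i = μ k j := ⟨j, rfl⟩
      refine ⟨Nat.find hex, Nat.find_min' hex rfl, Nat.find_spec hex, fun a ha => ?_⟩
      refine lt_of_le_of_ne (c2 (by omega)) fun h => ?_
      exact Nat.find_min hex (m := a) (by omega) (h ▸ Nat.find_spec hex)
    have h6 : i < j → μ (k + 1) i = μ (k + 1) j + 1 := by
      intro hij
      obtain ⟨a, rfl⟩ : ∃ a, j = a + 1 := ⟨j - 1, by omega⟩
      have := h3 a rfl
      have := c1 (show i ≤ a by omega)
      have := p i
      omega
    refine ⟨minus i, ?_, fun x hx => ⟨⟨fun i => ?_, fun _ => by omega, fun _ i => ?_⟩,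
      .slideDownOdd i j hm ?_ hi ?_ ?_⟩⟩ <;> simp only [Admissible, source] <;> grind

theorem exists_precedes (hμ : IsPattern m N μ) (hk : k < N) (ht : t.Admissible m μ (k + 1))
    (hi : t ≠ idle) : ∃ s, s.Admissible m μ k ∧ Precedes m k s t (μ k) (μ (k + 1)) := by
  rcases Nat.lt_or_ge k (2 * m) with hm | hm
  · rcases t with _ | j | _ | j
    · exact absurd rfl hi
    · exact exists_precedes_plus hμ hk hm j ht
    · exact exists_precedes_pend hμ hk hm ht
    · exact exists_precedes_minus hμ hk hm j ht
  · rcases t with _ | j | _ | j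
    · exact absurd rfl hi
    · exact exists_precedes_plus_odd hμ hk hm j ht
    · obtain ⟨h, -⟩ := ht
      omega
    · exact exists_precedes_minus_odd hμ hk hm j ht

end

/-- Every admissible final state is the end of a path. -/
theorem exists_isPath {m N : ℕ} {μ' : ℕ → ℕ → ℕ} (hμ : IsPattern m N μ') :
    ∀ k, k ≤ N → ∀ t : LevelState, t.Admissible m μ' k → t ≠ idle →
      ∃ x < k, ∃ μ σ, IsPattern m k μ ∧ IsPath m k x μ μ' σ ∧ σ k = t ∧
        μ k = t.source (μ' k) := by
  intro k
  induction k with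
  | zero =>
    intro _ t ht hi
    have z := hμ.zero
    cases t <;> simp only [Admissible] at ht <;> grind
  | succ k ih =>
    intro hk t ht hi
    obtain ⟨s, hs, hp⟩ := exists_precedes hμ hk ht hi
    have hz : k + 1 ≤ 2 * m → ∀ i, 0 < t.source (μ' (k + 1)) i → 2 * i < k + 1 := by
      intro hm i
      have := hμ.symplectic (k + 1) hk hm i
      cases t <;> simp only [source, Admissible] at ht ⊢ <;> grind
    -- With an idle predecessor the path begins here: `k` is the inserted letter and nothing changes
    -- at or below level `k`. Otherwise the path supplied by the induction is extended by one level.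
    by_cases hs0 : s = idle
    · subst hs0
      obtain ⟨h1, h2⟩ := hp k fun _ => rfl
      have e : idle.source (μ' k) = μ' k := rfl
      rw [e] at h1 h2
      refine ⟨k, by omega, fun j => if j ≤ k then μ' j else t.source (μ' j),
        fun j => if j ≤ k then idle else t, ⟨?_, ?_, ?_, ?_⟩, ⟨?_, ?_, ?_⟩, ?_, ?_⟩
      · simpa using hμ.zero
      · intro j hj
        rcases Nat.lt_or_ge k j with h | h
        · obtain rfl : j = k + 1 := by omega
          simpa using ht.antitone_source (hμ.anti _ hk)
        · simpa [h] using hμ.anti j (by omega)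
      · intro j hj
        rcases Nat.lt_or_ge j k with h | h
        · simpa [h, h.le, Nat.succ_le_of_lt h] using hμ.strip j (by omega)
        · obtain rfl : j = k := by omega
          simpa using h1
      · intro j hj hm i
        rcases Nat.lt_or_ge k j with h | h
        · obtain rfl : j = k + 1 := by omega
          simpa using hz hm i
        · simpa [h] using hμ.symplectic j (by omega) hm i
      · simp
      · intro j hj
        rcases Nat.lt_or_ge k j with h | h
        · obtain rfl : j = k + 1 := by omega
          simpa using ht.apply_source
        · simp [h, Apply]
      · intro j hj
        rcases Nat.lt_or_ge j k with h | h
        · simpa [h, h.le, Nat.succ_le_of_lt h] using Trans.idle h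
        · obtain rfl : j = k := by omega
          simpa using h2
      · simp
      · simp
    · obtain ⟨x, hx, μ, σ, hP, hpath, hσ, hμk⟩ := ih (by omega) s hs hs0
      obtain ⟨h1, h2⟩ := hp x fun h => absurd h hs0
      refine ⟨x, by omega, fun j => if j ≤ k then μ j else t.source (μ' j),
        fun j => if j ≤ k then σ j else t, ⟨?_, ?_, ?_, ?_⟩, ⟨?_, ?_, ?_⟩, ?_, ?_⟩
      · simpa using hP.zero
      · intro j hj
        rcases Nat.lt_or_ge k j with h | h
        · obtain rfl : j = k + 1 := by omega
          simpa using ht.antitone_source (hμ.anti _ hk)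
        · simpa [h] using hP.anti j (by omega)
      · intro j hj
        rcases Nat.lt_or_ge j k with h | h
        · simpa [h, h.le, Nat.succ_le_of_lt h] using hP.strip j (by omega)
        · obtain rfl : j = k := by omega
          simpa [hμk] using h1
      · intro j hj hm i
        rcases Nat.lt_or_ge k j with h | h
        · obtain rfl : j = k + 1 := by omega
          simpa using hz hm i
        · simpa [h] using hP.symplectic j (by omega) hm i
      · simpa using hpath.zero
      · intro j hj
        rcases Nat.lt_or_ge k j with h | h
        · obtain rfl : j = k + 1 := by omega
          simpa using ht.apply_source
        · simpa [h] using hpath.apply j h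
      · intro j hj
        rcases Nat.lt_or_ge j k with h | h
        · simpa [h, h.le, Nat.succ_le_of_lt h] using hpath.trans j h
        · obtain rfl : j = k := by omega
          simpa [hμk, hσ] using h2
      · simp
      · simp

end Spo

/-! ### Fillings and patterns -/

namespace Spo

/-- An infinite filling in which `N` marks the absent boxes, and which is an spo-tableau otherwise;
letters are represented by their ranks. -/
structure IsFilling (m N : ℕ) (f : ℕ → ℕ → ℕ) : Prop where
  le : ∀ i c, f i c ≤ N
  row : ∀ i c, f i c ≤ f i (c + 1)
  row_strict : ∀ i c, f i c = f i (c + 1) → f i c < 2 * m ∨ f i c = N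
  col : ∀ i c, f i c ≤ f (i + 1) c
  col_strict : ∀ i c, f i c = f (i + 1) c → 2 * m ≤ f i c
  symplectic : ∀ i c, f i c < 2 * m → 2 * i ≤ f i c
  bounded : ∃ B, ∀ i c, B ≤ i ∨ B ≤ c → f i c = N

/-- The numbers `μ k i` count the entries less than `k` in row `i` of `f`. -/
def Encodes (N : ℕ) (f μ : ℕ → ℕ → ℕ) : Prop :=
  ∀ k, k ≤ N → ∀ i c, f i c < k ↔ c < μ k i

variable {m N : ℕ} {f g μ ν : ℕ → ℕ → ℕ}

theorem IsFilling.row_mono (hf : IsFilling m N f) (i : ℕ) : Monotone (f i) :=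
  monotone_nat_of_le_succ (hf.row i)

theorem exists_encodes (hrow : ∀ i, Monotone (f i)) (hb : ∃ B, ∀ i c, B ≤ c → N ≤ f i c) :
    ∃ μ, Encodes N f μ := by
  obtain ⟨B, hB⟩ := hb
  classical
  refine ⟨fun k i => Nat.findGreatest (fun c => ∀ d, d < c → f i d < k) B, fun k hk i c => ?_⟩
  have h0 := Nat.findGreatest_spec (P := fun c => ∀ d, d < c → f i d < k) (n := B) (m := 0)
    (Nat.zero_le _) (by simp)
  constructor
  · intro h
    have hc : c < B := by
      by_contra hc
      have := hB i c (by omega)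
      omega
    refine Nat.lt_of_lt_of_le (Nat.lt_succ_self c) (Nat.le_findGreatest hc ?_)
    intro d hd
    exact (hrow i (Nat.le_of_lt_succ hd)).trans_lt h
  · exact h0 c

theorem le_of_forall_lt_imp {a b : ℕ} (h : ∀ c, c < a → c < b) : a ≤ b := by
  by_contra hab
  exact lt_irrefl b (h b (by omega))

/-- Strict columns on `B₀` make the boxes of one letter a horizontal strip, and strict rows on `B₁`
make them a vertical strip. For the symplectic bound the first entry of a row suffices. -/
theorem Encodes.isPattern (h : Encodes N f μ) (hf : IsFilling m N f) :
    IsPattern m N μ := by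
  refine ⟨fun i => ?_, fun k hk => ?_, fun k hk => ⟨fun i => ?_, fun hm i => ?_, fun hm i => ?_⟩,
    fun k hk hm i hi => ?_⟩
  · have := h 0 (Nat.zero_le _) i 0
    omega
  · refine antitone_nat_of_succ_le fun i => le_of_forall_lt_imp fun c hc => ?_
    rw [← h k hk] at hc ⊢
    exact (hf.col i c).trans_lt hc
  · refine le_of_forall_lt_imp fun c hc => ?_
    rw [← h k hk.le] at hc
    rw [← h _ hk]
    omega
  · refine le_of_forall_lt_imp fun c hc => ?_
    rw [← h _ hk] at hc
    rw [← h k hk.le]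
    have h1 := hf.col i c
    have h2 := hf.col_strict i c
    omega
  · by_contra hcon
    have h1 := (h (k + 1) hk i (μ k i + 1)).2 (by omega)
    have h2 := (h k hk.le i (μ k i)).not.2 (by omega)
    have h3 := hf.row i (μ k i)
    have h4 := hf.row_strict i (μ k i)
    omega
  · have h1 := (h k hk i 0).2 hi
    have h2 := hf.symplectic i 0 (by omega)
    omega

theorem Encodes.isFilling (h : Encodes N f μ) (hμ : IsPattern m N μ) (hm : 2 * m ≤ N)
    (hle : ∀ i c, f i c ≤ N) (hb : ∃ B, ∀ i, B ≤ i → μ N i = 0) : IsFilling m N f := by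
  have hrow : ∀ i c, f i c ≤ f i (c + 1) := by
    intro i c
    rcases (hle i (c + 1)).lt_or_eq with h1 | h1
    · have h2 := (h (f i (c + 1) + 1) h1 i (c + 1)).1 (by omega)
      have h3 := (h (f i (c + 1) + 1) h1 i c).2 (by omega)
      omega
    · rw [h1]; exact hle i c
  have hcol : ∀ i c, f i c ≤ f (i + 1) c := by
    intro i c
    rcases (hle (i + 1) c).lt_or_eq with h1 | h1
    · have h2 := (h (f (i + 1) c + 1) h1 (i + 1) c).1 (by omega)
      have h3 := (h (f (i + 1) c + 1) h1 i c).2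
        (h2.trans_le (hμ.anti _ h1 (Nat.le_succ i)))
      omega
    · rw [h1]; exact hle i c
  refine ⟨hle, hrow, fun i c e => ?_, hcol, fun i c e => ?_, fun i c hlt => ?_, ?_⟩
  · by_contra hcon
    have h0 : f i c < N := by have := hle i c; omega
    have h1 := (h (f i c) h0.le i c)
    have h2 := (h (f i c + 1) h0 i (c + 1))
    have h3 := (hμ.strip (f i c) h0).vert (by omega) i
    omega
  · by_contra hcon
    have h1 := (h (f i c) (by omega) i c)
    have h2 := (h (f i c + 1) (by omega) (i + 1) c)
    have h3 := (hμ.strip (f i c) (by omega)).horiz (by omega) i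
    omega
  · have h1 := (h (f i c + 1) (by omega) i c)
    have h2 := hμ.symplectic (f i c + 1) (by omega) (by omega) i (by omega)
    omega
  · obtain ⟨B, hB⟩ := hb
    refine ⟨max B (μ N 0), fun i c hic => ?_⟩
    have h1 := h N le_rfl i c
    have h2 := hle i c
    have h3 := hμ.anti N le_rfl (Nat.zero_le i)
    rcases hic with hic | hic
    · have := hB i (by omega)
      omega
    · omega

theorem Encodes.bounded (h : Encodes N f μ) (hf : IsFilling m N f) :
    ∃ B, ∀ i, B ≤ i → μ N i = 0 := by
  obtain ⟨B, hB⟩ := hf.bounded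
  refine ⟨B, fun i hi => ?_⟩
  have := hB i 0 (Or.inl hi)
  have := h N le_rfl i 0
  omega

theorem IsFilling.exists_encodes (hf : IsFilling m N f) : ∃ μ, Encodes N f μ := by
  obtain ⟨B, hB⟩ := hf.bounded
  exact Spo.exists_encodes hf.row_mono ⟨B, fun i c hc => (hB i c (Or.inr hc)).ge⟩

theorem Encodes.eq (hf : Encodes N f μ) (hg : Encodes N g μ) (h1 : ∀ i c, f i c ≤ N)
    (h2 : ∀ i c, g i c ≤ N) : f = g := by
  funext i c
  have a1 := h1 i c
  have a2 := h2 i c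
  rcases lt_trichotomy (f i c) (g i c) with h | h | h
  · have := (hf (g i c) a2 i c).trans (hg (g i c) a2 i c).symm
    omega
  · exact h
  · have := (hf (f i c) a1 i c).trans (hg (f i c) a1 i c).symm
    omega

theorem Encodes.congr (hf : Encodes N f μ) (h : ∀ k, k ≤ N → μ k = ν k) : Encodes N f ν := by
  intro k hk i c
  rw [← h k hk]
  exact hf k hk i c

theorem IsPattern.exists_filling (hμ : IsPattern m N μ) (hm : 2 * m ≤ N)
    (hb : ∃ B, ∀ i, B ≤ i → μ N i = 0) : ∃ f, IsFilling m N f ∧ Encodes N f μ := by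
  have hmono : ∀ i k l, k ≤ l → l ≤ N → μ k i ≤ μ l i := by
    intro i k l hkl
    induction l, hkl using Nat.le_induction with
    | base => intro _; exact le_rfl
    | succ l hkl ih => intro hl; exact (ih (by omega)).trans ((hμ.strip l hl).le i)
  -- The box in column `c` holds the letter `k` for which `μ k i ≤ c < μ (k + 1) i`; the greatest
  -- `k` with the first inequality is `N` exactly when the box is absent.
  let f : ℕ → ℕ → ℕ := fun i c => Nat.findGreatest (fun k => μ k i ≤ c) N
  have hle : ∀ i c, f i c ≤ N := fun i c => Nat.findGreatest_le _
  have hf : Encodes N f μ := by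
    intro k hk i c
    constructor
    · intro h
      by_contra hc
      exact Nat.findGreatest_is_greatest (P := fun k => μ k i ≤ c) h hk (by omega)
    · intro h
      by_contra hc
      have h1 := Nat.findGreatest_spec (P := fun k => μ k i ≤ c) (n := N) (m := 0)
        (Nat.zero_le _) (by rw [hμ.zero]; omega)
      have h2 := hmono i k (f i c) (by omega) (hle i c)
      have h3 : μ (f i c) i ≤ c := h1
      omega
  exact ⟨f, hf.isFilling hμ hm hle hb, hf⟩

/-! ### Tableaux as functions of row and column -/

namespace Tableau

variable {α : Type}

/-- The length of row `i`. -/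
def rowLen (T : Tableau α) (i : ℕ) : ℕ := (T.getD i []).length

/-- All rows are nonempty. -/
def NoEmptyRow (T : Tableau α) : Prop := ∀ row ∈ T, row ≠ []

/-- The entries as numbers, with `N` for absent boxes. -/
def cell (N : ℕ) (v : α → ℕ) (T : Tableau α) (i c : ℕ) : ℕ := (T.entry i c).elim N v

theorem entry_eq_none_iff {T : Tableau α} {i c : ℕ} : T.entry i c = none ↔ T.rowLen i ≤ c := by
  simp [entry, rowLen]

theorem entry_isSome_iff {T : Tableau α} {i c : ℕ} : (∃ x, T.entry i c = some x) ↔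
    c < T.rowLen i := by
  rw [← not_le, ← entry_eq_none_iff, ← Option.ne_none_iff_exists']

theorem lt_rowLen {T : Tableau α} {i c : ℕ} {x : α} (h : T.entry i c = some x) :
    c < T.rowLen i := entry_isSome_iff.1 ⟨x, h⟩

theorem rowLen_of_length_le {T : Tableau α} {i : ℕ} (h : T.length ≤ i) : T.rowLen i = 0 := by
  rw [rowLen, List.getD_eq_default _ _ h, List.length_nil]

theorem rowLen_pos_iff {T : Tableau α} (h : T.NoEmptyRow) {i : ℕ} :
    0 < T.rowLen i ↔ i < T.length := by
  constructor
  · intro hi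
    by_contra hcon
    rw [rowLen_of_length_le (by omega)] at hi
    omega
  · intro hi
    have := h _ (List.getElem_mem hi)
    rw [rowLen, List.getD_eq_getElem _ _ hi]
    exact List.length_pos_iff.2 this

/-- Nonempty rows are essential here: `entry` does not see trailing empty rows. -/
theorem ext_entry {T T' : Tableau α} (h : T.NoEmptyRow) (h' : T'.NoEmptyRow)
    (he : ∀ i c, T.entry i c = T'.entry i c) : T = T' := by
  have hrow : ∀ i, T.getD i [] = T'.getD i [] := fun i => List.ext_getElem? (he i)
  have hlen : ∀ i, T.rowLen i = T'.rowLen i := fun i => by rw [rowLen, rowLen, hrow]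
  have hl : T.length = T'.length := by
    have h1 : ∀ i, i < T.length ↔ i < T'.length := fun i => by
      rw [← rowLen_pos_iff h, ← rowLen_pos_iff h', hlen]
    have := h1 T.length
    have := h1 T'.length
    omega
  refine List.ext_getElem hl fun i h1 h2 => ?_
  have := hrow i
  rwa [List.getD_eq_getElem _ _ h1, List.getD_eq_getElem _ _ h2] at this

theorem shape_eq_iff {β : Type} {T : Tableau α} {T' : Tableau β} (h : T.NoEmptyRow)
    (h' : T'.NoEmptyRow) : T.shape = T'.shape ↔ ∀ i, T.rowLen i = T'.rowLen i := by
  have key : ∀ {γ : Type} (T : Tableau γ) i, T.rowLen i = T.shape.getD i 0 := by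
    intro γ T i
    rcases Nat.lt_or_ge i T.length with hi | hi
    · rw [rowLen, List.getD_eq_getElem _ _ hi, List.getD_eq_getElem _ _ (by simpa [shape] using hi)]
      simp [shape]
    · rw [rowLen_of_length_le hi, List.getD_eq_default _ _ (by simpa [shape] using hi)]
  constructor
  · intro e i
    rw [key, key, e]
  · intro e
    have hl : T.length = T'.length := by
      have h1 : ∀ i, i < T.length ↔ i < T'.length := fun i => by
        rw [← rowLen_pos_iff h, ← rowLen_pos_iff h', e]
      have := h1 T.length
      have := h1 T'.length
      omega
    refine List.ext_getElem (by simpa [shape] using hl) fun i h1 h2 => ?_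
    have := e i
    rwa [key, key, List.getD_eq_getElem _ _ h1, List.getD_eq_getElem _ _ h2] at this

theorem exists_of_entries (g : ℕ → ℕ → Option α) (hrow : ∀ i c, g i c = none → g i (c + 1) = none)
    (hcol : ∀ i c, g i c = none → g (i + 1) c = none)
    (hb : ∃ B, ∀ i c, B ≤ i ∨ B ≤ c → g i c = none) :
    ∃ T : Tableau α, T.NoEmptyRow ∧ ∀ i c, T.entry i c = g i c := by
  obtain ⟨B, hB⟩ := hb
  have hrow' : ∀ i c d, c ≤ d → g i c = none → g i d = none := by
    intro i c d hcd h
    induction d, hcd using Nat.le_induction with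
    | base => exact h
    | succ d _ ih => exact hrow i d ih
  have hcol' : ∀ c i j, i ≤ j → g i c = none → g j c = none := by
    intro c i j hij h
    induction j, hij using Nat.le_induction with
    | base => exact h
    | succ d _ ih => exact hcol d c ih
  classical
  have hlen : ∀ i, ∃ n, ∀ c, g i c = none ↔ n ≤ c := by
    intro i
    have hex : ∃ c, g i c = none := ⟨B, hB i B (Or.inr le_rfl)⟩
    refine ⟨Nat.find hex, fun c => ⟨fun h => Nat.find_min' hex h, fun h => ?_⟩⟩
    exact hrow' i _ c h (Nat.find_spec hex)
  choose len hlen using hlen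
  have hnum : ∃ n, ∀ i, g i 0 = none ↔ n ≤ i := by
    have hex : ∃ i, g i 0 = none := ⟨B, hB B 0 (Or.inl le_rfl)⟩
    refine ⟨Nat.find hex, fun c => ⟨fun h => Nat.find_min' hex h, fun h => ?_⟩⟩
    exact hcol' 0 _ c h (Nat.find_spec hex)
  obtain ⟨n, hn⟩ := hnum
  have hsome : ∀ i, ∀ c : Fin (len i), (g i c).isSome := by
    intro i c
    rw [Option.isSome_iff_ne_none, Ne, hlen]
    have := c.2
    omega
  refine ⟨List.ofFn fun i : Fin n => List.ofFn fun c : Fin (len i) => (g i c).get (hsome i c),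
    ?_, fun i c => ?_⟩
  · intro row hr
    rw [List.mem_ofFn] at hr
    obtain ⟨i, rfl⟩ := hr
    intro h0
    have h1 : len i = 0 := by simpa using congrArg List.length h0
    have h2 := (hlen i 0).2 (by omega)
    rw [hn] at h2
    have := i.2
    omega
  · rcases Nat.lt_or_ge i n with hi | hi
    · rw [entry, List.getD_eq_getElem _ _ (by simpa using hi)]
      rw [List.getElem_ofFn, List.getElem?_ofFn]
      split_ifs with hc
      · simp
      · exact ((hlen i c).2 (not_lt.1 hc)).symm
    · rw [entry_eq_none_iff.2, hcol' c i i le_rfl (hrow' i 0 c (Nat.zero_le _) ((hn i).2 hi))]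
      rw [rowLen_of_length_le (by simpa using hi)]
      omega

end Tableau

end Spo

/-! ### Spo-tableaux and semistandard tableaux as fillings -/

namespace Spo

open Tableau

namespace Letter

variable {m n : ℕ}

theorem rank_lt (x : Letter m n) : x.rank < 2 * m + n := by
  cases x with
  | plain i | barred i => have := i.2; simp only [rank]; omega
  | circ j => have := j.2; simp only [rank]; omega

theorem exists_rank_eq {k : ℕ} (hk : k < 2 * m + n) : ∃ x : Letter m n, x.rank = k := by
  rcases Nat.lt_or_ge k (2 * m) with h | h
  · rcases Nat.even_or_odd' k with ⟨i, rfl | rfl⟩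
    · exact ⟨plain ⟨i, by omega⟩, rfl⟩
    · exact ⟨barred ⟨i, by omega⟩, rfl⟩
  · exact ⟨circ ⟨k - 2 * m, by omega⟩, by simp only [rank]; omega⟩

theorem isB1_iff {x : Letter m n} : x.IsB1 ↔ 2 * m ≤ x.rank := by
  cases x with
  | plain i | barred i => have := i.2; simp only [rank, IsB1, false_iff]; omega
  | circ j => simp [rank, IsB1]

theorem rowRel_iff {x y : Letter m n} :
    RowRel x y ↔ x.rank < y.rank ∨ x.rank = y.rank ∧ x.rank < 2 * m := by
  rw [RowRel, isB1_iff, not_le, ← rank_injective.eq_iff]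
  rfl

theorem colRel_iff {x y : Letter m n} :
    ColRel x y ↔ x.rank < y.rank ∨ x.rank = y.rank ∧ 2 * m ≤ x.rank := by
  rw [ColRel, isB1_iff, ← rank_injective.eq_iff]
  rfl

theorem violates_iff {r : ℕ} {x : Letter m n} :
    Violates r x ↔ x.rank < 2 * m ∧ x.rank < 2 * r := by
  cases x with
  | plain i | barred i => have := i.2; simp only [rank, Violates]; omega
  | circ j => simp [rank, Violates]

end Letter

namespace Tableau

variable {α : Type} {N : ℕ} {v : α → ℕ} {T : Tableau α} {i c : ℕ}

theorem cell_of_some {x : α} (h : T.entry i c = some x) : T.cell N v i c = v x := by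
  simp [cell, h]

theorem cell_of_none (h : T.entry i c = none) : T.cell N v i c = N := by
  simp [cell, h]

theorem cell_lt_iff (hv : ∀ x, T.entry i c = some x → v x < N) :
    T.cell N v i c < N ↔ c < T.rowLen i := by
  rw [← entry_isSome_iff]
  rcases h : T.entry i c with _ | x
  · simp [cell_of_none h]
  · simp [cell_of_some h, hv x h]

theorem exists_entry_of_cell_lt (h : T.cell N v i c < N) :
    ∃ x, T.entry i c = some x ∧ v x = T.cell N v i c := by
  rcases h' : T.entry i c with _ | x
  · rw [cell_of_none h'] at h
    omega
  · exact ⟨x, rfl, (cell_of_some h').symm⟩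

theorem bounded_rowLen (T : Tableau α) : ∃ B, ∀ i c, B ≤ i ∨ B ≤ c → T.rowLen i ≤ c := by
  have h1 : ∃ B, ∀ i, T.rowLen i ≤ B := by
    refine ⟨(T.map List.length).sum, fun i => ?_⟩
    rcases Nat.lt_or_ge i T.length with hi | hi
    · rw [rowLen, List.getD_eq_getElem _ _ hi]
      exact List.single_le_sum (by simp) _ (List.mem_map_of_mem (List.getElem_mem hi))
    · rw [rowLen_of_length_le hi]
      omega
  obtain ⟨B, hB⟩ := h1
  refine ⟨max B T.length, fun i c h => ?_⟩
  rcases h with h | h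
  · rw [rowLen_of_length_le (by omega)]
    omega
  · have := hB i
    omega

theorem isTableau_shape {R C : α → α → Prop} (h : IsTableau R C T) :
    T.NoEmptyRow ∧ ∀ i, T.rowLen (i + 1) ≤ T.rowLen i := by
  constructor
  · intro row hr h0
    have := h.shape_pos row.length (List.mem_map_of_mem hr)
    simp [h0] at this
  · intro i
    rcases Nat.lt_or_ge (i + 1) T.length with hi | hi
    · have := List.pairwise_iff_getElem.1 h.shape_anti i (i + 1) (by simp [shape]; omega)
        (by simpa [shape] using hi) (Nat.lt_succ_self i)
      rw [rowLen, rowLen, List.getD_eq_getElem _ _ hi,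
        List.getD_eq_getElem _ _ (Nat.lt_of_succ_lt hi)]
      simpa [shape] using this
    · rw [rowLen_of_length_le hi]
      omega

theorem isTableau_of {R C : α → α → Prop} (h : T.NoEmptyRow)
    (ha : ∀ i, T.rowLen (i + 1) ≤ T.rowLen i)
    (hr : ∀ r c x y, T.entry r c = some x → T.entry r (c + 1) = some y → R x y)
    (hc : ∀ r c x y, T.entry r c = some x → T.entry (r + 1) c = some y → C x y) :
    IsTableau R C T := by
  refine ⟨fun l hl => ?_, ?_, hr, hc⟩
  · obtain ⟨row, hrow, rfl⟩ := List.mem_map.1 hl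
    exact List.length_pos_iff.2 (h row hrow)
  · rw [List.pairwise_iff_getElem]
    intro i j hi hj hij
    have := (antitone_nat_of_succ_le ha) hij.le
    have hi' : i < T.length := by simpa [shape] using hi
    have hj' : j < T.length := by simpa [shape] using hj
    rw [rowLen, rowLen, List.getD_eq_getElem _ _ hi', List.getD_eq_getElem _ _ hj'] at this
    simpa [shape] using this

end Tableau

section Spo

variable {m n : ℕ} {T T' : Tableau (Letter m n)}

/-- The ranks of the entries, with `2 * m + n` for absent boxes. -/
def ranks (T : Tableau (Letter m n)) : ℕ → ℕ → ℕ := T.cell (2 * m + n) Letter.rank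

theorem ranks_lt_iff {i c : ℕ} : ranks T i c < 2 * m + n ↔ c < T.rowLen i :=
  cell_lt_iff fun x _ => x.rank_lt

theorem ranks_le (T : Tableau (Letter m n)) (i c : ℕ) : ranks T i c ≤ 2 * m + n := by
  rcases h : T.entry i c with _ | x
  · exact (cell_of_none h).le
  · rw [ranks, cell_of_some h]
    exact x.rank_lt.le

theorem IsSpoTableau.isFilling (h : IsSpoTableau T) : IsFilling m (2 * m + n) (ranks T) := by
  obtain ⟨hne, ha⟩ := isTableau_shape h.isTableau
  have hlast : ∀ i c, ¬ ranks T i c < 2 * m + n → ranks T i c = 2 * m + n := fun i c hlt => by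
    have := ranks_le T i c
    omega
  have hrow : ∀ i c, ranks T i c < ranks T i (c + 1) ∨ ranks T i c = ranks T i (c + 1) ∧
      (ranks T i c < 2 * m ∨ ranks T i c = 2 * m + n) := by
    intro i c
    by_cases h2 : ranks T i (c + 1) < 2 * m + n
    · have h1 : ranks T i c < 2 * m + n := by
        rw [ranks_lt_iff] at h2 ⊢
        omega
      obtain ⟨x, hx, hx'⟩ := exists_entry_of_cell_lt h1
      obtain ⟨y, hy, hy'⟩ := exists_entry_of_cell_lt h2
      have := Letter.rowRel_iff.1 (h.isTableau.row i c x y hx hy)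
      rw [ranks, ← hx', ← hy']
      omega
    · have := hlast _ _ h2
      have := ranks_le T i c
      omega
  have hcol : ∀ i c, ranks T i c < ranks T (i + 1) c ∨ ranks T i c = ranks T (i + 1) c ∧
      2 * m ≤ ranks T i c := by
    intro i c
    by_cases h2 : ranks T (i + 1) c < 2 * m + n
    · have h1 : ranks T i c < 2 * m + n := by
        rw [ranks_lt_iff] at h2 ⊢
        have := ha i
        omega
      obtain ⟨x, hx, hx'⟩ := exists_entry_of_cell_lt h1
      obtain ⟨y, hy, hy'⟩ := exists_entry_of_cell_lt h2
      have := Letter.colRel_iff.1 (h.isTableau.col i c x y hx hy)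
      rw [ranks, ← hx', ← hy']
      omega
    · have := hlast _ _ h2
      have := ranks_le T i c
      omega
  refine ⟨ranks_le T, fun i c => ?_, fun i c e => ?_, fun i c => ?_, fun i c e => ?_,
    fun i c hlt => ?_, ?_⟩
  · have := hrow i c
    omega
  · have := hrow i c
    omega
  · have := hcol i c
    omega
  · have := hcol i c
    omega
  · obtain ⟨x, hx, hx'⟩ := exists_entry_of_cell_lt (show ranks T i c < 2 * m + n by omega)
    have := h.symplectic i c x hx
    rw [Letter.violates_iff] at this
    rw [ranks, ← hx'] at hlt ⊢
    omega
  · obtain ⟨B, hB⟩ := bounded_rowLen T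
    refine ⟨B, fun i c hic => hlast i c ?_⟩
    rw [ranks_lt_iff, not_lt]
    exact hB i c hic

theorem isSpoTableau_of_isFilling (h : T.NoEmptyRow)
    (hf : IsFilling m (2 * m + n) (ranks T)) : IsSpoTableau T := by
  refine ⟨isTableau_of h (fun i => ?_) (fun r c x y hx hy => ?_) (fun r c x y hx hy => ?_),
    fun r c x hx => ?_⟩
  · refine le_of_forall_lt_imp fun c hc => ?_
    rw [← ranks_lt_iff] at hc ⊢
    exact (hf.col i c).trans_lt hc
  · have h1 := hf.row r c
    have h2 := hf.row_strict r c
    rw [ranks, cell_of_some hx, cell_of_some hy] at h1 h2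
    rw [Letter.rowRel_iff]
    have := x.rank_lt
    omega
  · have h1 := hf.col r c
    have h2 := hf.col_strict r c
    rw [ranks, cell_of_some hx, cell_of_some hy] at h1 h2
    rw [Letter.colRel_iff]
    omega
  · have h1 := hf.symplectic r c
    rw [ranks, cell_of_some hx] at h1
    rw [Letter.violates_iff]
    omega

theorem eq_of_ranks_eq (h : T.NoEmptyRow) (h' : T'.NoEmptyRow) (e : ranks T = ranks T') :
    T = T' := by
  refine ext_entry h h' fun i c => ?_
  have e := congrFun (congrFun e i) c
  by_cases hlt : ranks T i c < 2 * m + n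
  · obtain ⟨x, hx, hx'⟩ := exists_entry_of_cell_lt hlt
    obtain ⟨y, hy, hy'⟩ := exists_entry_of_cell_lt (e ▸ hlt)
    rw [hx, hy, Letter.rank_injective (hx'.trans (e.trans hy'.symm))]
  · have hlt' : ¬ ranks T' i c < 2 * m + n := e ▸ hlt
    rw [ranks_lt_iff, not_lt, ← entry_eq_none_iff] at hlt hlt'
    rw [hlt, hlt']

theorem exists_isSpoTableau {f : ℕ → ℕ → ℕ} (hf : IsFilling m (2 * m + n) f) :
    ∃ T : Tableau (Letter m n), IsSpoTableau T ∧ ranks T = f := by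
  classical
  have hle := hf.le
  choose L hL using fun k (hk : k < 2 * m + n) => Letter.exists_rank_eq (m := m) (n := n) hk
  have hnone : ∀ i c, (if h : f i c < 2 * m + n then some (L _ h) else none) = none ↔
      f i c = 2 * m + n := by
    intro i c
    have := hle i c
    split_ifs with h <;> simp <;> omega
  obtain ⟨T, hT, he⟩ := Tableau.exists_of_entries
    (fun i c => if h : f i c < 2 * m + n then some (L _ h) else none)
    (fun i c h => by
      rw [hnone] at h ⊢
      have := hle i (c + 1)
      have := hf.row i c
      omega)
    (fun i c h => by
      rw [hnone] at h ⊢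
      have := hle (i + 1) c
      have := hf.col i c
      omega)
    (by
      obtain ⟨B, hB⟩ := hf.bounded
      exact ⟨B, fun i c h => by rw [hnone]; exact hB i c h⟩)
  have hr : ranks T = f := by
    funext i c
    rw [ranks, cell, he]
    have := hle i c
    split_ifs with h
    · simp [hL]
    · simp; omega
  exact ⟨T, isSpoTableau_of_isFilling hT (hr ▸ hf), hr⟩

end Spo

section Semistandard

variable {q : ℕ} {P P' : Tableau ℕ}

/-- The columns of `P`, with `q + 1` for absent boxes. -/
def columns (q : ℕ) (P : Tableau ℕ) : ℕ → ℕ → ℕ := fun c r => P.cell (q + 1) id r c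

/-- All entries lie between `1` and `q`. -/
def EntriesIn (q : ℕ) (P : Tableau ℕ) : Prop :=
  ∀ r c a, P.entry r c = some a → 1 ≤ a ∧ a ≤ q

theorem columns_lt_iff (h : EntriesIn q P) {c r : ℕ} :
    columns q P c r < q + 1 ↔ c < P.rowLen r :=
  cell_lt_iff fun a ha => Nat.lt_succ_of_le (h r c a ha).2

theorem columns_le (h : EntriesIn q P) (c r : ℕ) : columns q P c r ≤ q + 1 := by
  rcases h' : P.entry r c with _ | x
  · exact (cell_of_none h').le
  · rw [columns, cell_of_some h']
    exact Nat.le_succ_of_le (h _ _ _ h').2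

theorem one_le_columns (h : EntriesIn q P) (c r : ℕ) : 1 ≤ columns q P c r := by
  rcases h' : P.entry r c with _ | x
  · rw [columns, cell_of_none h']
    omega
  · rw [columns, cell_of_some h']
    exact (h _ _ _ h').1

/-- With rows and columns exchanged, all entries behave like letters of `B₁`, strict along rows and
weak along columns. So `m = 0`, and the symplectic condition is empty. -/
theorem IsSemistandard.isFilling (h : IsSemistandard q P) :
    IsFilling 0 (q + 1) (columns q P) := by
  obtain ⟨hne, ha⟩ := isTableau_shape h.isTableau
  have hlt := @columns_lt_iff q P h.entries
  have hle := columns_le h.entries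
  have hlast : ∀ i c, ¬ columns q P i c < q + 1 → columns q P i c = q + 1 := fun i c hlt => by
    have := hle i c
    omega
  have hrow : ∀ i c, columns q P i c < columns q P i (c + 1) ∨
      columns q P i c = q + 1 ∧ columns q P i (c + 1) = q + 1 := by
    intro i c
    by_cases h2 : columns q P i (c + 1) < q + 1
    · have h1 : columns q P i c < q + 1 := by
        rw [hlt] at h2 ⊢
        have := ha c
        omega
      obtain ⟨x, hx, hx'⟩ := exists_entry_of_cell_lt h1
      obtain ⟨y, hy, hy'⟩ := exists_entry_of_cell_lt h2
      have := h.isTableau.col c i x y hx hy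
      left
      rw [columns, columns, ← hx', ← hy']
      exact this
    · have := hlast _ _ h2
      have := hle i c
      omega
  have hcol : ∀ i c, columns q P i c ≤ columns q P (i + 1) c := by
    intro i c
    by_cases h2 : columns q P (i + 1) c < q + 1
    · have h1 : columns q P i c < q + 1 := by
        rw [hlt] at h2 ⊢
        omega
      obtain ⟨x, hx, hx'⟩ := exists_entry_of_cell_lt h1
      obtain ⟨y, hy, hy'⟩ := exists_entry_of_cell_lt h2
      have := h.isTableau.row c i x y hx hy
      rw [columns, columns, ← hx', ← hy']
      exact this
    · have := hlast _ _ h2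
      have := hle i c
      omega
  refine ⟨hle, fun i c => ?_, fun i c e => ?_, hcol, fun i c e => by omega,
    fun i c hlt => by omega, ?_⟩
  · have := hrow i c
    omega
  · have := hrow i c
    omega
  · obtain ⟨B, hB⟩ := bounded_rowLen P
    refine ⟨B, fun i c hic => hlast i c ?_⟩
    rw [hlt, not_lt]
    exact hB c i hic.symm

theorem isSemistandard_of_isFilling (h : P.NoEmptyRow) (he : EntriesIn q P)
    (hf : IsFilling 0 (q + 1) (columns q P)) : IsSemistandard q P := by
  refine ⟨isTableau_of h (fun i => ?_) (fun r c x y hx hy => ?_) (fun r c x y hx hy => ?_), he⟩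
  · refine le_of_forall_lt_imp fun c hc => ?_
    rw [← columns_lt_iff he] at hc ⊢
    exact (hf.row c i).trans_lt hc
  · have h1 := hf.col c r
    rw [columns, columns, cell_of_some hx, cell_of_some hy] at h1
    exact h1
  · have h1 := hf.row c r
    have h2 := hf.row_strict c r
    have := he r c x hx
    simp only [columns, cell_of_some hx, cell_of_some hy, id] at h1 h2
    omega

theorem eq_of_columns_eq (h : P.NoEmptyRow) (h' : P'.NoEmptyRow) (he : EntriesIn q P)
    (he' : EntriesIn q P') (e : columns q P = columns q P') : P = P' := by
  refine ext_entry h h' fun i c => ?_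
  have e := congrFun (congrFun e c) i
  by_cases hlt : columns q P c i < q + 1
  · obtain ⟨x, hx, hx'⟩ := exists_entry_of_cell_lt hlt
    obtain ⟨y, hy, hy'⟩ := exists_entry_of_cell_lt (show columns q P' c i < q + 1 from e ▸ hlt)
    rw [hx, hy]
    exact congrArg some (hx'.trans (e.trans hy'.symm))
  · have hlt' : ¬ columns q P' c i < q + 1 := e ▸ hlt
    rw [columns_lt_iff he, not_lt, ← entry_eq_none_iff] at hlt
    rw [columns_lt_iff he', not_lt, ← entry_eq_none_iff] at hlt'
    rw [hlt, hlt']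

theorem exists_isSemistandard {f : ℕ → ℕ → ℕ} (hf : IsFilling 0 (q + 1) f)
    (h1 : ∀ c r, 1 ≤ f c r) : ∃ P : Tableau ℕ, IsSemistandard q P ∧ columns q P = f := by
  have hle := hf.le
  have hnone : ∀ i c, (if f i c < q + 1 then some (f i c) else none) = none ↔ f i c = q + 1 := by
    intro i c
    have := hle i c
    split_ifs with h <;> simp <;> omega
  obtain ⟨P, hP, he⟩ := Tableau.exists_of_entries
    (fun r c => if f c r < q + 1 then some (f c r) else none)
    (fun i c h => by
      rw [hnone] at h ⊢
      have := hle (c + 1) i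
      have := hf.col c i
      omega)
    (fun i c h => by
      rw [hnone] at h ⊢
      have := hle c (i + 1)
      have := hf.row c i
      omega)
    (by
      obtain ⟨B, hB⟩ := hf.bounded
      exact ⟨B, fun i c h => by rw [hnone]; exact hB c i h.symm⟩)
  have hr : columns q P = f := by
    funext c r
    rw [columns, cell, he]
    have := hle c r
    split_ifs with h
    · simp
    · simp; omega
  refine ⟨P, isSemistandard_of_isFilling hP (fun r c a ha => ?_) (hr ▸ hf), hr⟩
  rw [he] at ha
  split_ifs at ha with h
  have := h1 c r
  simp only [Option.some.injEq] at ha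
  omega

end Semistandard

end Spo

/-! ### The bumping stage follows the local rules -/

namespace Spo

open LevelState

/-- The relation `Letter.ColRel` on ranks. -/
def RankColRel (m a b : ℕ) : Prop := a < b ∨ a = b ∧ 2 * m ≤ a

/-- Inserting `a` into the row `g` produces the row `g'` and the bumped letter `b`. -/
def RowInsert (m a : ℕ) (g g' : ℕ → ℕ) (b : ℕ) : Prop :=
  ∃ p, g p = b ∧ RankColRel m a b ∧ (∀ c, c < p → ¬ RankColRel m a (g c)) ∧ g' p = a ∧
    ∀ c, c ≠ p → g' c = g c

section

variable {m N a b k u : ℕ} {g g' : ℕ → ℕ}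

theorem RankColRel.le (h : RankColRel m a b) : a ≤ b := by
  rcases h with h | h <;> omega

theorem RowInsert.rel (h : RowInsert m a g g' b) : RankColRel m a b := by
  obtain ⟨p, -, h, -⟩ := h
  exact h

/-- Since `a` takes the place of `b`, the number of letters below `k` grows exactly when `k`
separates them. As `a` bumps the leftmost possible letter, the extra box is the next one in the row.
-/
theorem RowInsert.lt_iff (h : RowInsert m a g g' b) (hg : Monotone g)
    (hu : ∀ c, g c < k ↔ c < u) (c : ℕ) :
    g' c < k ↔ c < u + if a < k ∧ k ≤ b then 1 else 0 := by
  obtain ⟨p, h1, h2, h3, h4, h5⟩ := h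
  have h2' := h2.le
  have h3' : ∀ c, c < p → g c ≤ a := fun c hc => by
    have := h3 c hc
    simp only [RankColRel] at this
    omega
  have h6 : ∀ c, p ≤ c → b ≤ g c := fun c hc => h1 ▸ hg hc
  have hp := hu p
  rcases eq_or_ne c p with rfl | hc
  · rw [h4]
    split_ifs with h
    · have : c ≤ u := by
        by_contra hcon
        have := h3' u (by omega)
        have := hu u
        omega
      omega
    · omega
  · rw [h5 c hc, hu]
    split_ifs with h
    · have : p ≤ u := by
        by_contra hcon
        have := h3' u (by omega)
        have := hu u
        omega
      omega
    · omega

/-- A row contains no letter strictly between the inserted and the bumped one. -/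
theorem RowInsert.count_eq (h : RowInsert m a g g' b) (hg : Monotone g) (hk : k < b)
    (ha : a < k ∨ a = k ∧ 2 * m ≤ k) {v : ℕ} (hu : ∀ c, g c < k ↔ c < u)
    (hv : ∀ c, g c < k + 1 ↔ c < v) : u = v := by
  obtain ⟨p, h1, h2, h3, h4, h5⟩ := h
  have key : ∀ c, g c < k + 1 ↔ g c < k := by
    intro c
    rcases Nat.lt_or_ge c p with hc | hc
    · have := h3 c hc
      simp only [RankColRel] at this
      omega
    · have := hg hc
      omega
  have h1 := hu u
  have h2 := hv u
  have h3 := hu v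
  have h4 := hv v
  rw [key] at h2 h4
  omega

theorem RowInsert.count_lt (h : RowInsert m a g g' b) (hu : ∀ c, g c < b ↔ c < u)
    {v : ℕ} (hv : ∀ c, g c < b + 1 ↔ c < v) : u < v := by
  obtain ⟨p, h1, -⟩ := h
  have := hu p
  have := hv p
  omega

end

section

variable {m N x R K : ℕ} {f f' μ : ℕ → ℕ → ℕ} {ξ : ℕ → ℕ}

/-- The row in which the letters of rank less than `k` have gained a box, if the bumping letters
are given by `ξ`. -/
def bumpRow (ξ : ℕ → ℕ) (R k : ℕ) : ℕ := Nat.findGreatest (fun i => ξ i < k) R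

/-- The states in the bumping stage of an insertion. -/
def bumpState (ξ : ℕ → ℕ) (R k : ℕ) : LevelState :=
  if k ≤ ξ 0 then idle else plus (bumpRow ξ R k)

/-- The counts of letters after the bumping stage. -/
def bumpCount (μ : ℕ → ℕ → ℕ) (ξ : ℕ → ℕ) (R k i : ℕ) : ℕ :=
  μ k i + if i < R ∧ ξ i < k ∧ k ≤ ξ (i + 1) then 1 else 0

theorem bump_mono (h : ∀ i, i < R → RowInsert m (ξ i) (f i) (f' i) (ξ (i + 1))) :
    ∀ i j, i ≤ j → j ≤ R → ξ i ≤ ξ j := by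
  intro i j hij
  induction j, hij using Nat.le_induction with
  | base => intro _; exact le_rfl
  | succ j _ ih => intro hj; exact (ih (by omega)).trans (h j hj).rel.le

theorem bumpRow_spec (hK : K ≤ ξ R) {k : ℕ} (hk : ξ 0 < k) (hkK : k ≤ K) :
    bumpRow ξ R k < R ∧ ξ (bumpRow ξ R k) < k ∧ k ≤ ξ (bumpRow ξ R k + 1) := by
  have h1 : ξ (bumpRow ξ R k) < k :=
    Nat.findGreatest_spec (P := fun i => ξ i < k) (Nat.zero_le R) hk
  have h2 : bumpRow ξ R k ≤ R := Nat.findGreatest_le _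
  have h3 : bumpRow ξ R k < R := by
    refine lt_of_le_of_ne h2 fun h => ?_
    rw [h] at h1
    omega
  refine ⟨h3, h1, ?_⟩
  by_contra hcon
  exact Nat.findGreatest_is_greatest (P := fun i => ξ i < k) (Nat.lt_succ_self _) h3
    (not_le.1 hcon)

theorem bumpRow_eq (h : ∀ i, i < R → RowInsert m (ξ i) (f i) (f' i) (ξ (i + 1))) (hK : K ≤ ξ R)
    {k i : ℕ} (hkK : k ≤ K) (hi : i < R) (h1 : ξ i < k) (h2 : k ≤ ξ (i + 1)) :
    bumpRow ξ R k = i := by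
  have hm := bump_mono h
  have h0 := hm 0 i (Nat.zero_le _) (by omega)
  obtain ⟨h3, h4, h5⟩ := bumpRow_spec hK (show ξ 0 < k by omega) hkK
  rcases lt_trichotomy (bumpRow ξ R k) i with hlt | heq | hlt
  · have := hm (bumpRow ξ R k + 1) i hlt (by omega)
    omega
  · exact heq
  · have := hm (i + 1) (bumpRow ξ R k) hlt (by omega)
    omega

theorem encodes_bumpCount (h : ∀ i, i < R → RowInsert m (ξ i) (f i) (f' i) (ξ (i + 1)))
    (h' : ∀ i, R ≤ i → f' i = f i) (hf : ∀ i, Monotone (f i)) (hμ : Encodes N f μ) :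
    Encodes N f' (bumpCount μ ξ R) := by
  intro k hk i c
  rcases Nat.lt_or_ge i R with hi | hi
  · rw [(h i hi).lt_iff (hf i) (hμ k hk i) c, bumpCount]
    simp [hi]
  · rw [h' i hi, hμ k hk, bumpCount]
    simp [Nat.not_lt.2 hi]

theorem apply_bumpState (h : ∀ i, i < R → RowInsert m (ξ i) (f i) (f' i) (ξ (i + 1)))
    (hK : K ≤ ξ R) {k : ℕ} (hk : k ≤ K) :
    (bumpState ξ R k).Apply (μ k) (bumpCount μ ξ R k) := by
  have hm := bump_mono h
  rw [bumpState]
  split_ifs with h0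
  · intro j
    rw [bumpCount, if_neg]
    · rfl
    · rintro ⟨h1, h2, -⟩
      have := hm 0 j (Nat.zero_le _) h1.le
      omega
  · obtain ⟨h1, h2, h3⟩ := bumpRow_spec hK (not_le.1 h0) hk
    refine ⟨?_, fun j hj => ?_⟩
    · rw [bumpCount, if_pos ⟨h1, h2, h3⟩]
    · rw [bumpCount, if_neg]
      · rfl
      · rintro ⟨h4, h5, h6⟩
        exact hj (bumpRow_eq h hK hk h4 h5 h6).symm

/-- The letters `ξ 0 ≤ ξ 1 ≤ ⋯` entering the successive rows locate the gained box at level `k` in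
the row `i` with `ξ i < k ≤ ξ (i + 1)`. The bound `K` is the level up to which bumping alone governs
the change: all levels if a box is added, the level of the last letter bumped before a cancellation
otherwise. -/
theorem trans_bumpState (h : ∀ i, i < R → RowInsert m (ξ i) (f i) (f' i) (ξ (i + 1)))
    (hf : ∀ i, Monotone (f i)) (hμ : Encodes N f μ) (hK : K ≤ ξ R) (hKN : K ≤ N)
    (hv : ∀ i, i < R → ξ (i + 1) < 2 * m → 2 * (i + 1) ≤ ξ (i + 1)) {k : ℕ} (hk : k < K) :
    Trans m (ξ 0) k (μ k) (μ (k + 1)) (bumpState ξ R k) (bumpState ξ R (k + 1)) := by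
  have hm := bump_mono h
  have heq : ∀ i, i < R → k < ξ (i + 1) → (ξ i < k ∨ ξ i = k ∧ 2 * m ≤ k) →
      μ k i = μ (k + 1) i := fun i hi h1 h2 =>
    (h i hi).count_eq (hf i) h1 h2 (hμ k (by omega) i) (hμ (k + 1) (by omega) i)
  have hlt : ∀ i, i < R → ξ (i + 1) = k → μ k i < μ (k + 1) i := by
    rintro i hi rfl
    exact (h i hi).count_lt (hμ _ (by omega) i) (hμ _ (by omega) i)
  rcases lt_trichotomy k (ξ 0) with h0 | h0 | h0
  · rw [bumpState, bumpState, if_pos h0.le, if_pos (by omega)]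
    exact .idle h0
  · obtain ⟨h1, h2, h3⟩ := bumpRow_spec hK (show ξ 0 < k + 1 by omega) hk
    rw [bumpState, bumpState, if_pos h0.le, if_neg (by omega)]
    rcases Nat.lt_or_ge k (2 * m) with hkm | hkm
    · have hR : 0 < R := by omega
      have h4 := (h 0 hR).rel
      simp only [RankColRel] at h4
      rw [bumpRow_eq h hK hk hR (by omega) (by omega)]
      exact .start h0 hkm
    · have h4 := hm 0 _ (Nat.zero_le _) h1.le
      -- Equal letters of `B₁` bump each other, so `ξ` may be constant over several rows; all rows
      -- passed this way contain `k`.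
      refine .startOdd _ h0 hkm (fun l hl => ?_) (heq _ h1 (by omega) (by omega))
      have h5 := hm 0 (l + 1) (Nat.zero_le _) (by omega)
      have h6 := hm (l + 1) (bumpRow ξ R (k + 1)) (by omega) (by omega)
      exact hlt l (by omega) (by omega)
  · obtain ⟨h1, h2, h3⟩ := bumpRow_spec hK h0 hk.le
    obtain ⟨h4, h5, h6⟩ := bumpRow_spec hK (show ξ 0 < k + 1 by omega) hk
    rw [bumpState, bumpState, if_neg (by omega), if_neg (by omega)]
    have hle : bumpRow ξ R k ≤ bumpRow ξ R (k + 1) := by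
      by_contra hcon
      have := hm (bumpRow ξ R (k + 1) + 1) (bumpRow ξ R k) (by omega) (by omega)
      omega
    rcases Nat.lt_or_ge k (2 * m) with hkm | hkm
    -- Either the row passes on a letter larger than `k` and then has no `k`, or it passes on `k`
    -- itself, which settles one row lower because letters of `B₀` bump strictly larger ones.
    · rcases h3.lt_or_eq with h7 | h7
      · rw [bumpRow_eq h hK hk h1 (by omega) h7]
        exact .stay _ hkm (heq _ h1 h7 (Or.inl h2))
      · have h8 : bumpRow ξ R k + 1 < R := by
          refine lt_of_le_of_ne h1 fun h9 => ?_
          rw [h9] at h7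
          omega
        have h9 := (h _ h8).rel
        simp only [RankColRel] at h9
        rw [bumpRow_eq h hK hk h8 (by omega) (by omega)]
        exact .bump _ hkm (hlt _ h1 h7.symm) ((hv _ h1 (by omega)).trans h7.ge)
    · refine .plusOdd _ _ hkm hle (fun l h7 h8 => ?_) ?_
      · have := hm (bumpRow ξ R k + 1) (l + 1) (by omega) (by omega)
        have := hm (l + 1) (bumpRow ξ R (k + 1)) (by omega) (by omega)
        exact hlt l (by omega) (by omega)
      · exact heq _ h4 h6 (by omega)

end

end Spo

/-! ### Removing a box, and tableaux with a hole -/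

namespace Spo

open LevelState Tableau

namespace Tableau

variable {α : Type} {T : Tableau α}

theorem getD_modify (T : Tableau α) (r i : ℕ) (φ : List α → List α) (hφ : φ [] = []) :
    (T.modify r φ).getD i [] = if i = r then φ (T.getD r []) else T.getD i [] := by
  rw [List.getD_eq_getElem?_getD, List.getElem?_modify]
  rcases eq_or_ne i r with rfl | h
  · rw [if_pos rfl, List.getD_eq_getElem?_getD]
    cases T[i]? <;> simp [hφ]
  · simp only [if_neg h, if_neg h.symm, List.getD_eq_getElem?_getD]
    cases T[i]? <;> simp

theorem entry_setEntry {r c : ℕ} (h : c < T.rowLen r) (x : α) (i d : ℕ) :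
    (T.setEntry r c x).entry i d = if i = r ∧ d = c then some x else T.entry i d := by
  rw [entry, setEntry, getD_modify _ _ _ _ (by simp)]
  rcases eq_or_ne i r with rfl | hi
  · rw [if_pos rfl, List.getElem?_set]
    rcases eq_or_ne d c with rfl | hd
    · rw [if_pos rfl, if_pos (show d < (T.getD i []).length from h), if_pos ⟨rfl, rfl⟩]
    · rw [if_neg (Ne.symm hd), if_neg (by tauto)]
      rfl
  · rw [if_neg hi, if_neg (by tauto)]
    rfl

theorem rowLen_setEntry (T : Tableau α) (r c : ℕ) (x : α) (i : ℕ) :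
    (T.setEntry r c x).rowLen i = T.rowLen i := by
  rw [rowLen, setEntry, getD_modify _ _ _ _ (by simp)]
  rcases eq_or_ne i r with rfl | hi
  · rw [if_pos rfl, List.length_set]
    rfl
  · rw [if_neg hi]
    rfl

theorem shape_setEntry (T : Tableau α) (r c : ℕ) (x : α) : (T.setEntry r c x).shape = T.shape := by
  refine List.ext_getElem (by simp [shape, setEntry]) fun i h1 h2 => ?_
  simp only [shape, setEntry, List.getElem_map, List.getElem_modify]
  split_ifs <;> simp

theorem noEmptyRow_iff_shape : T.NoEmptyRow ↔ ∀ l ∈ T.shape, l ≠ 0 := by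
  simp [NoEmptyRow, shape]

theorem NoEmptyRow.setEntry (h : T.NoEmptyRow) (r c : ℕ) (x : α) :
    (T.setEntry r c x).NoEmptyRow := by
  rw [noEmptyRow_iff_shape] at h ⊢
  rwa [shape_setEntry]

/-- This makes the number of boxes a sufficient bound for the number of slides: each slide raises `r
+ c` by one. -/
theorem add_lt_size {T : Tableau α} (h : T.NoEmptyRow) {r c : ℕ} (hc : c < T.rowLen r) :
    r + c < T.size := by
  induction T generalizing r with
  | nil => simp [rowLen] at hc
  | cons row rows ih =>
    have h1 : 0 < row.length := List.length_pos_iff.2 (h row (by simp))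
    have h2 : size (row :: rows) = row.length + size rows := by simp [size, shape]
    cases r with
    | zero =>
      have : c < row.length := by simpa [rowLen] using hc
      omega
    | succ r =>
      have := ih (fun row' hr => h row' (List.mem_cons_of_mem _ hr)) (r := r)
        (by simpa [rowLen] using hc)
      omega

theorem noEmptyRow_removeBox (T : Tableau α) (r : ℕ) : (T.removeBox r).NoEmptyRow := by
  intro row hr
  simp only [removeBox, List.mem_filter, Bool.not_eq_true', List.isEmpty_eq_false_iff] at hr
  exact hr.2

/-- The filter in `removeBox` can only delete row `r`, and it does so only for `c = 0`, when row `r`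
is the last one by `hd`; so no other row changes its index. -/
theorem entry_removeBox (h : T.NoEmptyRow) {r c : ℕ} (hc : T.rowLen r = c + 1)
    (hd : T.rowLen (r + 1) ≤ c) (i d : ℕ) :
    (T.removeBox r).entry i d = if i = r ∧ d = c then none else T.entry i d := by
  have hr : r < T.length := (rowLen_pos_iff h).1 (by omega)
  have hrow : ∀ i, (T.removeBox r).getD i [] = (T.modify r List.dropLast).getD i [] := by
    rcases Nat.eq_zero_or_pos c with rfl | hpos
    · have hlen : T.length = r + 1 := by
        have : ¬ (r + 1 < T.length) := by
          rw [← rowLen_pos_iff h]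
          omega
        omega
      have hT : T.modify r List.dropLast = T.take r ++ [[]] := by
        rw [List.modify_eq_take_cons_drop hr]
        have h1 : T.drop (r + 1) = [] := List.drop_of_length_le (by omega)
        have h2 : T[r].dropLast = [] := by
          apply List.eq_nil_of_length_eq_zero
          rw [List.length_dropLast]
          rw [rowLen, List.getD_eq_getElem _ _ hr] at hc
          omega
        rw [h1, h2]
      have hT' : T.removeBox r = T.take r := by
        rw [removeBox, hT, List.filter_append, List.filter_eq_self.2]
        · simp
        · intro row hrow
          have := h row (List.mem_of_mem_take hrow)
          simpa using this
      intro i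
      rw [hT, hT', List.getD_eq_getElem?_getD, List.getD_eq_getElem?_getD]
      rcases Nat.lt_or_ge i (T.take r).length with hi | hi
      · rw [List.getElem?_append_left hi]
      · rw [List.getElem?_append_right hi, List.getElem?_eq_none hi]
        cases i - (T.take r).length <;> simp
    · have : T.removeBox r = T.modify r List.dropLast := by
        rw [removeBox, List.filter_eq_self]
        intro row hrow
        obtain ⟨i, hi, rfl⟩ := List.mem_iff_getElem.1 hrow
        rw [List.getElem_modify]
        have hi' : i < T.length := by simpa using hi
        split_ifs with hir
        · subst hir
          rw [rowLen, List.getD_eq_getElem _ _ hi'] at hc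
          have : T[r].dropLast ≠ [] := by
            rw [← List.length_pos_iff, List.length_dropLast]
            omega
          simpa using this
        · simpa using h _ (List.getElem_mem hi')
      intro i
      rw [this]
  rw [entry, hrow, getD_modify _ _ _ _ (by simp)]
  rcases eq_or_ne i r with rfl | hi
  · rw [if_pos rfl, List.getElem?_dropLast]
    change (if d < T.rowLen i - 1 then T.entry i d else none) = _
    rcases lt_trichotomy d c with hd | hd | hd
    · rw [if_pos (by omega), if_neg (by omega)]
    · rw [if_neg (by omega), if_pos ⟨rfl, hd⟩]
    · rw [if_neg (by omega), if_neg (by omega), entry_eq_none_iff.2 (by omega)]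
  · rw [if_neg hi, if_neg (by tauto)]
    rfl

end Tableau

section

variable {m n : ℕ}

theorem ranks_setEntry {T : Tableau (Letter m n)} {r c : ℕ} (h : c < T.rowLen r)
    (x : Letter m n) (i d : ℕ) :
    ranks (T.setEntry r c x) i d = if i = r ∧ d = c then x.rank else ranks T i d := by
  rw [ranks, cell, entry_setEntry h]
  split_ifs <;> rfl

theorem ranks_removeBox {T : Tableau (Letter m n)} (h : T.NoEmptyRow) {r c : ℕ}
    (hc : T.rowLen r = c + 1) (hd : T.rowLen (r + 1) ≤ c) (i d : ℕ) :
    ranks (T.removeBox r) i d = if i = r ∧ d = c then 2 * m + n else ranks T i d := by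
  rw [ranks, cell, entry_removeBox h hc hd]
  split_ifs <;> rfl

/-- The situation in the course of a sequence of slides: the box in row `r` and column `c` is empty,
but still contains the entry of rank `z` that has left it last. -/
structure IsPunctured (T : Tableau (Letter m n)) (r c z : ℕ) : Prop where
  noEmptyRow : T.NoEmptyRow
  row_mono : ∀ i, Monotone (ranks T i)
  hole : ranks T r c = z
  hole_lt : z < 2 * m + n
  col_le : ∀ i d, r ≤ i → ranks T i d ≤ ranks T (i + 1) d
  row_rel : ∀ i d, r ≤ i → c ≤ d → ranks T i d = ranks T i (d + 1) →
    ranks T i d < 2 * m ∨ ranks T i d = 2 * m + n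
  col_rel : ∀ i d, r ≤ i → c ≤ d → ranks T i d = ranks T (i + 1) d → 2 * m ≤ ranks T i d

/-- The rows from which the letters of rank less than `k`, for `k > z`, lose a box in the course of a
sequence of slides that starts in row `r` with an entry of rank `z`. -/
structure IsSlidePath (m N r z : ℕ) (μ μ' : ℕ → ℕ → ℕ) (ι : ℕ → ℕ) : Prop where
  below : ∀ k, k ≤ z → μ' k = μ k
  apply : ∀ k, z < k → k ≤ N → (minus (ι k)).Apply (μ k) (μ' k)
  trans : ∀ k, z < k → k < N → ∀ x, Trans m x k (μ k) (μ (k + 1)) (minus (ι k)) (minus (ι (k + 1)))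
  start : z < 2 * m → ι (z + 1) = r
  startOdd : 2 * m ≤ z → r ≤ ι (z + 1) ∧ μ (z + 1) (ι (z + 1)) = μ (z + 1) r ∧
    μ (z + 1) (ι (z + 1) + 1) < μ (z + 1) r

/-- The numbers of letters of rank less than `k` after the letter `z` in row `r` has been replaced by
the letter `y`. -/
def replaceCount (μ : ℕ → ℕ → ℕ) (r z y k i : ℕ) : ℕ :=
  μ k i - if i = r ∧ z < k ∧ k ≤ y then 1 else 0

theorem IsPunctured.lt_rowLen {T : Tableau (Letter m n)} {r c z : ℕ} (h : IsPunctured T r c z) :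
    c < T.rowLen r := ranks_lt_iff.1 (h.hole.trans_lt h.hole_lt)

theorem Encodes.eq_of_lt_of_le {N k i c : ℕ} {f μ : ℕ → ℕ → ℕ} (hμ : Encodes N f μ) (hk : k ≤ N)
    (h1 : f i c < k) (h2 : k ≤ f i (c + 1)) : μ k i = c + 1 := by
  have := (hμ k hk i c)
  have := (hμ k hk i (c + 1))
  omega

theorem Encodes.le_of_le {N k i c : ℕ} {f μ : ℕ → ℕ → ℕ} (hμ : Encodes N f μ) (hk : k ≤ N)
    (h1 : k ≤ f i c) : μ k i ≤ c := by
  have := (hμ k hk i c)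
  omega

/-- Filling the hole with the letter `y` changes the counts as if `z` were replaced by `y`. -/
theorem IsPunctured.encodes_setEntry {T : Tableau (Letter m n)} {r c z : ℕ}
    (h : IsPunctured T r c z) {μ : ℕ → ℕ → ℕ} (hμ : Encodes (2 * m + n) (ranks T) μ)
    {y : Letter m n} (hzy : z ≤ y.rank) (hy : y.rank ≤ ranks T r (c + 1)) :
    Encodes (2 * m + n) (ranks (T.setEntry r c y)) (replaceCount μ r z y.rank) := by
  intro k hk i d
  rw [ranks_setEntry h.lt_rowLen, replaceCount]
  have h1 := hμ k hk i d
  have h2 := h.hole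
  by_cases hi : i = r
  · subst hi
    have h3 : z < k → k ≤ y.rank → μ k i = c + 1 := fun h4 h5 =>
      hμ.eq_of_lt_of_le hk (h2.trans_lt h4) (by omega)
    rcases eq_or_ne d c with rfl | hd
    · simp only [and_self, if_true, true_and]
      split_ifs <;> omega
    · simp only [hd, and_false, if_false, true_and]
      split_ifs <;> omega
  · simp only [hi, false_and, if_false, Nat.sub_zero]
    exact h1

theorem IsPunctured.row_mono_setEntry {T : Tableau (Letter m n)} {r c z : ℕ}
    (h : IsPunctured T r c z) {y : Letter m n} (hzy : z ≤ y.rank)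
    (hy : y.rank ≤ ranks T r (c + 1)) (i : ℕ) : Monotone (ranks (T.setEntry r c y) i) := by
  refine monotone_nat_of_le_succ fun d => ?_
  rw [ranks_setEntry h.lt_rowLen, ranks_setEntry h.lt_rowLen]
  have h1 := h.row_mono i (Nat.le_succ d)
  have h2 := h.hole
  split_ifs with h3 h4 h4
  · omega
  · obtain ⟨rfl, rfl⟩ := h3
    exact hy
  · obtain ⟨rfl, h4⟩ := h4
    rw [Nat.succ_eq_add_one, h4, h2] at h1
    omega
  · exact h1

theorem IsPunctured.slideRight {T : Tableau (Letter m n)} {r c z : ℕ} (h : IsPunctured T r c z)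
    {x : Letter m n} (hx : ranks T r (c + 1) = x.rank)
    (hxy : RankColRel m x.rank (ranks T (r + 1) c)) :
    IsPunctured (T.setEntry r c x) r (c + 1) x.rank := by
  have hs := ranks_setEntry h.lt_rowLen x
  have hz := h.row_mono r (Nat.le_succ c)
  rw [h.hole, Nat.succ_eq_add_one, hx] at hz
  refine ⟨h.noEmptyRow.setEntry _ _ _, h.row_mono_setEntry hz hx.ge, ?_, x.rank_lt,
    fun i d hi => ?_, fun i d hi hd => ?_, fun i d hi hd => ?_⟩
  · rw [hs, if_neg (by omega), hx]
  · rw [hs, hs]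
    have h1 := h.col_le i d hi
    have h2 := hxy.le
    split_ifs with h3 h4 h4
    · omega
    · obtain ⟨rfl, rfl⟩ := h3
      exact h2
    · omega
    · exact h1
  · rw [hs, hs, if_neg (by omega), if_neg (by omega)]
    exact h.row_rel i d hi (by omega)
  · rw [hs, hs, if_neg (by omega), if_neg (by omega)]
    exact h.col_rel i d hi (by omega)

theorem IsPunctured.slideDown {T : Tableau (Letter m n)} {r c z : ℕ} (h : IsPunctured T r c z)
    {y : Letter m n} (hy : ranks T (r + 1) c = y.rank) (hyx : y.rank ≤ ranks T r (c + 1)) :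
    IsPunctured (T.setEntry r c y) (r + 1) c y.rank := by
  have hs := ranks_setEntry h.lt_rowLen y
  have hz := h.col_le r c le_rfl
  rw [h.hole, hy] at hz
  refine ⟨h.noEmptyRow.setEntry _ _ _, h.row_mono_setEntry hz hyx, ?_, y.rank_lt,
    fun i d hi => ?_, fun i d hi hd => ?_, fun i d hi hd => ?_⟩
  · rw [hs, if_neg (by omega), hy]
  · rw [hs, hs, if_neg (by omega), if_neg (by omega)]
    exact h.col_le i d (by omega)
  · rw [hs, hs, if_neg (by omega), if_neg (by omega)]
    exact h.row_rel i d (by omega) hd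
  · rw [hs, hs, if_neg (by omega), if_neg (by omega)]
    exact h.col_rel i d (by omega) hd

end

end Spo

/-! ### Forward slides follow the local rules -/

namespace Spo

open LevelState Tableau

section

variable {m n : ℕ} {T : Tableau (Letter m n)} {r c z : ℕ} {μ μ' : ℕ → ℕ → ℕ} {ι : ℕ → ℕ}

theorem IsPunctured.count_antitone (h : IsPunctured T r c z)
    (hμ : Encodes (2 * m + n) (ranks T) μ) {k : ℕ} (hk : k ≤ 2 * m + n) :
    ∀ i j, r ≤ i → i ≤ j → μ k j ≤ μ k i := by
  intro i j hi hij
  induction j, hij using Nat.le_induction with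
  | base => exact le_rfl
  | succ j hij ih =>
    refine le_trans (le_of_forall_lt_imp fun d hd => ?_) ih
    rw [← hμ k hk] at hd ⊢
    exact (h.col_le j d (by omega)).trans_lt hd

theorem IsPunctured.isSlidePath_removeBox (h : IsPunctured T r c z)
    (hμ : Encodes (2 * m + n) (ranks T) μ) (h1 : ranks T r (c + 1) = 2 * m + n)
    (h2 : ranks T (r + 1) c = 2 * m + n) :
    ∃ μ', Encodes (2 * m + n) (ranks (T.removeBox r)) μ' ∧
      IsSlidePath m (2 * m + n) r z μ μ' fun _ => r := by
  have hz := h.hole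
  have hzN : z + 1 ≤ 2 * m + n := h.hole_lt
  have hc : T.rowLen r = c + 1 := by
    have := h.lt_rowLen
    have := ranks_lt_iff (T := T) (i := r) (c := c + 1)
    omega
  have hd : T.rowLen (r + 1) ≤ c := by
    have := ranks_lt_iff (T := T) (i := r + 1) (c := c)
    omega
  have hr := ranks_removeBox h.noEmptyRow hc hd
  have e1 : ∀ k, z < k → k ≤ 2 * m + n → μ k r = c + 1 := fun k hk1 hk2 =>
    hμ.eq_of_lt_of_le hk2 (by omega) (by omega)
  have e2 : ∀ k, k ≤ 2 * m + n → μ k (r + 1) ≤ c := fun k hk => hμ.le_of_le hk (by omega)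
  -- Deleting the hole amounts to replacing `z` by the mark `2 * m + n` of an absent box.
  refine ⟨replaceCount μ r z (2 * m + n), fun k hk i d => ?_, ⟨fun k hk => ?_, fun k hk1 hk2 => ?_,
    fun k hk1 hk2 x => ?_, fun _ => rfl, fun _ => ⟨le_rfl, rfl, ?_⟩⟩⟩
  · rw [hr, replaceCount]
    have h3 := hμ k hk i d
    by_cases hi : i = r
    · subst hi
      have := e1 k
      rcases eq_or_ne d c with rfl | hdc
      · simp only [and_self, if_true, true_and]
        split_ifs <;> omega
      · simp only [hdc, and_false, if_false, true_and]
        split_ifs <;> omega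
    · simp only [hi, false_and, if_false, Nat.sub_zero]
      exact h3
  · funext i
    rw [replaceCount, if_neg (by omega), Nat.sub_zero]
  · refine ⟨?_, fun j hj => ?_⟩
    · rw [replaceCount, if_pos ⟨rfl, hk1, hk2⟩, e1 k hk1 hk2]
      omega
    · rw [replaceCount, if_neg (by tauto), Nat.sub_zero]
  · have a1 := e1 k hk1 hk2.le
    have a2 := e1 (k + 1) (by omega) hk2
    have a3 := e2 (k + 1) hk2
    rcases Nat.lt_or_ge k (2 * m) with hkm | hkm
    · exact .slideRight r hkm (by omega)
    · exact .slideDownOdd r r hkm (by omega) le_rfl rfl (by omega)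
  · have := e1 (z + 1) (by omega) hzN
    have := e2 (z + 1) hzN
    omega

theorem replaceCount_of_lt {y k : ℕ} (hk : y < k) : replaceCount μ r z y k = μ k := by
  funext i
  rw [replaceCount, if_neg (by omega), Nat.sub_zero]

theorem replaceCount_of_le {y k : ℕ} (hk : k ≤ z) : replaceCount μ r z y k = μ k := by
  funext i
  rw [replaceCount, if_neg (by omega), Nat.sub_zero]

theorem apply_replaceCount {y k : ℕ} (h1 : z < k) (h2 : k ≤ y) (hpos : 0 < μ k r) :
    (minus r).Apply (μ k) (replaceCount μ r z y k) := by
  refine ⟨?_, fun j hj => ?_⟩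
  · rw [replaceCount, if_pos ⟨rfl, h1, h2⟩]
    omega
  · rw [replaceCount, if_neg (by tauto), Nat.sub_zero]

/-- Until level `x.rank` the missing box is the hole in row `r`; from there on the remaining slides
determine it. -/
theorem IsPunctured.isSlidePath_right (h : IsPunctured T r c z)
    (hμ : Encodes (2 * m + n) (ranks T) μ) {x : Letter m n} (hx : ranks T r (c + 1) = x.rank)
    (hxy : RankColRel m x.rank (ranks T (r + 1) c))
    (hp : IsSlidePath m (2 * m + n) r x.rank (replaceCount μ r z x.rank) μ' ι) :
    IsSlidePath m (2 * m + n) r z μ μ' fun k => if k ≤ x.rank then r else ι k := by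
  have hz := h.hole
  have hxN : x.rank + 1 ≤ 2 * m + n := x.rank_lt
  have hzx := h.row_mono r (Nat.le_succ c)
  rw [hz, Nat.succ_eq_add_one, hx] at hzx
  have hrow := h.row_rel r c le_rfl le_rfl
  have hxy' := hxy.le
  have e1 : ∀ k, z < k → k ≤ x.rank → μ k r = c + 1 := fun k hk1 hk2 =>
    hμ.eq_of_lt_of_le (by omega) (by omega) (by omega)
  have e2 : ∀ k, k ≤ x.rank → μ k (r + 1) ≤ c := fun k hk => hμ.le_of_le (by omega) (by omega)
  -- After a letter of `B₁` has moved left, the box below the new hole does not contain the same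
  -- letter, since it would repeat in its row. So no descent happens on this level.
  have hstart : 2 * m ≤ x.rank → ι (x.rank + 1) = r := by
    intro hm
    obtain ⟨a1, a2, a3⟩ := hp.startOdd hm
    rw [replaceCount_of_lt (show _ < _ + 1 from Nat.lt_succ_self _)] at a2
    by_contra hne
    have a4 := h.count_antitone hμ hxN (r + 1) (ι (x.rank + 1)) (by omega) (by omega)
    have a5 := hμ (x.rank + 1) hxN r (c + 1)
    have a6 : x.rank + 1 ≤ ranks T (r + 1) (c + 1) := by
      have b1 := h.row_mono (r + 1) (Nat.le_succ c)
      have b2 := h.row_rel (r + 1) c (by omega) le_rfl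
      rw [Nat.succ_eq_add_one] at b1
      omega
    have a7 := hμ.le_of_le hxN a6
    omega
  have hstart' : ι (x.rank + 1) = r := by
    rcases Nat.lt_or_ge x.rank (2 * m) with hm | hm
    · exact hp.start hm
    · exact hstart hm
  refine ⟨fun k hk => ?_, fun k hk1 hk2 => ?_, fun k hk1 hk2 w => ?_, fun hm => ?_, fun hm => ?_⟩
  · rw [hp.below k (by omega), replaceCount_of_le hk]
  · split_ifs with hkx
    · rw [hp.below k hkx]
      exact apply_replaceCount hk1 hkx (by rw [e1 k hk1 hkx]; omega)
    · have := hp.apply k (by omega) hk2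
      rwa [replaceCount_of_lt (by omega)] at this
  · rcases lt_trichotomy k x.rank with hkx | hkx | hkx
    · rw [if_pos hkx.le, if_pos (by omega)]
      have a1 := e1 k hk1 hkx.le
      have a2 := e1 (k + 1) (by omega) hkx
      have a3 := e2 (k + 1) hkx
      rcases Nat.lt_or_ge k (2 * m) with hkm | hkm
      · exact .slideRight r hkm (by omega)
      · exact .slideDownOdd r r hkm (by omega) le_rfl rfl (by omega)
    · subst hkx
      rw [if_pos le_rfl, if_neg (by omega), hstart']
      have a1 := e1 _ hk1 le_rfl
      rcases Nat.lt_or_ge x.rank (2 * m) with hkm | hkm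
      · refine .slideRight r hkm ?_
        have := hμ.le_of_le (i := r + 1) (c := c) hxN (by simp only [RankColRel] at hxy; omega)
        omega
      · refine .slideRightOdd r hkm ?_
        have := hμ (x.rank + 1) hxN r (c + 1)
        omega
    · rw [if_neg (by omega), if_neg (by omega)]
      have := hp.trans k hkx hk2 w
      rwa [replaceCount_of_lt hkx, replaceCount_of_lt (by omega)] at this
  · split_ifs with hzx'
    · rfl
    · obtain rfl : z = x.rank := by omega
      exact hstart'
  · rw [if_pos (by omega)]
    have a1 := e1 (z + 1) (by omega) (by omega)
    have a2 := e2 (z + 1) (by omega)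
    exact ⟨le_rfl, rfl, by omega⟩

theorem IsPunctured.isSlidePath_down (h : IsPunctured T r c z)
    (hμ : Encodes (2 * m + n) (ranks T) μ) {y : Letter m n} (hy : ranks T (r + 1) c = y.rank)
    (hyx : ¬ RankColRel m (ranks T r (c + 1)) y.rank)
    (hp : IsSlidePath m (2 * m + n) (r + 1) y.rank (replaceCount μ r z y.rank) μ' ι) :
    IsSlidePath m (2 * m + n) r z μ μ' fun k => if k ≤ y.rank then r else ι k := by
  have hz := h.hole
  have hyN : y.rank + 1 ≤ 2 * m + n := y.rank_lt
  have hzy := h.col_le r c le_rfl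
  have hcol := h.col_rel r c le_rfl le_rfl
  rw [hz, hy] at hzy hcol
  simp only [RankColRel] at hyx
  have e1 : ∀ k, z < k → k ≤ y.rank → μ k r = c + 1 := fun k hk1 hk2 =>
    hμ.eq_of_lt_of_le (by omega) (by omega) (by omega)
  have e2 : ∀ k, k ≤ y.rank → μ k (r + 1) ≤ c := fun k hk => hμ.le_of_le (by omega) (by omega)
  -- The letter to the right of `y` is larger than `y`: otherwise the entry above it would be small
  -- enough to move left instead.
  have e3 : μ (y.rank + 1) (r + 1) = c + 1 := by
    refine hμ.eq_of_lt_of_le hyN (by omega) ?_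
    have b1 := h.col_le r (c + 1) le_rfl
    have b2 := h.col_rel r (c + 1) le_rfl (by omega)
    omega
  have e4 : 2 * m ≤ y.rank → μ (y.rank + 1) r = c + 1 := fun hm =>
    hμ.eq_of_lt_of_le hyN (by omega) (by omega)
  refine ⟨fun k hk => ?_, fun k hk1 hk2 => ?_, fun k hk1 hk2 w => ?_, fun hm => ?_, fun hm => ?_⟩
  · rw [hp.below k (by omega), replaceCount_of_le hk]
  · split_ifs with hkx
    · rw [hp.below k hkx]
      exact apply_replaceCount hk1 hkx (by rw [e1 k hk1 hkx]; omega)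
    · have := hp.apply k (by omega) hk2
      rwa [replaceCount_of_lt (by omega)] at this
  · rcases lt_trichotomy k y.rank with hkx | hkx | hkx
    · rw [if_pos hkx.le, if_pos (by omega)]
      have a1 := e1 k hk1 hkx.le
      have a2 := e1 (k + 1) (by omega) hkx
      have a3 := e2 (k + 1) hkx
      rcases Nat.lt_or_ge k (2 * m) with hkm | hkm
      · exact .slideRight r hkm (by omega)
      · exact .slideDownOdd r r hkm (by omega) le_rfl rfl (by omega)
    · subst hkx
      rw [if_pos le_rfl, if_neg (by omega)]
      have a1 := e1 _ hk1 le_rfl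
      rcases Nat.lt_or_ge y.rank (2 * m) with hkm | hkm
      · rw [hp.start hkm]
        exact .slideDown r hkm (by omega)
      · obtain ⟨b1, b2, b3⟩ := hp.startOdd hkm
        rw [replaceCount_of_lt (show _ < _ + 1 from Nat.lt_succ_self _)] at b2 b3
        have := e4 hkm
        exact .slideDownOdd r _ hkm (by omega) (by omega) (by omega) (by omega)
    · rw [if_neg (by omega), if_neg (by omega)]
      have := hp.trans k hkx hk2 w
      rwa [replaceCount_of_lt hkx, replaceCount_of_lt (by omega)] at this
  · rw [if_pos (by omega)]
  · split_ifs with hzy'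
    · have a1 := e1 (z + 1) (by omega) (by omega)
      have a2 := e2 (z + 1) (by omega)
      exact ⟨le_rfl, rfl, by omega⟩
    · obtain rfl : z = y.rank := by omega
      obtain ⟨b1, b2, b3⟩ := hp.startOdd hm
      rw [replaceCount_of_lt (show _ < _ + 1 from Nat.lt_succ_self _)] at b2 b3
      have := e4 hm
      exact ⟨by omega, by omega, by omega⟩

/-- Each slide preserves the bound on `T.size` because it trades one unit of fuel for one step of
the hole. With no fuel left the bound contradicts `add_lt_size`, so the slides never stop early. -/
theorem jeuDeTaquin_isSlidePath : ∀ (fuel : ℕ) (T : Tableau (Letter m n)) (r c z : ℕ)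
    (μ : ℕ → ℕ → ℕ), IsPunctured T r c z → Encodes (2 * m + n) (ranks T) μ →
    T.size ≤ fuel + r + c →
    (jeuDeTaquin fuel T r c).1.NoEmptyRow ∧
    ∃ μ' ι, Encodes (2 * m + n) (ranks (jeuDeTaquin fuel T r c).1) μ' ∧
      IsSlidePath m (2 * m + n) r z μ μ' ι ∧ ι (2 * m + n) = (jeuDeTaquin fuel T r c).2 := by
  intro fuel
  induction fuel with
  | zero =>
    intro T r c z μ h hμ hs
    have := add_lt_size h.noEmptyRow h.lt_rowLen
    omega
  | succ fuel ih =>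
    intro T r c z μ h hμ hs
    have hsize : ∀ x, (T.setEntry r c x).size = T.size := fun x => by rw [size, shape_setEntry, size]
    have right : ∀ x : Letter m n, T.entry r (c + 1) = some x →
        RankColRel m x.rank (ranks T (r + 1) c) →
        (jeuDeTaquin fuel (T.setEntry r c x) r (c + 1)).1.NoEmptyRow ∧
        ∃ μ' ι, Encodes (2 * m + n) (ranks (jeuDeTaquin fuel (T.setEntry r c x) r (c + 1)).1) μ' ∧
          IsSlidePath m (2 * m + n) r z μ μ' ι ∧
          ι (2 * m + n) = (jeuDeTaquin fuel (T.setEntry r c x) r (c + 1)).2 := by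
      intro x hx hxy
      have hx' : ranks T r (c + 1) = x.rank := cell_of_some hx
      have hzx := h.row_mono r (Nat.le_succ c)
      rw [h.hole, Nat.succ_eq_add_one, hx'] at hzx
      obtain ⟨h1, μ', ι, h2, h3, h4⟩ := ih _ r (c + 1) x.rank _ (h.slideRight hx' hxy)
        (h.encodes_setEntry hμ hzx hx'.ge) (by rw [hsize]; omega)
      refine ⟨h1, μ', _, h2, h.isSlidePath_right hμ hx' hxy h3, ?_⟩
      rw [if_neg (by have := x.rank_lt; omega), h4]
    have down : ∀ y : Letter m n, T.entry (r + 1) c = some y →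
        ¬ RankColRel m (ranks T r (c + 1)) y.rank →
        (jeuDeTaquin fuel (T.setEntry r c y) (r + 1) c).1.NoEmptyRow ∧
        ∃ μ' ι, Encodes (2 * m + n) (ranks (jeuDeTaquin fuel (T.setEntry r c y) (r + 1) c).1) μ' ∧
          IsSlidePath m (2 * m + n) r z μ μ' ι ∧
          ι (2 * m + n) = (jeuDeTaquin fuel (T.setEntry r c y) (r + 1) c).2 := by
      intro y hy hyx
      have hy' : ranks T (r + 1) c = y.rank := cell_of_some hy
      have hzy := h.col_le r c le_rfl
      rw [h.hole, hy'] at hzy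
      have hyx' : y.rank ≤ ranks T r (c + 1) := by
        simp only [RankColRel] at hyx
        omega
      obtain ⟨h1, μ', ι, h2, h3, h4⟩ := ih _ (r + 1) c y.rank _ (h.slideDown hy' hyx')
        (h.encodes_setEntry hμ hzy hyx') (by rw [hsize]; omega)
      refine ⟨h1, μ', _, h2, h.isSlidePath_down hμ hy' hyx h3, ?_⟩
      rw [if_neg (by have := y.rank_lt; omega), h4]
    rw [jeuDeTaquin]
    rcases hx : T.entry r (c + 1) with _ | x <;> rcases hy : T.entry (r + 1) c with _ | y
    · obtain ⟨μ', h1, h2⟩ := h.isSlidePath_removeBox hμ (cell_of_none hx) (cell_of_none hy)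
      exact ⟨noEmptyRow_removeBox T r, μ', _, h1, h2, rfl⟩
    · refine down y hy ?_
      have h1 : ranks T r (c + 1) = 2 * m + n := cell_of_none hx
      have := y.rank_lt
      simp only [RankColRel, h1]
      omega
    · refine right x hx ?_
      have h1 : ranks T (r + 1) c = 2 * m + n := cell_of_none hy
      exact Or.inl (h1 ▸ x.rank_lt)
    · have h1 : ranks T r (c + 1) = x.rank := cell_of_some hx
      have h2 : ranks T (r + 1) c = y.rank := cell_of_some hy
      by_cases hxy : x.ColRel y
      · simp only [if_pos hxy]
        exact right x hx (h2 ▸ Letter.colRel_iff.1 hxy)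
      · simp only [if_neg hxy]
        exact down y hy (h1 ▸ fun h => hxy (Letter.colRel_iff.2 h))

end

end Spo

/-! ### The whole spo-insertion follows the local rules -/

namespace Spo

open LevelState Tableau

theorem Encodes.row_mono {N : ℕ} {f μ : ℕ → ℕ → ℕ} (h : Encodes N f μ) (hle : ∀ i c, f i c ≤ N)
    (i : ℕ) : Monotone (f i) := by
  refine monotone_nat_of_le_succ fun c => ?_
  rcases (hle i (c + 1)).lt_or_eq with h1 | h1
  · have h2 := (h (f i (c + 1) + 1) h1 i (c + 1)).1 (by omega)
    have h3 := (h (f i (c + 1) + 1) h1 i c).2 (by omega)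
    omega
  · rw [h1]; exact hle i c

section

variable {m n : ℕ}

/-- Appending a letter is the same as bumping an absent box, whose mark exceeds the rank of every
letter. -/
theorem rowInsert_append {x : Letter m n} {T : Tableau (Letter m n)} {i : ℕ}
    {T' : Tableau (Letter m n)} {row : List (Letter m n)} (hT : T.getD i [] = row)
    (hT' : T'.getD i [] = row ++ [x])
    (h : ∀ y ∈ row, ¬ x.ColRel y) :
    RowInsert m x.rank (ranks T i) (ranks T' i) (2 * m + n) := by
  refine ⟨row.length, ?_, Or.inl x.rank_lt, fun c hc hrel => ?_, ?_, fun c hc => ?_⟩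
  · exact cell_of_none (by simp only [entry, hT]; exact List.getElem?_eq_none le_rfl)
  · have h1 : T.entry i c = some row[c] := by
      simp only [entry, hT]
      exact List.getElem?_eq_getElem hc
    rw [ranks, cell_of_some h1] at hrel
    exact h _ (List.getElem_mem hc) (Letter.colRel_iff.2 hrel)
  · exact cell_of_some (by simp only [entry, hT']; simp)
  · have h1 : T'.entry i c = T.entry i c := by
      simp only [entry, hT, hT']
      rcases Nat.lt_or_ge c row.length with h2 | h2
      · rw [List.getElem?_append_left h2]
      · rw [List.getElem?_eq_none h2, List.getElem?_eq_none (by simp; omega)]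
    simp [ranks, cell, h1]

theorem rowInsert_set {x y : Letter m n} {T : Tableau (Letter m n)} {i : ℕ}
    {T' : Tableau (Letter m n)} {row : List (Letter m n)} {p : ℕ} (hT : T.getD i [] = row)
    (hT' : T'.getD i [] = row.set p x) (hp : row[p]? = some y) (hxy : x.ColRel y)
    (h : ∀ c, c < p → ¬ RankColRel m x.rank (ranks T i c)) :
    RowInsert m x.rank (ranks T i) (ranks T' i) y.rank := by
  have hlen : p < row.length := (List.getElem?_eq_some_iff.1 hp).1
  refine ⟨p, ?_, Letter.colRel_iff.1 hxy, h, ?_, fun c hc => ?_⟩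
  · exact cell_of_some (by simp only [entry, hT, hp])
  · exact cell_of_some (by simp only [entry, hT']; rw [List.getElem?_set, if_pos rfl, if_pos hlen])
  · have h1 : T'.entry i c = T.entry i c := by
      simp only [entry, hT, hT']
      rw [List.getElem?_set, if_neg hc.symm]
    simp [ranks, cell, h1]

/-- What the bumping stage, started in row `r`, does to the rows `T`, the result being `T'`. The
letters that enter the rows have the ranks `ξ i`; only the first `d` rows are changed. -/
structure IsBumping (r : ℕ) (T T' : Tableau (Letter m n)) (e : BumpEnd) (ξ : ℕ → ℕ) (d : ℕ) :
    Prop where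
  noEmptyRow : T'.NoEmptyRow
  insert : ∀ i, i < d → RowInsert m (ξ i) (ranks T i) (ranks T' i) (ξ (i + 1))
  symplectic : ∀ i, i < d → ξ (i + 1) < 2 * m → 2 * (r + i + 1) ≤ ξ (i + 1)
  rest : ∀ i, d ≤ i → ranks T' i = ranks T i
  last : (∃ R, e = .newBox R ∧ r + d = R + 1 ∧ ξ d = 2 * m + n ∧ ∀ i, i < d → ξ i < 2 * m + n) ∨
    ∃ R c, e = .hole R c ∧ r + d = R ∧ ranks T d c < 2 * m ∧ ranks T d c < 2 * (R + 1) ∧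
      RankColRel m (ξ d) (ranks T d c) ∧ ∀ c', c' < c → ¬ RankColRel m (ξ d) (ranks T d c')

theorem ranks_cons_succ (row : List (Letter m n)) (T : Tableau (Letter m n)) (i : ℕ) :
    ranks (row :: T) (i + 1) = ranks T i := by
  funext c
  simp [ranks, cell, entry]

theorem bump_isBumping (T : Tableau (Letter m n)) : ∀ (r : ℕ) (x : Letter m n), T.NoEmptyRow →
    ∃ ξ d, ξ 0 = x.rank ∧ IsBumping r T (bump r x T).1 (bump r x T).2 ξ d := by
  induction T with
  | nil =>
    intro r x _
    refine ⟨fun i => if i = 0 then x.rank else 2 * m + n, 1, rfl, ⟨?_, fun i hi => ?_,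
      fun i hi => ?_, fun i hi => ?_, Or.inl ⟨r, rfl, rfl, rfl, fun i hi => ?_⟩⟩⟩
    · intro row hrow
      simp only [bump, List.mem_singleton] at hrow
      simp [hrow]
    · obtain rfl : i = 0 := by omega
      exact rowInsert_append (row := []) rfl rfl (by simp)
    · simp
    · obtain ⟨j, rfl⟩ : ∃ j, i = j + 1 := ⟨i - 1, by omega⟩
      simp only [bump, ranks_cons_succ]
      funext c
      simp [ranks, cell, entry]
    · obtain rfl : i = 0 := by omega
      exact x.rank_lt
  | cons row rows ih =>
    intro r x hne
    have hne' : Tableau.NoEmptyRow rows := fun w hw => hne w (List.mem_cons_of_mem _ hw)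
    have hbefore : ∀ c, c < row.findIdx (fun y => decide (x.ColRel y)) →
        ¬ RankColRel m x.rank (ranks (row :: rows) 0 c) := by
      intro c hc hrel
      have h1 : c < row.length := hc.trans_le List.findIdx_le_length
      have h2 := List.not_of_lt_findIdx hc
      have h3 : Tableau.entry (row :: rows) 0 c = some row[c] := List.getElem?_eq_getElem h1
      rw [ranks, cell_of_some h3] at hrel
      exact absurd (Letter.colRel_iff.2 hrel) (by simpa using h2)
    rw [bump]
    rcases hy : row[row.findIdx fun y => decide (x.ColRel y)]? with _ | y
    · have hall : ∀ y ∈ row, ¬ x.ColRel y := by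
        intro y hy' hrel
        have := List.findIdx_lt_length_of_exists (xs := row) (p := fun y => decide (x.ColRel y))
          ⟨y, hy', by simpa using hrel⟩
        rw [List.getElem?_eq_none_iff] at hy
        omega
      refine ⟨fun i => if i = 0 then x.rank else 2 * m + n, 1, rfl, ⟨?_, fun i hi => ?_,
        fun i hi => ?_, fun i hi => ?_, Or.inl ⟨r, rfl, rfl, rfl, fun i hi => ?_⟩⟩⟩
      · intro w hw
        simp only [List.mem_cons] at hw
        rcases hw with rfl | hw
        · simp
        · exact hne' w hw
      · obtain rfl : i = 0 := by omega
        refine rowInsert_append (row := row) rfl ?_ hall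
        simp
      · simp
      · obtain ⟨j, rfl⟩ : ∃ j, i = j + 1 := ⟨i - 1, by omega⟩
        simp only [ranks_cons_succ]
      · obtain rfl : i = 0 := by omega
        exact x.rank_lt
    · have hlen := (List.getElem?_eq_some_iff.1 hy).1
      have hrel : x.ColRel y := by
        have := List.findIdx_getElem (w := hlen)
        rw [(List.getElem?_eq_some_iff.1 hy).2] at this
        simpa using this
      have hy' : ranks (row :: rows) 0 (row.findIdx fun y => decide (x.ColRel y)) = y.rank :=
        cell_of_some hy
      simp only
      by_cases hv : y.Violates (r + 1)
      · simp only [if_pos hv]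
        have hv' := Letter.violates_iff.1 hv
        refine ⟨fun _ => x.rank, 0, rfl, ⟨hne, fun i hi => by omega, fun i hi => by omega,
          fun i hi => rfl, Or.inr ⟨r, _, rfl, rfl, ?_⟩⟩⟩
        rw [hy']
        exact ⟨hv'.1, hv'.2, Letter.colRel_iff.1 hrel, hbefore⟩
      · simp only [if_neg hv]
        obtain ⟨ξ, d, h0, hb⟩ := ih (r + 1) y hne'
        refine ⟨fun i => if i = 0 then x.rank else ξ (i - 1), d + 1, rfl, ⟨?_, fun i hi => ?_,
          fun i hi => ?_, fun i hi => ?_, ?_⟩⟩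
        · intro w hw
          rcases List.mem_cons.1 hw with rfl | hw
          · have := hne row (by simp)
            rw [← List.length_pos_iff] at this ⊢
            simpa using this
          · exact hb.noEmptyRow w hw
        · rcases i with _ | i
          · simp only [if_true, Nat.zero_add, one_ne_zero, if_false, Nat.sub_self, h0]
            exact rowInsert_set (row := row) rfl rfl hy hrel hbefore
          · simpa [ranks_cons_succ] using hb.insert i (by omega)
        · rcases i with _ | i
          · simp only [Nat.zero_add, one_ne_zero, if_false, Nat.sub_self, h0]
            rw [Letter.violates_iff] at hv
            omega
          · have := hb.symplectic i (by omega)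
            simp only [Nat.add_eq_zero_iff, one_ne_zero, and_false, if_false,
              Nat.add_sub_cancel]
            omega
        · obtain ⟨j, rfl⟩ : ∃ j, i = j + 1 := ⟨i - 1, by omega⟩
          rw [ranks_cons_succ, ranks_cons_succ]
          exact hb.rest j (by omega)
        · rcases hb.last with ⟨R, h1, h2, h3, h4⟩ | ⟨R, c, h1, h2, h3⟩
          · refine Or.inl ⟨R, h1, by omega, by simpa using h3, fun i hi => ?_⟩
            rcases i with _ | i
            · exact x.rank_lt
            · simpa using h4 i (by omega)
          · refine Or.inr ⟨R, c, h1, by omega, ?_⟩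
            simpa [ranks_cons_succ] using h3

/-- The state of the last level. -/
def Change.state : Change → LevelState
  | .added r => plus r
  | .removed r => minus r

variable {T T' : Tableau (Letter m n)} {μ : ℕ → ℕ → ℕ} {ξ : ℕ → ℕ} {d : ℕ}

theorem IsBumping.encodes {r : ℕ} {e : BumpEnd} (hb : IsBumping r T T' e ξ d)
    (hT : IsSpoTableau T) (hμ : Encodes (2 * m + n) (ranks T) μ) :
    Encodes (2 * m + n) (ranks T') (bumpCount μ ξ d) :=
  encodes_bumpCount hb.insert hb.rest hT.isFilling.row_mono hμ

theorem IsBumping.isPath_newBox {R : ℕ} (hb : IsBumping 0 T T' (.newBox R) ξ d)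
    (hT : IsSpoTableau T) (hμ : Encodes (2 * m + n) (ranks T) μ) :
    IsPath m (2 * m + n) (ξ 0) μ (bumpCount μ ξ d) (bumpState ξ d) ∧
      bumpState ξ d (2 * m + n) = plus R := by
  rcases hb.last with ⟨R', h1, h2, h3, h4⟩ | ⟨R', c, h1, -⟩
  · cases h1
    obtain rfl : d = R + 1 := by omega
    refine ⟨⟨?_, fun k hk => ?_, fun k hk => ?_⟩, ?_⟩
    · rw [bumpState, if_pos (Nat.zero_le _)]
    · exact apply_bumpState hb.insert h3.ge hk
    · refine trans_bumpState hb.insert hT.isFilling.row_mono hμ h3.ge le_rfl (fun i hi => ?_) hk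
      simpa using hb.symplectic i hi
    · have := h4 0 (by omega)
      rw [bumpState, if_neg (by omega),
        bumpRow_eq hb.insert h3.ge le_rfl (by omega) (h4 R (by omega)) h3.ge]
  · cases h1

/-- The letter entering row `R` is legal there, so its rank is at least `2 * R`; the letter it would
bump is illegal one row lower, so its rank is less than `2 * R + 2`. As letters of `B₀` bump
strictly larger ones, the two are the unbarred and the barred letter of that row. -/
theorem IsBumping.hole_spec {R c : ℕ} (hb : IsBumping 0 T T' (.hole R c) ξ d)
    (hT : IsSpoTableau T) : d = R ∧ ξ R = 2 * R ∧ ranks T R c = 2 * R + 1 ∧ R < m := by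
  rcases hb.last with ⟨R', h1, -⟩ | ⟨R', c', h1, h2, h3, h4, h5, -⟩
  · cases h1
  · cases h1
    obtain rfl : d = R := by omega
    have h6 := hT.isFilling.symplectic d c h3
    have h7 : 2 * d ≤ ξ d ∨ 2 * m ≤ ξ d := by
      rcases d with _ | d
      · omega
      · have := hb.symplectic d (by omega)
        rw [Nat.zero_add] at this
        omega
    simp only [RankColRel] at h5
    omega

theorem IsBumping.isPunctured {R c : ℕ} (hb : IsBumping 0 T T' (.hole R c) ξ d)
    (hT : IsSpoTableau T) (hμ : Encodes (2 * m + n) (ranks T) μ) :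
    IsPunctured T' R c (2 * R + 1) := by
  obtain ⟨rfl, h1, h2, h3⟩ := hb.hole_spec hT
  have hf := hT.isFilling
  refine ⟨hb.noEmptyRow, (hb.encodes hT hμ).row_mono (ranks_le T'), ?_, by omega,
    fun i d hi => ?_, fun i d hi _ => ?_, fun i d hi _ => ?_⟩
  · rw [hb.rest d le_rfl, h2]
  · rw [hb.rest i hi, hb.rest (i + 1) (by omega)]
    exact hf.col i d
  · rw [hb.rest i hi]
    exact hf.row_strict i d
  · rw [hb.rest i hi, hb.rest (i + 1) (by omega)]
    exact hf.col_strict i d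

/-- The path has three stretches: bumping up to level `2 * R`, the pending level `2 * R + 1` where
the discarded unbarred letter leaves no trace in the shape, and the slides above it. -/
theorem IsBumping.isPath_hole {R c : ℕ} (hb : IsBumping 0 T T' (.hole R c) ξ d)
    (hT : IsSpoTableau T) (hμ : Encodes (2 * m + n) (ranks T) μ) {μ' : ℕ → ℕ → ℕ} {ι : ℕ → ℕ}
    (hs : IsSlidePath m (2 * m + n) R (2 * R + 1) (bumpCount μ ξ d) μ' ι) :
    ∃ σ, IsPath m (2 * m + n) (ξ 0) μ μ' σ ∧ σ (2 * m + n) = minus (ι (2 * m + n)) := by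
  obtain ⟨rfl, h1, h2, h3⟩ := hb.hole_spec hT
  have hf := hT.isFilling
  have hmono := bump_mono hb.insert
  -- All bumped and placed letters have rank at most `2 * d`, so the higher levels do not notice the
  -- bumping.
  have hbelow : ∀ k, 2 * d < k → bumpCount μ ξ d k = μ k := by
    intro k hk
    funext i
    rw [bumpCount, if_neg]
    · rfl
    · rintro ⟨h4, -, h5⟩
      have := hmono (i + 1) d h4 le_rfl
      omega
  refine ⟨fun k => if k ≤ 2 * d then bumpState ξ d k else if k = 2 * d + 1 then pend else
    minus (ι k), ⟨?_, fun k hk => ?_, fun k hk => ?_⟩, ?_⟩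
  · rw [if_pos (Nat.zero_le _), bumpState, if_pos (Nat.zero_le _)]
  · rcases lt_trichotomy k (2 * d + 1) with hkd | hkd | hkd
    · rw [if_pos (by omega), hs.below k hkd.le]
      exact apply_bumpState hb.insert h1.ge (by omega)
    · rw [if_neg (by omega), if_pos hkd, hs.below k hkd.le, hbelow k (by omega)]
      exact fun _ => rfl
    · rw [if_neg (by omega), if_neg (by omega)]
      have := hs.apply k hkd hk
      rwa [hbelow k (by omega)] at this
  · rcases Nat.lt_or_ge k (2 * d) with hkd | hkd
    · rw [if_pos hkd.le, if_pos (by omega)]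
      refine trans_bumpState hb.insert hf.row_mono hμ h1.ge (by omega) (fun i hi => ?_) hkd
      simpa using hb.symplectic i hi
    · rcases hkd.eq_or_lt with rfl | hkd
      · rw [if_pos le_rfl, if_neg (by omega), if_pos rfl]
        rcases d with _ | d
        · rw [bumpState, if_pos (by omega)]
          exact .startPend h1.symm rfl (by omega)
        · have h4 := hb.insert d (by omega)
          have h5 := h4.rel
          simp only [RankColRel] at h5
          have h6 := hmono 0 d (Nat.zero_le _) (by omega)
          rw [bumpState, if_neg (by omega),
            bumpRow_eq hb.insert h1.ge le_rfl (by omega) (show ξ d < 2 * (d + 1) by omega) h1.ge]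
          refine .bumpPend d (by omega) ?_ rfl
          rw [h1] at h4
          exact h4.count_lt (hμ _ (by omega) d) (hμ _ (by omega) d)
      · rcases (show 2 * d + 1 ≤ k from hkd).eq_or_lt with rfl | hkd'
        · rw [if_neg (by omega), if_pos rfl, if_neg (by omega), if_neg (by omega),
            hs.start (by omega)]
          refine .cancel d (by omega) rfl ?_
          have := hμ (2 * d + 1) (by omega) d c
          have := hμ (2 * d + 1 + 1) (by omega) d c
          omega
        · rw [if_neg (by omega), if_neg (by omega), if_neg (by omega), if_neg (by omega)]
          have := hs.trans k hkd' hk (ξ 0)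
          rwa [hbelow k (by omega), hbelow (k + 1) (by omega)] at this
  · change (if _ then _ else if _ then _ else _) = _
    rw [if_neg (by omega), if_neg (by omega)]

theorem IsPath.bounded {m N x : ℕ} {μ μ' : ℕ → ℕ → ℕ} {σ : ℕ → LevelState}
    (h : IsPath m N x μ μ' σ) (hb : ∃ B, ∀ i, B ≤ i → μ N i = 0) :
    ∃ B, ∀ i, B ≤ i → μ' N i = 0 := by
  obtain ⟨B, hB⟩ := hb
  have ha := h.apply N le_rfl
  rcases hs : σ N with _ | j | _ | j <;> rw [hs] at ha
  · exact ⟨B, fun i hi => (ha i).trans (hB i hi)⟩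
  · exact ⟨max B (j + 1), fun i hi => (ha.2 i (by omega)).trans (hB i (by omega))⟩
  · exact ⟨B, fun i hi => (ha i).trans (hB i hi)⟩
  · exact ⟨max B (j + 1), fun i hi => (ha.2 i (by omega)).trans (hB i (by omega))⟩

/-- Bumping and slides are joined into one path. That the result is an spo-tableau then comes from
the invariance of patterns under paths. -/
theorem spoInsert_isPath (hT : IsSpoTableau T) (hμ : Encodes (2 * m + n) (ranks T) μ)
    (x : Letter m n) : IsSpoTableau (spoInsert T x).1 ∧
      ∃ μ' σ, Encodes (2 * m + n) (ranks (spoInsert T x).1) μ' ∧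
        IsPath m (2 * m + n) x.rank μ μ' σ ∧ σ (2 * m + n) = (spoInsert T x).2.state := by
  have key : (spoInsert T x).1.NoEmptyRow ∧
      ∃ μ' σ, Encodes (2 * m + n) (ranks (spoInsert T x).1) μ' ∧
        IsPath m (2 * m + n) x.rank μ μ' σ ∧ σ (2 * m + n) = (spoInsert T x).2.state := by
    obtain ⟨ξ, d, h0, hb⟩ := bump_isBumping T 0 x (isTableau_shape hT.isTableau).1
    rw [spoInsert]
    generalize bump 0 x T = p at hb
    obtain ⟨T', R | ⟨R, c⟩⟩ := p
    · obtain ⟨h1, h2⟩ := hb.isPath_newBox hT hμ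
      rw [h0] at h1
      exact ⟨hb.noEmptyRow, _, _, hb.encodes hT hμ, h1, h2⟩
    · obtain ⟨h1, μ', ι, h2, h3, h4⟩ := jeuDeTaquin_isSlidePath T'.size T' R c _ _
        (hb.isPunctured hT hμ) (hb.encodes hT hμ) (by omega)
      obtain ⟨σ, h5, h6⟩ := hb.isPath_hole hT hμ h3
      rw [h0] at h5
      exact ⟨h1, μ', σ, h2, h5, by rw [h6, h4]; rfl⟩
  obtain ⟨h1, μ', σ, h2, h3, h4⟩ := key
  refine ⟨isSpoTableau_of_isFilling h1 ?_, μ', σ, h2, h3, h4⟩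
  exact h2.isFilling (h3.isPattern (hμ.isPattern hT.isFilling)) (by omega) (ranks_le _)
    (h3.bounded (hμ.bounded hT.isFilling))

end

end Spo

/-! ### Reverse column bumping is an insertion read backwards -/

namespace Spo

open LevelState Tableau

/-- Reverse bumping in the column `f`, with the result `g`: the letter `b` replaces the letter `a`
in row `p`. -/
structure IsColumnBump (N : ℕ) (f g : ℕ → ℕ) (p a b : ℕ) : Prop where
  old : f p = a
  le : a ≤ b
  below : ∀ i, p < i → b < f i ∨ f i = N
  new : g p = b
  rest : ∀ i, i ≠ p → g i = f i

section

variable {q : ℕ}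

theorem columns_setEntry {Q : Tableau ℕ} {k c : ℕ} (h : c < Q.rowLen k) (y j i : ℕ) :
    columns q (Q.setEntry k c y) j i = if i = k ∧ j = c then y else columns q Q j i := by
  rw [columns, cell, entry_setEntry h]
  split_ifs <;> rfl

theorem columns_removeBox {P : Tableau ℕ} (h : P.NoEmptyRow) {r c : ℕ}
    (hc : P.rowLen r = c + 1) (hd : P.rowLen (r + 1) ≤ c) (j i : ℕ) :
    columns q (P.removeBox r) j i = if i = r ∧ j = c then q + 1 else columns q P j i := by
  rw [columns, cell, entry_removeBox h hc hd]
  split_ifs <;> rfl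

theorem reverseColumns_spec : ∀ (c : ℕ) (Q : Tableau ℕ) (y : ℕ), Q.NoEmptyRow → EntriesIn q Q →
    1 ≤ y → y ≤ q → (∀ j i, j + 1 < c → columns q Q j i ≤ columns q Q (j + 1) i) →
    (∀ d, c = d + 1 → ∃ k, columns q Q d k ≤ y) →
    (reverseColumns c Q y).1.NoEmptyRow ∧ EntriesIn q (reverseColumns c Q y).1 ∧
    (∀ i, (reverseColumns c Q y).1.rowLen i = Q.rowLen i) ∧
    ∃ (ξ p : ℕ → ℕ), ξ 0 = (reverseColumns c Q y).2 ∧ ξ c = y ∧ (∀ j, j ≤ c → 1 ≤ ξ j ∧ ξ j ≤ q) ∧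
      (∀ j, j < c → IsColumnBump (q + 1) (columns q Q j)
        (columns q (reverseColumns c Q y).1 j) (p j) (ξ j) (ξ (j + 1))) ∧
      ∀ j, c ≤ j → columns q (reverseColumns c Q y).1 j = columns q Q j := by
  intro c
  induction c with
  | zero =>
    intro Q y h1 h2 h3 h4 _ _
    exact ⟨h1, h2, fun _ => rfl, fun _ => y, fun _ => 0, rfl, rfl, fun _ _ => ⟨h3, h4⟩,
      fun j hj => by omega, fun _ _ => rfl⟩
  | succ c ih =>
    intro Q y hne hent hy1 hyq hrow hex
    -- Absent boxes carry the mark `q + 1 > y`, in agreement with the value of `any` on `none`.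
    have hpred : ∀ k, (Q.entry k c).any (fun z => decide (z ≤ y)) = true ↔
        columns q Q c k ≤ y := by
      intro k
      rcases h : Q.entry k c with _ | z
      · simp [columns, cell_of_none h]
        omega
      · simp [columns, cell_of_some h]
    obtain ⟨k, hk⟩ : ∃ k, Nat.findGreatest
        (fun k => (Q.entry k c).any (fun z => decide (z ≤ y))) Q.length = k := ⟨_, rfl⟩
    have hlen : ∀ i, columns q Q c i ≤ y → i < Q.length := by
      intro i hi
      rw [← rowLen_pos_iff hne]
      have := (columns_lt_iff hent (c := c) (r := i)).1 (by omega)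
      omega
    have hk1 : columns q Q c k ≤ y := by
      obtain ⟨k', hk'⟩ := hex c rfl
      rw [← hpred, ← hk]
      exact Nat.findGreatest_spec
        (P := fun k => (Q.entry k c).any (fun z => decide (z ≤ y)) = true) (hlen k' hk').le
        ((hpred k').2 hk')
    have hk2 : ∀ i, k < i → y < columns q Q c i := by
      intro i hi
      by_contra hcon
      have h1 := not_lt.1 hcon
      refine Nat.findGreatest_is_greatest
        (P := fun k => (Q.entry k c).any (fun z => decide (z ≤ y)) = true) (n := Q.length) (k := i)
        ?_ (hlen i h1).le ((hpred i).2 h1)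
      rw [hk]
      exact hi
    have hkc : c < Q.rowLen k := (columns_lt_iff hent).1 (by omega)
    obtain ⟨z, hz⟩ := entry_isSome_iff.2 hkc
    have hz' : columns q Q c k = z := cell_of_some hz
    have hzb := hent k c z hz
    have hcols := columns_setEntry (q := q) hkc y
    rw [reverseColumns]
    simp only [hk, hz, Option.getD_some]
    obtain ⟨h1, h2, h3, ξ, p, h4, h5, h6, h7, h8⟩ := ih (Q.setEntry k c y) z
      (hne.setEntry _ _ _) (fun i j a ha => by
        rw [entry_setEntry hkc] at ha
        split_ifs at ha
        · cases ha
          exact ⟨hy1, hyq⟩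
        · exact hent i j a ha) hzb.1 hzb.2
      (fun j i hj => by
        rw [hcols, hcols, if_neg (by omega), if_neg (by omega)]
        exact hrow j i (by omega))
      (fun d hd => ⟨k, by
        rw [hcols, if_neg (by omega)]
        have := hrow d k (by omega)
        rw [← hd] at this
        omega⟩)
    refine ⟨h1, h2, fun i => by rw [h3, rowLen_setEntry], fun j => if j ≤ c then ξ j else y,
      fun j => if j < c then p j else k, ?_, ?_, fun j hj => ?_, fun j hj => ?_, fun j hj => ?_⟩ <;>
      beta_reduce
    · rw [if_pos (Nat.zero_le _), h4]
    · rw [if_neg (by omega)]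
    · split_ifs with h
      · exact h6 j h
      · exact ⟨hy1, hyq⟩
    · rcases (Nat.le_of_lt_succ hj).lt_or_eq with hj' | rfl
      · rw [if_pos hj', if_pos hj'.le, if_pos (by omega)]
        have h9 := h7 j hj'
        have h10 : columns q (Q.setEntry k c y) j = columns q Q j := by
          funext i
          rw [hcols, if_neg (by omega)]
        rwa [h10] at h9
      · rw [if_neg (lt_irrefl _), if_pos le_rfl, if_neg (by omega), h5, h8 j le_rfl]
        refine ⟨hz', by omega, fun i hi => Or.inl (hk2 i hi), ?_, fun i hi => ?_⟩
        · rw [hcols, if_pos ⟨rfl, rfl⟩]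
        · rw [hcols, if_neg (by tauto)]
    · rw [h8 j (by omega)]
      funext i
      rw [hcols, if_neg (by omega)]

end

section

variable {N c r : ℕ} {f g : ℕ → ℕ → ℕ} {ξ p : ℕ → ℕ}

/-- Putting `a` back in place of `b` is a bumping with all letters in `B₁`: the entries above the
exchanged one are smaller than `a` because columns are strict. -/
theorem rowInsert_of_isColumnBump (hf : IsFilling 0 N f)
    (hb : ∀ j, j < c + 1 → IsColumnBump N (f j) (g j) (p j) (ξ j) (ξ (j + 1)))
    (hξ : ∀ j, j < c + 1 → ξ j < N) :
    ∀ j, j < c + 1 → RowInsert 0 (ξ j) (g j) (f j) (ξ (j + 1)) := by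
  intro j hj
  have h := hb j hj
  have hlt := hξ j hj
  refine ⟨p j, h.new, ?_, fun i hi hrel => ?_, h.old, fun i hi => (h.rest i hi).symm⟩
  · have := h.le
    simp only [RankColRel]
    omega
  · rw [h.rest i hi.ne] at hrel
    have h1 := hf.row_mono j hi
    have h2 := hf.row j i
    have h3 := hf.row_strict j i
    have h4 := h.old
    simp only [RankColRel] at hrel
    simp only [Nat.succ_eq_add_one] at h1
    omega

theorem isFilling_of_isColumnBump (hf : IsFilling 0 N f)
    (hb : ∀ j, j < c + 1 → IsColumnBump N (f j) (g j) (p j) (ξ j) (ξ (j + 1)))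
    (hξ : ∀ j, j < c + 1 → ξ j < N) (hN : ξ (c + 1) = N) (hr : f (c + 1) (p c) = N)
    (hrest : ∀ j, c < j → g j = f j) : IsFilling 0 N g := by
  have hξ' : ∀ j, j < c + 1 → ξ (j + 1) ≤ N := by
    intro j hj
    rcases Nat.lt_or_ge (j + 1) (c + 1) with h | h
    · exact (hξ _ h).le
    · obtain rfl : j = c := by omega
      exact hN.le
  have hstrict : ∀ j i i', i < i' → f j i < f j i' ∨ f j i' = N := by
    intro j i i' hi
    have h1 := hf.row_mono j (show i + 1 ≤ i' from hi)
    have h2 := hf.row j i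
    have h3 := hf.row_strict j i
    have h4 := hf.le j i'
    omega
  -- The exchanged entries move weakly down from right to left: the bumped entry has an entry of at
  -- most its own value on its left, so the replaced entry there is not higher up.
  have hp : ∀ j, j < c → p (j + 1) ≤ p j := by
    intro j hj
    by_contra hcon
    have h1 := (hb j (by omega)).below (p (j + 1)) (by omega)
    have h2 := (hb (j + 1) (by omega)).old
    have h3 := hf.col j (p (j + 1))
    have h4 := hξ (j + 1) (by omega)
    omega
  have hge : ∀ j i, f j i ≤ g j i := by
    intro j i
    rcases Nat.lt_or_ge j (c + 1) with hj | hj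
    · have h := hb j hj
      rcases eq_or_ne i (p j) with rfl | hi
      · rw [h.old, h.new]
        exact h.le
      · rw [h.rest i hi]
    · rw [hrest j hj]
  have hle : ∀ j i, g j i ≤ N := by
    intro j i
    rcases Nat.lt_or_ge j (c + 1) with hj | hj
    · have h := hb j hj
      rcases eq_or_ne i (p j) with rfl | hi
      · rw [h.new]
        exact hξ' j hj
      · rw [h.rest i hi]
        exact hf.le j i
    · rw [hrest j hj]
      exact hf.le j i
  have hrow : ∀ j i, g j i < g j (i + 1) ∨ g j (i + 1) = N := by
    intro j i
    have hs := hstrict j i (i + 1) (Nat.lt_succ_self i)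
    rcases Nat.lt_or_ge j (c + 1) with hj | hj
    · have h := hb j hj
      rcases eq_or_ne i (p j) with hi | hi
      · have h1 := h.below (i + 1) (by omega)
        rw [h.rest (i + 1) (by omega), hi, h.new, ← hi]
        omega
      · rw [h.rest i hi]
        have := hge j (i + 1)
        have := hle j (i + 1)
        omega
    · rw [hrest j hj]
      exact hs
  refine ⟨hle, fun j i => ?_, fun j i e => ?_, fun j i => ?_, fun j i _ => by omega,
    fun j i h => by omega, ?_⟩
  · have := hrow j i
    have := hle j i
    omega
  · have := hrow j i
    omega
  · rcases Nat.lt_or_ge j (c + 1) with hj | hj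
    · have h := hb j hj
      rcases eq_or_ne i (p j) with hi | hi
      · rw [hi, h.new]
        rcases Nat.lt_or_ge j c with hj' | hj'
        · have h' := hb (j + 1) (by omega)
          rcases (hp j hj').eq_or_lt with h1 | h1
          · rw [← h1, h'.new]
            exact h'.le
          · rw [h'.rest _ (by omega)]
            have h2 := hstrict (j + 1) _ _ h1
            rw [h'.old] at h2
            have := hξ' j hj
            omega
        · obtain rfl : j = c := by omega
          rw [hrest (j + 1) (by omega), hr, hN]
      · rw [h.rest i hi]
        exact (hf.col j i).trans (hge (j + 1) i)
    · rw [hrest j hj, hrest (j + 1) (by omega)]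
      exact hf.col j i
  · obtain ⟨B, hB⟩ := hf.bounded
    refine ⟨B, fun j i hij => ?_⟩
    have := hge j i
    have := hle j i
    have := hB j i hij
    omega

end

section

variable {q : ℕ} {P : Tableau ℕ} {r c : ℕ}

/-- The last clause is the main one: inserting the expelled entry into the columns of the result,
with `m = 0`, recovers `P` and ends with a new box in column `c`. -/
theorem reverseColumnBump_spec (hP : IsSemistandard q P) (hc : P.rowLen r = c + 1)
    (hd : P.rowLen (r + 1) ≤ c) :
    IsSemistandard q (reverseColumnBump P r).1 ∧
    1 ≤ (reverseColumnBump P r).2 ∧ (reverseColumnBump P r).2 ≤ q ∧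
    (∀ i, (reverseColumnBump P r).1.rowLen i = (P.removeBox r).rowLen i) ∧
    ∀ μ, Encodes (q + 1) (columns q (reverseColumnBump P r).1) μ →
      ∃ μ' σ, Encodes (q + 1) (columns q P) μ' ∧
        IsPath 0 (q + 1) (reverseColumnBump P r).2 μ μ' σ ∧ σ (q + 1) = plus c := by
  have hf := hP.isFilling
  have hne := (isTableau_shape hP.isTableau).1
  obtain ⟨y, hy⟩ := entry_isSome_iff.2 (show c < P.rowLen r by omega)
  have hyb := hP.entries r c y hy
  have hy' : columns q P c r = y := cell_of_some hy
  have hcols := columns_removeBox (q := q) hne hc hd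
  have hlen : (P.getD r []).length - 1 = c := by
    change P.rowLen r - 1 = c
    omega
  have hrb : reverseColumnBump P r = reverseColumns c (P.removeBox r) y := by
    simp only [reverseColumnBump, hlen, hy, Option.getD_some]
  rw [hrb]
  obtain ⟨h1, h2, h3, ξ, p, h4, h5, h6, h7, h8⟩ := reverseColumns_spec (q := q) c (P.removeBox r) y
    (noEmptyRow_removeBox P r)
    (fun i j a ha => by
      rw [entry_removeBox hne hc hd] at ha
      split_ifs at ha
      exact hP.entries i j a ha) hyb.1 hyb.2
    (fun j i hj => by
      rw [hcols, hcols, if_neg (by omega), if_neg (by omega)]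
      exact hf.col j i)
    (fun d hd => ⟨r, by
      rw [hcols, if_neg (by omega)]
      have := hf.col d r
      rw [← hd] at this
      omega⟩)
  obtain ⟨P', hP'⟩ : ∃ P', (reverseColumns c (P.removeBox r) y).1 = P' := ⟨_, rfl⟩
  rw [hP'] at h1 h2 h3 h8 ⊢
  simp only [hP'] at h7
  -- Removing the box in column `c` is treated as one more exchange, of `y` for the mark `q + 1`.
  have hb : ∀ j, j < c + 1 → IsColumnBump (q + 1) (columns q P j) (columns q P' j)
      (if j < c then p j else r) (if j ≤ c then ξ j else q + 1)
      (if j + 1 ≤ c then ξ (j + 1) else q + 1) := by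
    intro j hj
    rcases (Nat.le_of_lt_succ hj).lt_or_eq with hj' | hjc
    · rw [if_pos hj', if_pos hj'.le, if_pos (by omega)]
      have h9 := h7 j hj'
      have h10 : columns q (P.removeBox r) j = columns q P j := by
        funext i
        rw [hcols, if_neg (by omega)]
      rwa [h10] at h9
    · rw [hjc, if_neg (lt_irrefl _), if_pos le_rfl, if_neg (by omega), h5, h8 c le_rfl]
      refine ⟨hy', by omega, fun i hi => Or.inr ?_, ?_, fun i hi => ?_⟩
      · have h9 := columns_le hP.entries c i
        have h10 := hf.row_mono c (show r + 1 ≤ i from hi)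
        have h11 := (columns_lt_iff hP.entries (c := c) (r := r + 1))
        omega
      · rw [hcols, if_pos ⟨rfl, rfl⟩]
      · rw [hcols, if_neg (by tauto)]
  have hξ : ∀ j, j < c + 1 → (if j ≤ c then ξ j else q + 1) < q + 1 := by
    intro j hj
    rw [if_pos (by omega)]
    have := h6 j (by omega)
    omega
  have hN : (if c + 1 ≤ c then ξ (c + 1) else q + 1) = q + 1 := if_neg (by omega)
  have hfill : IsFilling 0 (q + 1) (columns q P') := by
    refine isFilling_of_isColumnBump (ξ := fun j => if j ≤ c then ξ j else q + 1)
      (p := fun j => if j < c then p j else r) hf hb hξ hN ?_ fun j hj => ?_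
    · simp only [lt_irrefl, if_false]
      have h9 := columns_le hP.entries (c + 1) r
      have h11 := (columns_lt_iff hP.entries (c := c + 1) (r := r))
      omega
    · rw [h8 j hj.le]
      funext i
      rw [hcols, if_neg (by omega)]
  have h0 := h6 0 (Nat.zero_le _)
  rw [h4] at h0
  refine ⟨isSemistandard_of_isFilling h1 h2 hfill, h0.1, h0.2, h3, fun μ hμ => ?_⟩
  have hins := rowInsert_of_isColumnBump (ξ := fun j => if j ≤ c then ξ j else q + 1)
    (p := fun j => if j < c then p j else r) hf hb hξ
  have hrest : ∀ j, c + 1 ≤ j → columns q P j = columns q P' j := by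
    intro j hj
    rw [h8 j (by omega)]
    funext i
    rw [hcols, if_neg (by omega)]
  refine ⟨_, bumpState (fun j => if j ≤ c then ξ j else q + 1) (c + 1),
    encodes_bumpCount hins hrest hfill.row_mono hμ, ⟨?_, fun k hk => ?_, fun k hk => ?_⟩, ?_⟩
  · rw [bumpState, if_pos (Nat.zero_le _)]
  · exact apply_bumpState hins hN.ge hk
  · have := trans_bumpState hins hfill.row_mono hμ hN.ge le_rfl (fun i _ h => by omega) hk
    rwa [if_pos (Nat.zero_le _), h4] at this
  · rw [bumpState, if_neg (by rw [if_pos (Nat.zero_le _), h4]; omega),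
      bumpRow_eq hins hN.ge le_rfl (Nat.lt_succ_self c) (hξ c (Nat.lt_succ_self c)) hN.ge]

end

end Spo

/-! ### Insertion and reverse column bumping: injectivity, order and existence -/

namespace Spo

open LevelState Tableau

theorem Encodes.unique {N : ℕ} {f μ ν : ℕ → ℕ → ℕ} (h : Encodes N f μ) (h' : Encodes N f ν)
    {k : ℕ} (hk : k ≤ N) : μ k = ν k := by
  funext i
  have h1 : ∀ c, c < μ k i ↔ c < ν k i := fun c => by rw [← h k hk, ← h' k hk]
  have h2 := h1 (μ k i)
  have h3 := h1 (ν k i)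
  omega

section

variable {m n : ℕ} {T T' : Tableau (Letter m n)}

theorem Encodes.eq_rowLen {μ : ℕ → ℕ → ℕ} (h : Encodes (2 * m + n) (ranks T) μ) :
    μ (2 * m + n) = T.rowLen := by
  funext i
  have h1 : ∀ c, c < μ (2 * m + n) i ↔ c < T.rowLen i := fun c => by
    rw [← h _ le_rfl i c, ranks_lt_iff]
  have h2 := h1 (μ (2 * m + n) i)
  have h3 := h1 (T.rowLen i)
  omega

theorem IsSpoTableau.spoInsert (hT : IsSpoTableau T) (x : Letter m n) :
    IsSpoTableau (spoInsert T x).1 := by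
  obtain ⟨μ, hμ⟩ := hT.isFilling.exists_encodes
  exact (spoInsert_isPath hT hμ x).1

theorem spoInsert_apply_rowLen (hT : IsSpoTableau T) (x : Letter m n) :
    (spoInsert T x).2.state.Apply T.rowLen (spoInsert T x).1.rowLen := by
  obtain ⟨μ, hμ⟩ := hT.isFilling.exists_encodes
  obtain ⟨-, μ', σ, h1, h2, h3⟩ := spoInsert_isPath hT hμ x
  have h4 := h2.apply _ le_rfl
  rwa [h3, hμ.eq_rowLen, h1.eq_rowLen] at h4

theorem Change.state_injective : Function.Injective Change.state := by
  rintro (r | r) (r' | r') h <;> simp only [Change.state, plus.injEq, minus.injEq, reduceCtorEq] at h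
  · rw [h]
  · rw [h]

/-- The kind and the row of the change fix the last state, and the path is reversible from there. -/
theorem spoInsert_injective {x y : Letter m n} (hT : IsSpoTableau T) (hT' : IsSpoTableau T')
    (h : spoInsert T x = spoInsert T' y) : T = T' ∧ x = y := by
  obtain ⟨μ, hμ⟩ := hT.isFilling.exists_encodes
  obtain ⟨ν, hν⟩ := hT'.isFilling.exists_encodes
  obtain ⟨h0, μ', σ, h1, h2, h3⟩ := spoInsert_isPath hT hμ x
  obtain ⟨-, ν', τ, k1, k2, k3⟩ := spoInsert_isPath hT' hν y
  rw [← h] at k1 k3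
  have k2' : IsPath m (2 * m + n) y.rank ν μ' τ :=
    ⟨k2.zero, fun k hk => k1.unique h1 hk ▸ k2.apply k hk, k2.trans⟩
  obtain ⟨h4, h5⟩ := h2.source_unique k2' (hμ.isPattern hT.isFilling) (hν.isPattern hT'.isFilling)
    x.rank_lt (h3.trans k3.symm)
  refine ⟨eq_of_ranks_eq (isTableau_shape hT.isTableau).1 (isTableau_shape hT'.isTableau).1 ?_,
    Letter.rank_injective h4⟩
  exact (hμ.congr h5).eq hν (ranks_le _) (ranks_le _)

theorem spoInsert_rowOrdered {x y : Letter m n} (hT : IsSpoTableau T) (h : x.RowRel y) :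
    RowOrdered (2 * m + n) (spoInsert T x).2.state
      (spoInsert (spoInsert T x).1 y).2.state := by
  obtain ⟨μ, hμ⟩ := hT.isFilling.exists_encodes
  obtain ⟨h0, μ', σ, h1, h2, h3⟩ := spoInsert_isPath hT hμ x
  obtain ⟨-, ν', τ, k1, k2, k3⟩ := spoInsert_isPath h0 h1 y
  rw [← h3, ← k3]
  exact h2.rowOrdered k2 (hμ.isPattern hT.isFilling) (Letter.rowRel_iff.1 h) _ le_rfl

theorem spoInsert_colOrdered {x y : Letter m n} (hT : IsSpoTableau T) (h : y.ColRel x) :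
    ColOrdered (2 * m + n) (spoInsert T x).2.state
      (spoInsert (spoInsert T x).1 y).2.state := by
  obtain ⟨μ, hμ⟩ := hT.isFilling.exists_encodes
  obtain ⟨h0, μ', σ, h1, h2, h3⟩ := spoInsert_isPath hT hμ x
  obtain ⟨-, ν', τ, k1, k2, k3⟩ := spoInsert_isPath h0 h1 y
  rw [← h3, ← k3]
  refine h2.colOrdered k2 (hμ.isPattern hT.isFilling) ?_ _ le_rfl
  rcases Letter.colRel_iff.1 h with h | ⟨h, h'⟩
  · exact Or.inl h
  · exact Or.inr ⟨h.symm, by omega⟩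

/-- The source pattern is realised by a tableau. By determinism the insertion into it cannot follow
any path but the given one. -/
theorem exists_spoInsert_of_path {x : ℕ} {μ μ' : ℕ → ℕ → ℕ} {σ : ℕ → LevelState} {s : Change}
    (hT : IsSpoTableau T) (hμ' : Encodes (2 * m + n) (ranks T) μ') (hμ : IsPattern m (2 * m + n) μ)
    (h : IsPath m (2 * m + n) x μ μ' σ) (hx : x < 2 * m + n) (hs : σ (2 * m + n) = s.state)
    (hb : ∃ B, ∀ i, B ≤ i → μ (2 * m + n) i = 0) :
    ∃ (T₀ : Tableau (Letter m n)) (y : Letter m n), IsSpoTableau T₀ ∧ spoInsert T₀ y = (T, s) := by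
  obtain ⟨f, hf, hfμ⟩ := hμ.exists_filling (by omega) hb
  obtain ⟨T₀, hT₀, rfl⟩ := exists_isSpoTableau hf
  obtain ⟨y, rfl⟩ := Letter.exists_rank_eq hx
  obtain ⟨h0, ν', τ, h1, h2, h3⟩ := spoInsert_isPath hT₀ hfμ y
  refine ⟨T₀, y, hT₀, Prod.ext ?_ ?_⟩
  · refine eq_of_ranks_eq (isTableau_shape h0.isTableau).1 (isTableau_shape hT.isTableau).1 ?_
    refine (h1.congr fun k hk => ?_).eq hμ' (ranks_le _) (ranks_le _)
    exact h2.result_unique h (by omega) hμ hk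
  · apply Change.state_injective
    rw [← h3, ← hs]
    exact h2.state_unique h (by omega) hμ _ le_rfl

theorem exists_spoInsert_added (hT : IsSpoTableau T) {r : ℕ}
    (hr : T.rowLen (r + 1) < T.rowLen r) :
    ∃ (T₀ : Tableau (Letter m n)) (x : Letter m n),
      IsSpoTableau T₀ ∧ spoInsert T₀ x = (T, .added r) := by
  obtain ⟨μ', hμ'⟩ := hT.isFilling.exists_encodes
  obtain ⟨x, hx, μ, σ, h1, h2, h3, h4⟩ := exists_isPath (hμ'.isPattern hT.isFilling) _ le_rfl
    (plus r) (by simpa only [Admissible, hμ'.eq_rowLen] using hr) (by simp)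
  refine exists_spoInsert_of_path hT hμ' h1 h2 hx h3 ?_
  obtain ⟨B, hB⟩ := hμ'.bounded hT.isFilling
  refine ⟨B, fun i hi => ?_⟩
  have := hB i hi
  rw [h4]
  simp only [source]
  split_ifs <;> omega

theorem exists_spoInsert_removed (hT : IsSpoTableau T) {r : ℕ} (hm : r < m)
    (hr : ∀ l, r = l + 1 → T.rowLen r < T.rowLen l) :
    ∃ (T₀ : Tableau (Letter m n)) (x : Letter m n),
      IsSpoTableau T₀ ∧ spoInsert T₀ x = (T, .removed r) := by
  obtain ⟨μ', hμ'⟩ := hT.isFilling.exists_encodes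
  obtain ⟨x, hx, μ, σ, h1, h2, h3, h4⟩ := exists_isPath (hμ'.isPattern hT.isFilling) _ le_rfl
    (minus r) (by
      refine ⟨hm, fun _ => by omega, ?_, fun _ => by omega⟩
      rwa [hμ'.eq_rowLen]) (by simp)
  refine exists_spoInsert_of_path hT hμ' h1 h2 hx h3 ?_
  obtain ⟨B, hB⟩ := hμ'.bounded hT.isFilling
  refine ⟨max B (r + 1), fun i hi => ?_⟩
  have := hB i (by omega)
  rw [h4]
  simp only [source]
  split_ifs <;> omega

end

section

variable {q : ℕ} {P Q : Tableau ℕ} {r s c d : ℕ}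

/-- The last box of row `r` is a corner of the shape, in column `c`. -/
structure IsCorner {α : Type} (P : Tableau α) (r c : ℕ) : Prop where
  rowLen_eq : P.rowLen r = c + 1
  rowLen_succ_le : P.rowLen (r + 1) ≤ c

theorem IsSemistandard.rowLen_anti (h : IsSemistandard q P) : Antitone P.rowLen :=
  antitone_nat_of_succ_le (isTableau_shape h.isTableau).2

theorem IsSpoTableau.rowLen_anti {m n : ℕ} {T : Tableau (Letter m n)} (h : IsSpoTableau T) :
    Antitone T.rowLen :=
  antitone_nat_of_succ_le (isTableau_shape h.isTableau).2

theorem IsSemistandard.noEmptyRow (h : IsSemistandard q P) : P.NoEmptyRow :=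
  (isTableau_shape h.isTableau).1

theorem IsSpoTableau.noEmptyRow {m n : ℕ} {T : Tableau (Letter m n)} (h : IsSpoTableau T) :
    T.NoEmptyRow :=
  (isTableau_shape h.isTableau).1

theorem IsCorner.row_unique (hP : Antitone P.rowLen) (h : IsCorner P r c) (h' : IsCorner P s c) :
    r = s := by
  have h1 := h.rowLen_eq
  have h2 := h.rowLen_succ_le
  have h3 := h'.rowLen_eq
  have h4 := h'.rowLen_succ_le
  by_contra hne
  rcases Nat.lt_or_gt_of_ne hne with hlt | hlt
  · have := hP (show r + 1 ≤ s from hlt)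
    omega
  · have := hP (show s + 1 ≤ r from hlt)
    omega

theorem rowLen_removeBox {α : Type} {P : Tableau α} (h : P.NoEmptyRow) (hc : IsCorner P r c)
    (i : ℕ) : (P.removeBox r).rowLen i = if i = r then c else P.rowLen i := by
  have h1 : ∀ d, d < (P.removeBox r).rowLen i ↔ d < if i = r then c else P.rowLen i := by
    intro d
    rw [← entry_isSome_iff, entry_removeBox h hc.rowLen_eq hc.rowLen_succ_le]
    have h2 := hc.rowLen_eq
    split_ifs with h3 h4 h4
    · simp; omega
    · omega
    · rw [entry_isSome_iff, h4]; omega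
    · exact entry_isSome_iff
  have h2 := h1 ((P.removeBox r).rowLen i)
  have h3 := h1 (if i = r then c else P.rowLen i)
  omega

theorem rowLen_reverseColumnBump (hP : IsSemistandard q P) (hc : IsCorner P r c) (i : ℕ) :
    (reverseColumnBump P r).1.rowLen i = if i = r then c else P.rowLen i := by
  rw [(reverseColumnBump_spec hP hc.rowLen_eq hc.rowLen_succ_le).2.2.2.1 i,
    rowLen_removeBox hP.noEmptyRow hc]

theorem reverseColumnBump_injective (hP : IsSemistandard q P) (hQ : IsSemistandard q Q)
    (hc : IsCorner P r c) (hd : IsCorner Q s d)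
    (h : reverseColumnBump P r = reverseColumnBump Q s) : P = Q ∧ r = s := by
  obtain ⟨h1, -, -, -, h2⟩ := reverseColumnBump_spec hP hc.rowLen_eq hc.rowLen_succ_le
  obtain ⟨-, -, -, -, h3⟩ := reverseColumnBump_spec hQ hd.rowLen_eq hd.rowLen_succ_le
  rw [← h] at h3
  obtain ⟨μ, hμ⟩ := h1.isFilling.exists_encodes
  obtain ⟨μ', σ, h4, h5, h6⟩ := h2 μ hμ
  obtain ⟨ν', τ, k4, k5, k6⟩ := h3 μ hμ
  have hpat := hμ.isPattern h1.isFilling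
  have e : P = Q := by
    refine eq_of_columns_eq hP.noEmptyRow hQ.noEmptyRow hP.entries hQ.entries ?_
    exact (h4.congr fun k hk => h5.result_unique k5 (by omega) hpat hk).eq k4
      (columns_le hP.entries) (columns_le hQ.entries)
  subst e
  have e2 := h5.state_unique k5 (by omega) hpat _ le_rfl
  rw [h6, k6, plus.injEq] at e2
  subst e2
  exact ⟨rfl, hc.row_unique hP.rowLen_anti hd⟩

/-- In reversed time the entry expelled second is inserted first. The bumping lemma for `m = 0`
compares the columns of the two boxes, and for corners a column further to the left means a lower or
equal row. -/
theorem reverseColumnBump_le_iff (hP : IsSemistandard q P) (hc : IsCorner P r c)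
    (hd : IsCorner (reverseColumnBump P r).1 s d) :
    (reverseColumnBump P r).2 ≤ (reverseColumnBump (reverseColumnBump P r).1 s).2 ↔ r ≤ s := by
  obtain ⟨h1, -, -, -, h2⟩ := reverseColumnBump_spec hP hc.rowLen_eq hc.rowLen_succ_le
  obtain ⟨k1, -, -, -, k2⟩ := reverseColumnBump_spec h1 hd.rowLen_eq hd.rowLen_succ_le
  obtain ⟨μ, hμ⟩ := k1.isFilling.exists_encodes
  obtain ⟨μ', σ, h4, h5, h6⟩ := k2 μ hμ
  obtain ⟨μ'', τ, k4, k5, k6⟩ := h2 μ' h4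
  have hpat := hμ.isPattern k1.isFilling
  have hlen := rowLen_reverseColumnBump hP hc
  have hs := hd.rowLen_eq
  have hr := hc.rowLen_eq
  rw [hlen] at hs
  constructor
  · intro hle
    have h7 := h5.colOrdered k5 hpat (by omega) _ le_rfl
    rw [h6, k6] at h7
    simp only [ColOrdered] at h7
    by_contra hcon
    rw [if_neg (by omega)] at hs
    have := hP.rowLen_anti (show s ≤ r by omega)
    omega
  · intro hle
    by_contra hcon
    have h7 := h5.rowOrdered k5 hpat (Or.inl (by omega)) _ le_rfl
    rw [h6, k6] at h7
    simp only [RowOrdered] at h7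
    split_ifs at hs with h8
    · omega
    · have := hP.rowLen_anti (show r + 1 ≤ s by omega)
      have := hc.rowLen_succ_le
      omega

theorem IsPath.ne_minus {N x : ℕ} {μ μ' : ℕ → ℕ → ℕ} {σ : ℕ → LevelState}
    (h : IsPath 0 N x μ μ' σ) (k : ℕ) (hk : k ≤ N) : ∀ i, σ k ≠ minus i := by
  induction k with
  | zero => intro i; rw [h.zero]; simp
  | succ k ih =>
    intro i hi
    have h1 := h.trans k hk
    have h2 := ih (by omega)
    rw [hi] at h1
    generalize σ k = s at h1 h2
    cases h1
    case slideRightOdd => exact h2 _ rfl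
    case slideDownOdd => exact h2 _ rfl
    all_goals omega

/-- The columns of `Q` are realised as an spo-tableau over `q + 1` letters of `B₁`, whose rank `0`
stays unused, and `a` is inserted there. Without `B₀` there is no cancellation, so a box is added.
Reversibility of paths shows that reverse bumping from it gives back `Q` and `a`. -/
theorem exists_reverseColumnBump_eq (hQ : IsSemistandard q Q) {a : ℕ} (h1 : 1 ≤ a) (ha : a ≤ q) :
    ∃ P r c, IsSemistandard q P ∧ IsCorner P r c ∧ reverseColumnBump P r = (Q, a) := by
  obtain ⟨μ, hμ⟩ := hQ.isFilling.exists_encodes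
  have hpat := hμ.isPattern hQ.isFilling
  obtain ⟨T, hT, hTf⟩ : ∃ T : Tableau (Letter 0 (q + 1)), IsSpoTableau T ∧ ranks T = columns q Q :=
    exists_isSpoTableau (by simpa using hQ.isFilling)
  obtain ⟨x, hx⟩ := Letter.exists_rank_eq (m := 0) (n := q + 1) (k := a) (by omega)
  obtain ⟨h2, μ', σ, h3, h4, h5⟩ := spoInsert_isPath hT (μ := μ) (by rw [hTf]; simpa using hμ) x
  rw [hx] at h4
  have hfill := h2.isFilling
  generalize ranks (spoInsert T x).1 = g at h3 hfill
  have e0 : 2 * 0 + (q + 1) = q + 1 := by omega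
  rw [e0] at h3 h4 h5 hfill
  obtain ⟨c, hc⟩ : ∃ c, σ (q + 1) = plus c := by
    rcases h4.last (by omega) (by omega) with h | ⟨i, hi⟩
    · exact h
    · exact absurd hi (h4.ne_minus _ le_rfl i)
  -- Since `1 ≤ a`, level `1` is unaffected, so the entry `0` does not arise.
  have hidle : σ 1 = idle := by
    have h6 := h4.trans 0 (by omega)
    rw [h4.zero] at h6
    generalize σ 1 = s at h6
    cases h6 <;> first | rfl | omega
  obtain ⟨P, hP, rfl⟩ := exists_isSemistandard hfill fun c r => by
    by_contra hcon
    have h6 := (h3 1 (by omega) c r).1 (by omega)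
    have h7 := h4.apply 1 (by omega)
    rw [hidle] at h7
    rw [h7 c, ← hμ 1 (by omega) c r] at h6
    have := one_le_columns hQ.entries c r
    omega
  have hcol : ∀ {R : Tableau ℕ} {ν : ℕ → ℕ → ℕ}, IsSemistandard q R →
      Encodes (q + 1) (columns q R) ν → ∀ i j, j < R.rowLen i ↔ i < ν (q + 1) j := by
    intro R ν hR hν i j
    rw [← columns_lt_iff hR.entries, hν _ le_rfl]
  have h6 := h4.apply _ le_rfl
  rw [hc] at h6
  have hcorner : IsCorner P (μ (q + 1) c) c := by
    have a1 := hcol hP h3 (μ (q + 1) c) c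
    have a2 := hcol hP h3 (μ (q + 1) c) (c + 1)
    have a3 := hcol hP h3 (μ (q + 1) c + 1) c
    have a4 := h6.1
    have a5 := h6.2 (c + 1) (by omega)
    have a6 := hpat.anti (q + 1) le_rfl (Nat.le_succ c)
    simp only [Nat.succ_eq_add_one] at a6
    constructor <;> omega
  refine ⟨P, μ (q + 1) c, c, hP, hcorner, ?_⟩
  obtain ⟨k1, k2, k3, -, k4⟩ := reverseColumnBump_spec hP hcorner.rowLen_eq hcorner.rowLen_succ_le
  obtain ⟨ν, hν⟩ := k1.isFilling.exists_encodes
  obtain ⟨ν', τ, l1, l2, l3⟩ := k4 ν hν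
  have l2' : IsPath 0 (q + 1) (reverseColumnBump P (μ (q + 1) c)).2 ν μ' τ :=
    ⟨l2.zero, fun k hk => l1.unique h3 hk ▸ l2.apply k hk, l2.trans⟩
  obtain ⟨m1, m2⟩ := l2'.source_unique h4 (hν.isPattern k1.isFilling) hpat (by omega)
    (l3.trans hc.symm)
  refine Prod.ext ?_ m1
  refine eq_of_columns_eq k1.noEmptyRow hQ.noEmptyRow k1.entries hQ.entries ?_
  exact (hν.congr m2).eq hμ (columns_le k1.entries) (columns_le hQ.entries)

end

end Spo

/-! ### Adding and removing boxes, and Burge arrays -/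

namespace Spo

open LevelState Tableau

namespace Tableau

variable {α : Type} {T : Tableau α} {r : ℕ}

theorem entry_addBox (hr : r ≤ T.length) (x : α) (i d : ℕ) :
    (T.addBox r x).entry i d = if i = r ∧ d = T.rowLen r then some x else T.entry i d := by
  have h1 : (T.addBox r x).getD i [] = if i = r then T.getD r [] ++ [x] else T.getD i [] := by
    rw [addBox]
    split_ifs with h2 h3 h3
    · subst h3
      simp [List.getD_eq_getElem?_getD, h2]
    · simp [List.getD_eq_getElem?_getD, Ne.symm h3]
    · obtain rfl : r = T.length := by omega
      subst h3
      simp [List.getD_eq_getElem?_getD]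
    · rcases Nat.lt_or_ge i T.length with h4 | h4
      · simp [List.getD_eq_getElem?_getD, List.getElem?_append_left h4]
      · rw [List.getD_eq_default _ _ (by simp; omega), List.getD_eq_default _ _ h4]
  have h3 : T.rowLen r = (T.getD r []).length := rfl
  rw [h3]
  simp only [entry, h1]
  rcases eq_or_ne i r with rfl | h2
  · rw [if_pos rfl]
    rcases lt_trichotomy d (T.getD i []).length with h4 | h4 | h4
    · rw [List.getElem?_append_left h4, if_neg (by omega)]
    · rw [h4, List.getElem?_concat_length, if_pos ⟨rfl, rfl⟩]
    · rw [List.getElem?_eq_none (by rw [List.length_append, List.length_singleton]; exact h4),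
        if_neg (by omega), List.getElem?_eq_none h4.le]
  · rw [if_neg h2, if_neg (by tauto)]

theorem NoEmptyRow.addBox (h : T.NoEmptyRow) (r : ℕ) (x : α) : (T.addBox r x).NoEmptyRow := by
  rw [Tableau.addBox]
  split_ifs with hr
  · intro row hrow
    obtain ⟨i, hi, rfl⟩ := List.mem_iff_getElem.1 hrow
    rw [List.getElem_modify]
    split_ifs
    · simp
    · exact h _ (List.getElem_mem _)
  · intro row hrow
    rcases List.mem_append.1 hrow with h1 | h1
    · exact h row h1
    · simp at h1; simp [h1]

theorem rowLen_addBox (hr : r ≤ T.length) (x : α) (i : ℕ) :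
    (T.addBox r x).rowLen i = if i = r then T.rowLen r + 1 else T.rowLen i := by
  have h1 : ∀ d, d < (T.addBox r x).rowLen i ↔ d < if i = r then T.rowLen r + 1 else T.rowLen i := by
    intro d
    rw [← entry_isSome_iff, entry_addBox hr]
    split_ifs with h3 h4 h4
    · simp; omega
    · omega
    · rw [entry_isSome_iff, h4]; omega
    · exact entry_isSome_iff
  have h2 := h1 ((T.addBox r x).rowLen i)
  have h3 := h1 (if i = r then T.rowLen r + 1 else T.rowLen i)
  omega

/-- A box may be added at the end of row `r`. -/
def IsAddable (T : Tableau α) (r : ℕ) : Prop := ∀ l, r = l + 1 → T.rowLen r < T.rowLen l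

theorem IsAddable.le_length (h : T.IsAddable r) : r ≤ T.length := by
  rcases r with _ | r
  · exact Nat.zero_le _
  · by_contra hcon
    have h1 := h r rfl
    rw [rowLen_of_length_le (i := r) (by omega)] at h1
    omega

theorem size_eq_sum {B : ℕ} (hB : T.length ≤ B) : T.size = ∑ i ∈ Finset.range B, T.rowLen i := by
  induction T generalizing B with
  | nil => simp [size, shape, rowLen]
  | cons row rows ih =>
    rcases B with _ | B
    · simp at hB
    · rw [Finset.sum_range_succ', size, shape, List.map_cons, List.sum_cons, add_comm]
      have h1 := ih (B := B) (by simpa using hB)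
      simp only [size, shape] at h1
      rw [h1]
      rfl

theorem size_eq_succ {β : Type} {T' : Tableau β} (hr : T'.rowLen r = T.rowLen r + 1)
    (h : ∀ i, i ≠ r → T'.rowLen i = T.rowLen i) : T'.size = T.size + 1 := by
  have hmem : r ∈ Finset.range (T.length + T'.length + r + 1) := by simp
  rw [size_eq_sum (B := T.length + T'.length + r + 1) (by omega),
    size_eq_sum (T := T) (B := T.length + T'.length + r + 1) (by omega),
    ← Finset.add_sum_erase _ _ hmem, ← Finset.add_sum_erase _ _ hmem, hr,
    Finset.sum_congr rfl fun i hi => h i (Finset.ne_of_mem_erase hi), add_right_comm]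

end Tableau

section

variable {q : ℕ} {P : Tableau ℕ} {r c : ℕ}

theorem IsSemistandard.mono {q' : ℕ} (h : IsSemistandard q P) (hq : q ≤ q') :
    IsSemistandard q' P :=
  ⟨h.isTableau, fun r c a ha => ⟨(h.entries r c a ha).1, (h.entries r c a ha).2.trans hq⟩⟩

theorem IsSemistandard.of_forall_ne (h : IsSemistandard q P) (hq : ∀ r c, P.entry r c ≠ some q) :
    IsSemistandard (q - 1) P := by
  refine ⟨h.isTableau, fun r c a ha => ?_⟩
  have h1 := h.entries r c a ha
  have h2 : a ≠ q := by
    rintro rfl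
    exact hq r c ha
  omega

/-- The hypothesis `hm` keeps the entry above the new box different from `q`, as strict columns
require. -/
theorem IsSemistandard.addBox (h : IsSemistandard q P) (hq : 1 ≤ q) (hr : P.IsAddable r)
    (hm : ∀ r' c, P.entry r' c = some q → r ≤ r') : IsSemistandard q (P.addBox r q) := by
  have he := entry_addBox hr.le_length q
  have hl := rowLen_addBox hr.le_length q
  have ha := (isTableau_shape h.isTableau).2
  refine ⟨isTableau_of (h.noEmptyRow.addBox r q) (fun i => ?_) (fun i d x y hx hy => ?_)
    (fun i d x y hx hy => ?_), fun i d a hx => ?_⟩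
  · rw [hl, hl]
    have h1 := ha i
    split_ifs with h2 h3 h3
    · omega
    · exact hr i h2.symm
    · subst h3
      omega
    · exact h1
  · rw [he] at hx hy
    split_ifs at hx hy with h1 h2 h2
    · omega
    · have := Tableau.lt_rowLen hy
      rw [h1.1] at this
      omega
    · cases hy
      exact (h.entries i d x hx).2
    · exact h.isTableau.row i d x y hx hy
  · rw [he] at hx hy
    split_ifs at hx hy with h1 h2 h2
    · omega
    · have h3 := Tableau.lt_rowLen hy
      rw [h1.1] at h3
      have h4 := ha r
      omega
    · cases hy
      refine lt_of_le_of_ne (h.entries i d x hx).2 ?_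
      rintro rfl
      have := hm i d hx
      omega
    · exact h.isTableau.col i d x y hx hy
  · rw [he] at hx
    split_ifs at hx with h1
    · cases hx
      exact ⟨hq, le_rfl⟩
    · exact h.entries i d a hx

theorem IsSemistandard.removeBox (h : IsSemistandard q P) (hc : IsCorner P r c) :
    IsSemistandard q (P.removeBox r) := by
  have he : ∀ i d a, (P.removeBox r).entry i d = some a → P.entry i d = some a := by
    intro i d a ha
    rw [entry_removeBox h.noEmptyRow hc.rowLen_eq hc.rowLen_succ_le] at ha
    split_ifs at ha
    exact ha
  refine ⟨isTableau_of (noEmptyRow_removeBox P r) (fun i => ?_)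
    (fun i d x y hx hy => h.isTableau.row i d x y (he _ _ _ hx) (he _ _ _ hy))
    (fun i d x y hx hy => h.isTableau.col i d x y (he _ _ _ hx) (he _ _ _ hy)),
    fun i d a hx => h.entries i d a (he _ _ _ hx)⟩
  rw [rowLen_removeBox h.noEmptyRow hc, rowLen_removeBox h.noEmptyRow hc]
  have h1 := h.rowLen_anti (Nat.le_succ i)
  have h2 := hc.rowLen_eq
  have h3 := hc.rowLen_succ_le
  simp only [Nat.succ_eq_add_one] at h1
  split_ifs with h4 h5 h5
  · omega
  · rw [← h4] at h2
    omega
  · rw [h5]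
    exact h3
  · exact h1

theorem addBox_removeBox (h : P.NoEmptyRow) (hc : IsCorner P r c) (hr : r ≤ (P.removeBox r).length)
    {x : ℕ} (hx : P.entry r c = some x) : (P.removeBox r).addBox r x = P := by
  refine ext_entry ((noEmptyRow_removeBox P r).addBox r x) h fun i d => ?_
  rw [entry_addBox hr, rowLen_removeBox h hc, if_pos rfl,
    entry_removeBox h hc.rowLen_eq hc.rowLen_succ_le]
  split_ifs with h1
  · rw [h1.1, h1.2, hx]
  · rfl

theorem isAddable_of_isCorner {α β : Type} {T : Tableau α} {T' : Tableau β}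
    (ha : Antitone T'.rowLen) (hr : T'.rowLen r = T.rowLen r + 1)
    (h : ∀ i, i ≠ r → T'.rowLen i = T.rowLen i) : T.IsAddable r := by
  rintro l rfl
  have h1 := ha (Nat.le_succ l)
  rw [h l (by omega)] at h1
  simp only [Nat.succ_eq_add_one] at h1
  omega

end

section

variable {L : TwoLine ℕ} {i a : ℕ}

theorem burgeArrays_mono {q q' : ℕ} (h : q ≤ q') : burgeArrays q ⊆ burgeArrays q' := by
  rintro L ⟨h1, h2, h3⟩
  refine ⟨fun p hp => ?_, h2, h3⟩
  have := h1 p hp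
  omega

theorem append_mem_burgeArrays_iff :
    L ++ [(i, a)] ∈ burgeArrays i ↔ L ∈ burgeArrays i ∧ 1 ≤ a ∧ a < i ∧
      ∀ b, L.getLast? = some (i, b) → b ≤ a := by
  constructor
  · rintro ⟨h1, h2, h3⟩
    rw [IsSortedArray, List.isChain_append] at h2
    have h4 := h1 (i, a) (by simp)
    have h5 := h3 (i, a) (by simp)
    refine ⟨⟨fun p hp => h1 p (by simp [hp]), h2.1, fun p hp => h3 p (by simp [hp])⟩, h4.2.2.1, h5,
      fun b hb => ?_⟩
    exact (h2.2.2 _ hb (i, a) (by simp)).2 rfl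
  · rintro ⟨⟨h1, h2, h3⟩, h4, h5, h6⟩
    refine ⟨fun p hp => ?_, ?_, fun p hp => ?_⟩
    · rcases List.mem_append.1 hp with hp | hp
      · exact h1 p hp
      · rw [List.mem_singleton.1 hp]
        simp only
        omega
    · rw [IsSortedArray, List.isChain_append]
      refine ⟨h2, by simp, fun p hp p' hp' => ?_⟩
      simp only [List.head?_cons, Option.mem_def, Option.some.injEq] at hp'
      subst hp'
      refine ⟨(h1 p (List.mem_of_getLast? hp)).2.1, fun e => h6 _ ?_⟩
      rw [hp]
      exact congrArg some (Prod.ext e rfl)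
    · rcases List.mem_append.1 hp with hp | hp
      · exact h3 p hp
      · rw [List.mem_singleton.1 hp]
        exact h5

theorem fst_le_of_isSortedArray {β : Type} [LE β] {π : TwoLine β} {p : ℕ × β}
    (h : IsSortedArray (π ++ [p])) : ∀ p' ∈ π, p'.1 ≤ p.1 := by
  have h1 : (π ++ [p]).IsChain (fun p p' => p.1 ≤ p'.1) := h.imp fun _ _ h => h.1
  have : IsTrans (ℕ × β) (fun p p' => p.1 ≤ p'.1) := ⟨fun _ _ _ => le_trans⟩
  have h2 := List.isChain_iff_pairwise.1 h1
  intro p' hp'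
  exact (List.pairwise_append.1 h2).2.2 p' hp' p (by simp)

theorem burgeArrays_of_getLast (hi : L ∈ burgeArrays i) (h : ∀ b, L.getLast? ≠ some (i, b)) :
    L ∈ burgeArrays (i - 1) := by
  obtain ⟨h1, h2, h3⟩ := hi
  refine ⟨fun p hp => ?_, h2, h3⟩
  have h4 := h1 p hp
  have h5 := h3 p hp
  suffices h : p.1 ≠ i by omega
  intro hpi
  rcases L.eq_nil_or_concat' with rfl | ⟨L', p', rfl⟩
  · simp at hp
  · have h6 : p.1 ≤ p'.1 := by
      rcases List.mem_append.1 hp with hp | hp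
      · exact fst_le_of_isSortedArray h2 p hp
      · rw [List.mem_singleton.1 hp]
    have h7 := h1 p' (by simp)
    refine h p'.2 ?_
    rw [List.getLast?_concat, show i = p'.1 by omega]

end

end Spo

/-! ### One step of the correspondence -/

namespace Spo

open LevelState Tableau

section

variable {m n q i : ℕ} {t : Triple m n} {x y : Letter m n}

theorem mem_triples_iff {T : Tableau (Letter m n)} {P : Tableau ℕ} {L : TwoLine ℕ} :
    (T, P, L) ∈ triples m n q ↔ IsSpoTableau T ∧ IsSemistandard q P ∧
      (∀ i, P.rowLen i = T.rowLen i) ∧ L ∈ burgeArrays q := by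
  constructor
  · rintro ⟨h1, h2, h3, h4⟩
    exact ⟨h1, h2, (shape_eq_iff h2.noEmptyRow h1.noEmptyRow).1 h3, h4⟩
  · rintro ⟨h1, h2, h3, h4⟩
    exact ⟨h1, h2, (shape_eq_iff h2.noEmptyRow h1.noEmptyRow).2 h3, h4⟩

theorem triples_mono {q' : ℕ} (h : q ≤ q') : triples m n q ⊆ triples m n q' := by
  rintro ⟨T, P, L⟩ ⟨h1, h2, h3, h4⟩
  exact ⟨h1, h2.mono h, h3, burgeArrays_mono h h4⟩

theorem nil_mem_triples (m n q : ℕ) : (([], [], []) : Triple m n) ∈ triples m n q := by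
  have he : ∀ {α : Type} (r c : ℕ), Tableau.entry ([] : Tableau α) r c = none := by
    intro α r c
    simp [Tableau.entry]
  refine ⟨⟨⟨?_, ?_, ?_, ?_⟩, ?_⟩, ⟨⟨?_, ?_, ?_, ?_⟩, ?_⟩, rfl, ?_, ?_, ?_⟩ <;>
    simp [he, Tableau.shape, IsSortedArray]

theorem eq_nil_of_mem_triples_zero (h : t ∈ triples m n 0) : t = ([], [], []) := by
  obtain ⟨T, P, L⟩ := t
  obtain ⟨h1, h2, h3, h4, -, -⟩ := mem_triples_iff.1 h
  have hP : ∀ i, P.rowLen i = 0 := by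
    intro i
    by_contra hcon
    obtain ⟨a, ha⟩ := entry_isSome_iff.2 (Nat.pos_of_ne_zero hcon)
    have := h2.entries _ _ _ ha
    omega
  have hnil : ∀ {α : Type} (Q : Tableau α), Q.NoEmptyRow → (∀ i, Q.rowLen i = 0) → Q = [] := by
    intro α Q hQ h0
    by_contra hne
    have := (rowLen_pos_iff hQ (i := 0)).2 (List.length_pos_iff.2 hne)
    rw [h0] at this
    omega
  have hL : L = [] := by
    refine List.eq_nil_iff_forall_not_mem.2 fun p hp => ?_
    have := h4 p hp
    omega
  rw [hL, hnil P h2.noEmptyRow hP, hnil T h1.noEmptyRow fun i => (h3 i).symm.trans (hP i)]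

/-- The change `s` of the shape is one that a column with top entry `i` may cause if the previous
columns with this top entry have led to `t`: a new box lies above all entries `i`, or there is no
entry `i` and the cancelled entry is not smaller than the previous one. -/
def Fits (i : ℕ) (t : Triple m n) : Change → Prop
  | .added r => ∀ r' c, t.2.1.entry r' c = some i → r ≤ r'
  | .removed r => (∀ r' c, t.2.1.entry r' c ≠ some i) ∧
      ∀ a, t.2.2.getLast? = some (i, a) → a ≤ (reverseColumnBump t.2.1 r).2

/-- The two kinds of steps of the correspondence, for a column with top entry `i`. -/
inductive StepResult (i : ℕ) (t : Triple m n) (x : Letter m n) : Triple m n → Prop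
  | added (r : ℕ) (T' : Tableau (Letter m n)) : spoInsert t.1 x = (T', .added r) →
      IsSpoTableau T' → t.2.1.IsAddable r →
      (∀ j, (t.2.1.addBox r i).rowLen j = T'.rowLen j) →
      StepResult i t x (T', t.2.1.addBox r i, t.2.2)
  | removed (r c : ℕ) (T' : Tableau (Letter m n)) : spoInsert t.1 x = (T', .removed r) →
      IsSpoTableau T' → IsCorner t.2.1 r c →
      (∀ j, (reverseColumnBump t.2.1 r).1.rowLen j = T'.rowLen j) →
      StepResult i t x (T', (reverseColumnBump t.2.1 r).1,
        t.2.2 ++ [(i, (reverseColumnBump t.2.1 r).2)])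

theorem stepResult (ht : t ∈ triples m n q) (i : ℕ) (x : Letter m n) :
    StepResult i t x (correspondenceStep t (i, x)) := by
  obtain ⟨T, P, L⟩ := t
  obtain ⟨h1, h2, h3, h4⟩ := mem_triples_iff.1 ht
  have hT' := h1.spoInsert x
  have ha := spoInsert_apply_rowLen h1 x
  rcases hs : spoInsert T x with ⟨T', r | r⟩
  · rw [hs] at hT' ha
    simp only [Change.state, Apply] at ha
    have hadd : P.IsAddable r := by
      refine isAddable_of_isCorner hT'.rowLen_anti ?_ ?_
      · rw [h3, ha.1]
      · intro j hj
        rw [h3, ha.2 j hj]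
    have e : correspondenceStep (T, P, L) (i, x) = (T', P.addBox r i, L) := by
      simp only [correspondenceStep, hs]
    rw [e]
    refine .added r T' hs hT' hadd fun j => ?_
    rw [rowLen_addBox hadd.le_length]
    split_ifs with hj
    · rw [hj, ha.1, h3]
    · rw [ha.2 j hj, h3]
  · rw [hs] at hT' ha
    simp only [Change.state, Apply] at ha
    have hc : IsCorner P r (T'.rowLen r) := by
      refine ⟨by rw [h3, ha.1], ?_⟩
      rw [h3, ← ha.2 (r + 1) (by omega)]
      exact hT'.rowLen_anti (Nat.le_succ r)
    have e : correspondenceStep (T, P, L) (i, x) = (T', (reverseColumnBump P r).1,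
        L ++ [(i, (reverseColumnBump P r).2)]) := by
      simp only [correspondenceStep, hs]
    rw [e]
    refine .removed r _ T' hs hT' hc fun j => ?_
    rw [rowLen_reverseColumnBump h2 hc]
    split_ifs with hj
    · rw [hj]
    · rw [ha.2 j hj, h3]

/-- A new top entry occurs neither in `P` nor in `L`, so the first step with it is unrestricted. -/
theorem fits_of_lt {i₀ : ℕ} (ht : t ∈ triples m n i₀) (h : i₀ < i) (s : Change) : Fits i t s := by
  obtain ⟨T, P, L⟩ := t
  obtain ⟨h1, h2, h3, h4⟩ := mem_triples_iff.1 ht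
  have hP : ∀ r c, P.entry r c ≠ some i := by
    intro r c hrc
    have := h2.entries r c i hrc
    omega
  cases s with
  | added r => exact fun r' c hr => absurd hr (hP r' c)
  | removed r =>
    refine ⟨hP, fun a ha => ?_⟩
    have := h4.1 _ (List.mem_of_getLast? ha)
    simp only at this
    omega

/-- Without the entry `i` the tableau has entries in `{1, …, i - 1}`, and so has whatever is bumped
out of it. This is the Burge condition `b < a`. -/
theorem reverseColumnBump_lt {P : Tableau ℕ} {r c : ℕ} (hP : IsSemistandard i P) (hi : 1 ≤ i)
    (hc : IsCorner P r c) (h : ∀ r c, P.entry r c ≠ some i) :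
    IsSemistandard (i - 1) (reverseColumnBump P r).1 ∧ 1 ≤ (reverseColumnBump P r).2 ∧
      (reverseColumnBump P r).2 < i := by
  obtain ⟨h1, h2, h3, -⟩ := reverseColumnBump_spec (hP.of_forall_ne h) hc.rowLen_eq
    hc.rowLen_succ_le
  exact ⟨h1, h2, by omega⟩

theorem correspondenceStep_mem (ht : t ∈ triples m n i) (hi : 1 ≤ i)
    (hs : Fits i t (spoInsert t.1 x).2) : correspondenceStep t (i, x) ∈ triples m n i := by
  have h := stepResult ht i x
  obtain ⟨T, P, L⟩ := t
  obtain ⟨h1, h2, h3, h4⟩ := mem_triples_iff.1 ht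
  generalize correspondenceStep (T, P, L) (i, x) = t' at h
  cases h with
  | added r T' e hT' hr hl =>
    rw [e] at hs
    exact mem_triples_iff.2 ⟨hT', h2.addBox hi hr hs, hl, h4⟩
  | removed r c T' e hT' hc hl =>
    rw [e] at hs
    obtain ⟨k1, k2, k3⟩ := reverseColumnBump_lt h2 hi hc hs.1
    exact mem_triples_iff.2 ⟨hT', k1.mono (by omega), hl,
      append_mem_burgeArrays_iff.2 ⟨h4, k2, k3, hs.2⟩⟩

theorem entry_addBox_self {P : Tableau ℕ} {r : ℕ} (hr : P.IsAddable r) (i : ℕ) :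
    (P.addBox r i).entry r (P.rowLen r) = some i := by
  rw [entry_addBox hr.le_length, if_pos ⟨rfl, rfl⟩]

/-- For two consecutive columns with the same top entry, the second one causes a change of the
allowed kind if and only if the bottom entries are in order. -/
theorem fits_correspondenceStep_iff (ht : t ∈ triples m n i) (hi : 1 ≤ i)
    (hs : Fits i t (spoInsert t.1 x).2) :
    Fits i (correspondenceStep t (i, x)) (spoInsert (correspondenceStep t (i, x)).1 y).2 ↔
      x.RowRel y := by
  have ht' := correspondenceStep_mem ht hi hs
  have h := stepResult ht i x
  have h' := stepResult ht' i y
  have hT := ht.1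
  have hrow := spoInsert_rowOrdered (x := x) (y := y) hT
  have hcol := spoInsert_colOrdered (x := x) (y := y) hT
  -- One of the two bumping lemmas always applies. For the converse direction of the equivalence the
  -- wrong order is refuted by `colOrdered`.
  have htot : ¬ x.RowRel y → y.ColRel x := by
    rw [Letter.rowRel_iff, Letter.colRel_iff]
    omega
  have hP := ht.2.1
  generalize correspondenceStep t (i, x) = t' at h h' ht'
  generalize correspondenceStep t' (i, y) = t'' at h'
  cases h with
  | added r T' e hT' hr hl =>
    have hself := entry_addBox_self hr i
    rw [e] at hs hrow hcol
    cases h' with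
    | added r' T'' e' hT'' hr' hl' =>
      simp only at e'
      rw [e'] at hrow hcol ⊢
      simp only [Change.state, RowOrdered, ColOrdered] at hrow hcol
      constructor
      · intro h
        by_contra hcon
        have h1 := hcol (htot hcon)
        have h2 := h r _ hself
        omega
      · intro h r'' c hr''
        simp only [entry_addBox hr.le_length] at hr''
        have := hrow h
        split_ifs at hr'' with h1
        · omega
        · have := hs r'' c hr''
          omega
    | removed r' c' T'' e' hT'' hr' hl' =>
      simp only at e'
      rw [e'] at hrow hcol ⊢
      simp only [Change.state, RowOrdered, ColOrdered] at hrow hcol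
      constructor
      · intro h
        exact absurd hself (h.1 _ _)
      · intro h
        exact (hrow h).elim
  | removed r c T' e hT' hr hl =>
    rw [e] at hs hrow hcol
    obtain ⟨k1, k2, k3⟩ := reverseColumnBump_lt hP hi hr hs.1
    have hno : ∀ r' c, (reverseColumnBump t.2.1 r).1.entry r' c ≠ some i := by
      intro r' c h
      have := k1.entries _ _ _ h
      omega
    cases h' with
    | added r' T'' e' hT'' hr' hl' =>
      simp only at e'
      rw [e'] at hrow hcol ⊢
      simp only [Change.state, RowOrdered, ColOrdered] at hrow hcol
      constructor
      · intro h
        by_contra hcon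
        exact hcol (htot hcon)
      · intro h r'' c hr''
        exact absurd hr'' (hno r'' c)
    | removed r' c' T'' e' hT'' hr' hl' =>
      simp only at e' hr'
      have hiff := reverseColumnBump_le_iff hP hr hr'
      rw [e'] at hrow hcol ⊢
      simp only [Change.state, RowOrdered, ColOrdered] at hrow hcol
      constructor
      · intro h
        by_contra hcon
        have h1 := hcol (htot hcon)
        have h2 := hiff.1 (h.2 _ (List.getLast?_concat))
        omega
      · intro h
        refine ⟨hno, fun a ha => ?_⟩
        simp only [List.getLast?_concat, Option.some.injEq, Prod.mk.injEq, true_and] at ha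
        rw [← ha]
        exact hiff.2 (hrow h)

/-- The top entry of the last column can be seen from the result. -/
theorem le_of_correspondenceStep_mem {q' : ℕ} (ht : t ∈ triples m n q)
    (h : correspondenceStep t (i, x) ∈ triples m n q') : i ≤ q' := by
  have h1 := stepResult ht i x
  generalize correspondenceStep t (i, x) = t' at h h1
  cases h1 with
  | added r T' e hT' hr hl => exact (h.2.1.entries _ _ _ (entry_addBox_self hr i)).2
  | removed r c T' e hT' hc hl =>
    exact (h.2.2.2.1 (i, (reverseColumnBump t.2.1 r).2) (by simp)).2.1

/-- The result reveals the step. Its top entry is the least bound for all entries of `P` and `L`. A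
box was added exactly when `P` contains that entry, and then in the topmost row containing it.
Otherwise the last column of `L` holds the entry whose insertion restores `P`. -/
theorem correspondenceStep_injective {j : ℕ} {u : Triple m n} (ht : t ∈ triples m n i)
    (hu : u ∈ triples m n j) (hi : 1 ≤ i) (hj : 1 ≤ j) (hs : Fits i t (spoInsert t.1 x).2)
    (hs' : Fits j u (spoInsert u.1 y).2)
    (h : correspondenceStep t (i, x) = correspondenceStep u (j, y)) :
    t = u ∧ i = j ∧ x = y := by
  have hij : i = j := by
    apply le_antisymm
    · exact le_of_correspondenceStep_mem (x := x) ht (h ▸ correspondenceStep_mem hu hj hs')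
    · exact le_of_correspondenceStep_mem (x := y) hu (h ▸ correspondenceStep_mem ht hi hs)
  subst hij
  have h1 := stepResult ht i x
  have h2 := stepResult hu i y
  rw [← h] at h2
  clear h
  generalize ht' : correspondenceStep t (i, x) = t' at h1 h2
  obtain ⟨T, P, L⟩ := t
  obtain ⟨U, Q, M⟩ := u
  have hT := ht.1
  have hU := hu.1
  have hP := ht.2.1
  have hQ := hu.2.1
  cases h1 with
  | added r T' e hT' hr hl =>
    rw [e] at hs
    simp only at e hr
    have hself := entry_addBox_self hr i
    generalize hR : P.addBox r i = R at h2 hself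
    generalize hM : (T', R, L) = t'' at h2
    cases h2 with
    | added r' U' e' hU' hr' hl' =>
      rw [e'] at hs'
      simp only at e' hr'
      simp only [Prod.mk.injEq] at hM
      obtain ⟨rfl, rfl, rfl⟩ := hM
      have hself' := entry_addBox_self hr' i
      -- Each of the two new boxes is either the other one or an older entry `i`, which by `Fits`
      -- lies no higher.
      have hrr : r = r' := by
        apply le_antisymm
        · rw [← hR, entry_addBox hr.le_length] at hself'
          split_ifs at hself' with h3
          · exact h3.1.ge
          · exact hs _ _ hself'
        · rw [entry_addBox hr'.le_length] at hself
          split_ifs at hself with h3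
          · exact h3.1.ge
          · exact hs' _ _ hself
      subst hrr
      obtain ⟨rfl, rfl⟩ := spoInsert_injective hT hU (e.trans e'.symm)
      have hlen : ∀ k, P.rowLen k = Q.rowLen k := by
        intro k
        rw [(mem_triples_iff.1 ht).2.2.1, (mem_triples_iff.1 hu).2.2.1]
      have hPQ : P = Q := by
        refine ext_entry hP.noEmptyRow hQ.noEmptyRow fun k d => ?_
        have h4 := congrArg (fun R => Tableau.entry R k d) hR
        simp only [entry_addBox hr.le_length, entry_addBox hr'.le_length, hlen r] at h4
        split_ifs at h4 with h5
        · rw [entry_eq_none_iff.2 (by rw [hlen, h5.1, h5.2]),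
            entry_eq_none_iff.2 (by rw [h5.1, h5.2])]
        · exact h4
      rw [hPQ]
      exact ⟨rfl, rfl, rfl⟩
    | removed r' c' U' e' hU' hr' hl' =>
      rw [e'] at hs'
      simp only [Prod.mk.injEq] at hM
      obtain ⟨rfl, rfl, rfl⟩ := hM
      have := (reverseColumnBump_lt hQ hi hr' hs'.1).1.entries _ _ _ hself
      omega
  | removed r c T' e hT' hr hl =>
    rw [e] at hs
    simp only at e hr
    have hno := (reverseColumnBump_lt hP hi hr hs.1).1.entries
    generalize hM : (T', (reverseColumnBump P r).1, L ++ [(i, (reverseColumnBump P r).2)]) = t''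
      at h2
    cases h2 with
    | added r' U' e' hU' hr' hl' =>
      simp only [Prod.mk.injEq] at hM
      rw [hM.2.1] at hno
      have := hno _ _ _ (entry_addBox_self hr' i)
      omega
    | removed r' c' U' e' hU' hr' hl' =>
      simp only [Prod.mk.injEq] at hM
      obtain ⟨rfl, h3, h4⟩ := hM
      obtain ⟨rfl, h5⟩ := List.append_inj' h4 rfl
      simp only [List.cons.injEq, Prod.mk.injEq, true_and, and_true] at h5
      obtain ⟨rfl, rfl⟩ := reverseColumnBump_injective hP hQ hr hr' (Prod.ext h3 h5)
      obtain ⟨rfl, rfl⟩ := spoInsert_injective hT hU (e.trans e'.symm)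
      exact ⟨rfl, rfl, rfl⟩

theorem correspondenceStep_ne_nil (ht : t ∈ triples m n q) (hi : 1 ≤ i) :
    correspondenceStep t (i, x) ≠ ([], [], []) := by
  intro h
  have := le_of_correspondenceStep_mem (x := x) (i := i) ht (h ▸ nil_mem_triples m n 0)
  omega

end

end Spo

/-! ### Undoing the last step, and induction along the array -/

namespace Spo

open LevelState Tableau

section

variable {m n q i : ℕ} {t : Triple m n} {x y : Letter m n}

/-- The number of columns of the arrays that lead to `t`. -/
def Triple.weight (t : Triple m n) : ℕ := t.2.1.size + 2 * t.2.2.length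

theorem IsSemistandard.succ_le_entry {P : Tableau ℕ} (hP : IsSemistandard q P) {r : ℕ} :
    ∀ {c a : ℕ}, P.entry r c = some a → r + 1 ≤ a := by
  induction r with
  | zero => exact fun h => (hP.entries _ _ _ h).1
  | succ r ih =>
    intro c a h
    have h1 := Tableau.lt_rowLen h
    have h2 := hP.rowLen_anti (Nat.le_succ r)
    obtain ⟨b, hb⟩ := entry_isSome_iff.2 (h1.trans_le h2)
    have h3 := hP.isTableau.col r c b a hb h
    have h4 := ih hb
    omega

/-- The topmost row that contains the largest entry ends in a corner. -/
theorem IsSemistandard.exists_corner {P : Tableau ℕ} (hP : IsSemistandard i P)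
    (h : ∃ r c, P.entry r c = some i) :
    ∃ r c, IsCorner P r c ∧ P.entry r c = some i ∧ ∀ r' c', P.entry r' c' = some i → r ≤ r' := by
  classical
  obtain ⟨c, hc⟩ := Nat.find_spec h
  have hmin : ∀ r' c', P.entry r' c' = some i → Nat.find h ≤ r' :=
    fun r' c' h' => Nat.find_min' h ⟨c', h'⟩
  generalize Nat.find h = r at hc hmin
  have hrow : ∀ d, c ≤ d → d < P.rowLen r → P.entry r d = some i := by
    intro d hd
    induction d, hd using Nat.le_induction with
    | base => exact fun _ => hc
    | succ d hd ih =>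
      intro hlt
      obtain ⟨a, ha⟩ := entry_isSome_iff.2 hlt
      have h1 := hP.isTableau.row r d i a (ih (by omega)) ha
      have h2 := (hP.entries _ _ _ ha).2
      rw [ha, le_antisymm h2 h1]
  have hlt := Tableau.lt_rowLen hc
  have hlast := hrow (P.rowLen r - 1) (by omega) (by omega)
  refine ⟨r, P.rowLen r - 1, ⟨by omega, ?_⟩, hlast, hmin⟩
  by_contra hcon
  obtain ⟨a, ha⟩ := entry_isSome_iff.2 (not_le.1 hcon)
  have h1 := hP.isTableau.col r _ i a hlast ha
  have h2 := (hP.entries _ _ _ ha).2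
  omega

theorem exists_correspondenceStep_added {T : Tableau (Letter m n)} {P : Tableau ℕ} {L : TwoLine ℕ}
    (ht : (T, P, L) ∈ triples m n i) (h : ∃ r c, P.entry r c = some i) :
    ∃ (u : Triple m n) (x : Letter m n), u ∈ triples m n i ∧ Fits i u (spoInsert u.1 x).2 ∧
      correspondenceStep u (i, x) = (T, P, L) ∧ u.weight < Triple.weight (T, P, L) := by
  obtain ⟨h1, h2, h3, h4⟩ := mem_triples_iff.1 ht
  obtain ⟨r, c, hc, hrc, hmin⟩ := h2.exists_corner h
  have hlen := rowLen_removeBox h2.noEmptyRow hc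
  obtain ⟨T₀, x, hT₀, hx⟩ := exists_spoInsert_added h1 (r := r) (by
    rw [← h3, ← h3, hc.rowLen_eq]
    exact Nat.lt_succ_of_le hc.rowLen_succ_le)
  have ha := spoInsert_apply_rowLen hT₀ x
  rw [hx] at ha
  simp only [Change.state, Apply] at ha
  have hadd : (P.removeBox r).IsAddable r := by
    refine isAddable_of_isCorner h2.rowLen_anti ?_ fun j hj => ?_
    · rw [hlen, if_pos rfl, hc.rowLen_eq]
    · rw [hlen, if_neg hj]
  refine ⟨(T₀, P.removeBox r, L), x, mem_triples_iff.2 ⟨hT₀, h2.removeBox hc, fun j => ?_, h4⟩,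
    ?_, ?_, ?_⟩
  · rw [hlen]
    split_ifs with hj
    · have h5 := h3 r
      rw [hc.rowLen_eq, ha.1] at h5
      rw [hj]
      omega
    · rw [h3, ha.2 j hj]
  · simp only [hx, Fits]
    intro r' c' hr'
    rw [entry_removeBox h2.noEmptyRow hc.rowLen_eq hc.rowLen_succ_le] at hr'
    split_ifs at hr'
    exact hmin r' c' hr'
  · simp only [correspondenceStep, hx, addBox_removeBox h2.noEmptyRow hc hadd.le_length hrc]
  · have := size_eq_succ (T := P.removeBox r) (T' := P) (r := r)
      (by rw [hlen, if_pos rfl, hc.rowLen_eq]) (fun j hj => by rw [hlen, if_neg hj])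
    simp only [Triple.weight]
    omega

/-- Inserting `a` back into `P` tells in which row the box was removed; a cancellation ending in
that row is then undone in `T`. -/
theorem exists_correspondenceStep_removed {T : Tableau (Letter m n)} {P : Tableau ℕ}
    {L : TwoLine ℕ} {a : ℕ} (ht : (T, P, L ++ [(i, a)]) ∈ triples m n i) (hi : i ≤ m + 1)
    (h : ∀ r c, P.entry r c ≠ some i) :
    ∃ (u : Triple m n) (x : Letter m n), u ∈ triples m n i ∧ Fits i u (spoInsert u.1 x).2 ∧
      correspondenceStep u (i, x) = (T, P, L ++ [(i, a)]) ∧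
      u.weight < Triple.weight (T, P, L ++ [(i, a)]) := by
  obtain ⟨h1, h2, h3, h4⟩ := mem_triples_iff.1 ht
  obtain ⟨h4, h5, h6, h7⟩ := append_mem_burgeArrays_iff.1 h4
  obtain ⟨P₀, r, c, hP₀, hc, hr⟩ := exists_reverseColumnBump_eq (h2.of_forall_ne h) h5
    (show a ≤ i - 1 by omega)
  have hlen : ∀ j, P.rowLen j = if j = r then c else P₀.rowLen j := by
    intro j
    rw [← rowLen_reverseColumnBump hP₀ hc, hr]
  have hadd : T.IsAddable r := by
    refine isAddable_of_isCorner hP₀.rowLen_anti ?_ fun j hj => ?_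
    · rw [← h3, hlen, if_pos rfl, hc.rowLen_eq]
    · rw [← h3, hlen, if_neg hj]
  -- An entry in row `r` is at least `r + 1` and, as `i` does not occur, at most `i - 1 ≤ m`.
  have hrm : r < m := by
    obtain ⟨b, hb⟩ := entry_isSome_iff.2 (show c < P₀.rowLen r by rw [hc.rowLen_eq]; omega)
    have h8 := hP₀.succ_le_entry hb
    have h9 := (hP₀.entries _ _ _ hb).2
    omega
  obtain ⟨T₀, x, hT₀, hx⟩ := exists_spoInsert_removed h1 hrm hadd
  have ha := spoInsert_apply_rowLen hT₀ x
  rw [hx] at ha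
  simp only [Change.state, Apply] at ha
  refine ⟨(T₀, P₀, L), x, mem_triples_iff.2 ⟨hT₀, hP₀.mono (by omega), fun j => ?_, h4⟩,
    ?_, ?_, ?_⟩
  · rcases eq_or_ne j r with hj | hj
    · rw [hj, ha.1, ← h3, hlen, if_pos rfl, hc.rowLen_eq]
    · rw [← ha.2 j hj, ← h3, hlen, if_neg hj]
  · simp only [hx, Fits, hr]
    refine ⟨fun r' c' hr' => ?_, h7⟩
    have := (hP₀.entries _ _ _ hr').2
    omega
  · simp only [correspondenceStep, hx, hr]
  · have := size_eq_succ (T := P) (T' := P₀) (r := r)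
      (by rw [hlen, if_pos rfl, hc.rowLen_eq]) (fun j hj => by rw [hlen, if_neg hj])
    simp only [Triple.weight, List.length_append, List.length_singleton]
    omega

theorem exists_correspondenceStep (ht : t ∈ triples m n q) (hq : q ≤ m + 1)
    (hne : t ≠ ([], [], [])) :
    ∃ (i : ℕ) (u : Triple m n) (x : Letter m n), 1 ≤ i ∧ i ≤ q ∧ u ∈ triples m n i ∧
      Fits i u (spoInsert u.1 x).2 ∧ correspondenceStep u (i, x) = t ∧ u.weight < t.weight := by
  induction q with
  | zero => exact absurd (eq_nil_of_mem_triples_zero ht) hne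
  | succ q ih =>
    obtain ⟨T, P, L⟩ := t
    by_cases hP : ∃ r c, P.entry r c = some (q + 1)
    · obtain ⟨u, x, h⟩ := exists_correspondenceStep_added ht hP
      exact ⟨q + 1, u, x, by omega, le_rfl, h⟩
    · have hP' : ∀ r c, P.entry r c ≠ some (q + 1) := fun r c h => hP ⟨r, c, h⟩
      -- Additions come after cancellations, so the largest entry is first sought in `P`, then at
      -- the end of `L`. If it is in neither, the triple belongs to a smaller `q`.
      by_cases hL : ∃ b, L.getLast? = some (q + 1, b)
      · obtain ⟨b, hb⟩ := hL
        obtain ⟨L', rfl⟩ := List.getLast?_eq_some_iff.1 hb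
        obtain ⟨u, x, h⟩ := exists_correspondenceStep_removed ht hq hP'
        exact ⟨q + 1, u, x, by omega, le_rfl, h⟩
      · obtain ⟨h1, h2, h3, h4⟩ := ht
        obtain ⟨i, u, x, h5, h6, h7⟩ := ih ⟨h1, h2.of_forall_ne hP', h3,
          burgeArrays_of_getLast h4 fun b hb => hL ⟨b, hb⟩⟩ (by omega)
        exact ⟨i, u, x, h5, by omega, h7⟩

/-- The order of the columns of the arrays in `𝒜`: no column with bottom entry in `B₁` may follow
itself. -/
def ColumnRel (p p' : ℕ × Letter m n) : Prop := p.1 < p'.1 ∨ p.1 = p'.1 ∧ p.2.RowRel p'.2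

/-- In a sorted array equal columns are adjacent, so the multiplicity condition is a condition on
neighbours. Transitivity of `ColumnRel` excludes repetitions at a distance. -/
theorem mem_arrays_iff {π : TwoLine (Letter m n)} :
    π ∈ arrays m n q ↔ (∀ p ∈ π, 1 ≤ p.1 ∧ p.1 ≤ q) ∧ π.IsChain ColumnRel := by
  have hle : ∀ {x y : Letter m n}, x ≤ y ↔ x.rank ≤ y.rank := Iff.rfl
  have htrans : IsTrans (ℕ × Letter m n) ColumnRel := by
    refine ⟨fun a b c => ?_⟩
    simp only [ColumnRel, Letter.rowRel_iff]
    omega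
  have hcount : ∀ p, π.Duplicate p ↔ 2 ≤ π.count p := fun p => by
    rw [List.duplicate_iff_sublist, ← List.replicate_sublist_iff]
    rfl
  constructor
  · rintro ⟨h1, h2, h3⟩
    refine ⟨h1, ?_⟩
    rw [IsSortedArray, List.isChain_iff_getElem] at h2
    rw [List.isChain_iff_getElem]
    intro i hi
    have h4 := h2 i hi
    by_contra hcon
    simp only [ColumnRel, Letter.rowRel_iff, not_or, not_and, not_lt] at hcon
    have h5 : π[i].1 = π[i + 1].1 := by omega
    have h6 := hle.1 (h4.2 h5)
    have h7 := hcon.2 h5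
    have h8 : π[i] = π[i + 1] := Prod.ext h5 (Letter.rank_injective (by omega))
    have h9 := h3 π[i] (List.getElem_mem _) (Letter.isB1_iff.2 (h7.2 (by omega)))
    have h10 := (hcount _).1 (List.duplicate_iff_exists_distinct_get.2
      ⟨⟨i, by omega⟩, ⟨i + 1, hi⟩, by simp, rfl, h8⟩ : List.Duplicate π[i] π)
    omega
  · rintro ⟨h1, h2⟩
    refine ⟨h1, h2.imp fun p p' h => ?_, fun p hp hB => ?_⟩
    · simp only [ColumnRel, Letter.rowRel_iff] at h
      rw [hle]
      omega
    · by_contra hcon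
      have h3 := List.isChain_iff_pairwise.1 h2
      obtain ⟨i, j, hij, hi, hj⟩ := List.duplicate_iff_exists_distinct_get.1
        ((hcount p).2 (not_le.1 hcon))
      have h4 := List.pairwise_iff_get.1 h3 i j hij
      rw [← hi, ← hj] at h4
      rw [Letter.isB1_iff] at hB
      simp only [ColumnRel, Letter.rowRel_iff] at h4
      omega

theorem append_mem_arrays_iff {π : TwoLine (Letter m n)} :
    π ++ [(i, x)] ∈ arrays m n q ↔ π ∈ arrays m n q ∧ 1 ≤ i ∧ i ≤ q ∧
      ∀ p, π.getLast? = some p → ColumnRel p (i, x) := by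
  simp only [mem_arrays_iff, List.isChain_append, List.mem_append, List.mem_singleton]
  constructor
  · rintro ⟨h1, h2, -, h3⟩
    exact ⟨⟨fun p hp => h1 p (Or.inl hp), h2⟩, (h1 _ (Or.inr rfl)).1, (h1 _ (Or.inr rfl)).2,
      fun p hp => h3 p hp _ (by simp)⟩
  · rintro ⟨⟨h1, h2⟩, h3, h4, h5⟩
    refine ⟨fun p hp => ?_, h2, by simp, fun p hp p' hp' => ?_⟩
    · rcases hp with hp | rfl
      · exact h1 p hp
      · exact ⟨h3, h4⟩
    · simp only [List.head?_cons, Option.mem_def, Option.some.injEq] at hp'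
      rw [← hp']
      exact h5 p hp

theorem correspondence_append (π : TwoLine (Letter m n)) (p : ℕ × Letter m n) :
    correspondence (π ++ [p]) = correspondenceStep (correspondence π) p := by
  simp [correspondence, List.foldl_append]

/-- The induction is over prefixes and quantifies over the next column: its top entry is what bounds
the entries of the triple reached so far. -/
theorem correspondence_fits (π : TwoLine (Letter m n)) :
    ∀ (i : ℕ) (x : Letter m n), π ++ [(i, x)] ∈ arrays m n q →
      correspondence π ∈ triples m n i ∧ Fits i (correspondence π)
        (spoInsert (correspondence π).1 x).2 := by
  induction π using List.reverseRecOn with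
  | nil =>
    intro i x h
    have hi := (append_mem_arrays_iff.1 h).2.1
    exact ⟨nil_mem_triples m n i, fits_of_lt (nil_mem_triples m n 0) hi _⟩
  | append_singleton π p ih =>
    obtain ⟨i₀, x₀⟩ := p
    intro i x h
    obtain ⟨h1, h2, h3, h4⟩ := append_mem_arrays_iff.1 h
    obtain ⟨h5, h6⟩ := ih i₀ x₀ h1
    have hi₀ := (append_mem_arrays_iff.1 h1).2.1
    have h7 := correspondenceStep_mem h5 hi₀ h6
    rw [correspondence_append]
    rcases h4 _ List.getLast?_concat with h8 | ⟨h8, h9⟩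
    · exact ⟨triples_mono h8.le h7, fits_of_lt h7 h8 _⟩
    · simp only at h8 h9
      subst h8
      exact ⟨h7, (fits_correspondenceStep_iff h5 hi₀ h6).2 h9⟩

theorem mapsTo_correspondence (m n q : ℕ) :
    Set.MapsTo (correspondence (m := m) (n := n)) (arrays m n q) (triples m n q) := by
  intro π h
  rcases π.eq_nil_or_concat' with rfl | ⟨π, ⟨i, x⟩, rfl⟩
  · exact nil_mem_triples m n q
  · obtain ⟨h1, h2⟩ := correspondence_fits π i x h
    obtain ⟨-, h3, h4, -⟩ := append_mem_arrays_iff.1 h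
    rw [correspondence_append]
    exact triples_mono h4 (correspondenceStep_mem h1 h3 h2)

theorem injOn_correspondence (m n q : ℕ) :
    Set.InjOn (correspondence (m := m) (n := n)) (arrays m n q) := by
  intro π hπ
  induction π using List.reverseRecOn with
  | nil =>
    intro ρ hρ h
    rcases ρ.eq_nil_or_concat' with rfl | ⟨ρ, ⟨i, x⟩, rfl⟩
    · rfl
    · rw [correspondence_append] at h
      exact absurd h.symm (correspondenceStep_ne_nil (correspondence_fits ρ i x hρ).1
        (append_mem_arrays_iff.1 hρ).2.1)
  | append_singleton π p ih =>
    obtain ⟨i, x⟩ := p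
    intro ρ hρ h
    obtain ⟨h1, h2⟩ := correspondence_fits π i x hπ
    have h3 := append_mem_arrays_iff.1 hπ
    rcases ρ.eq_nil_or_concat' with rfl | ⟨ρ, ⟨j, y⟩, rfl⟩
    · rw [correspondence_append] at h
      exact absurd h (correspondenceStep_ne_nil h1 h3.2.1)
    · obtain ⟨k1, k2⟩ := correspondence_fits ρ j y hρ
      have k3 := append_mem_arrays_iff.1 hρ
      rw [correspondence_append, correspondence_append] at h
      obtain ⟨e1, rfl, rfl⟩ := correspondenceStep_injective h1 k1 h3.2.1 k3.2.1 h2 k2 h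
      rw [ih h3.1 k3.1 e1]

theorem surjOn_correspondence (hq : q ≤ m + 1) :
    Set.SurjOn (correspondence (m := m) (n := n)) (arrays m n q) (triples m n q) := by
  intro t ht
  induction hw : t.weight using Nat.strong_induction_on generalizing t with
  | _ w ih =>
    by_cases hne : t = ([], [], [])
    · exact ⟨[], mem_arrays_iff.2 (by simp), hne.symm⟩
    obtain ⟨i, u, x, h1, h2, h3, h4, h5, h6⟩ := exists_correspondenceStep ht hq hne
    obtain ⟨π, hπ, rfl⟩ := ih _ (hw ▸ h6) (triples_mono h2 h3) rfl
    -- The array found for the smaller triple may be extended: its last top entry is at most `i`,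
    -- and if it equals `i`, then `Fits` forces the bottom entries to be in order.
    refine ⟨π ++ [(i, x)], append_mem_arrays_iff.2 ⟨hπ, h1, h2, fun p hp => ?_⟩, ?_⟩
    · obtain ⟨i₀, x₀⟩ := p
      obtain ⟨π, rfl⟩ := List.getLast?_eq_some_iff.1 hp
      obtain ⟨k1, k2⟩ := correspondence_fits π i₀ x₀ hπ
      have hi₀ := (append_mem_arrays_iff.1 hπ).2.1
      rw [correspondence_append] at h3 h4
      rcases (le_of_correspondenceStep_mem k1 h3).lt_or_eq with h7 | h7
      · exact Or.inl h7
      · subst h7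
        exact Or.inr ⟨rfl, (fits_correspondenceStep_iff k1 hi₀ k2).1 h4⟩
    · rw [correspondence_append, h5]

end

end Spo

theorem mainTheorem3 (m n q : ℕ) :
    Set.MapsTo (Spo.correspondence (m := m) (n := n)) (Spo.arrays m n q) (Spo.triples m n q) ∧
    Set.InjOn (Spo.correspondence (m := m) (n := n)) (Spo.arrays m n q) ∧
    (q ≤ m + 1 →
      Set.BijOn (Spo.correspondence (m := m) (n := n)) (Spo.arrays m n q)
        (Spo.triples m n q)) :=
  ⟨Spo.mapsTo_correspondence m n q, Spo.injOn_correspondence m n q, fun hq =>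
    ⟨Spo.mapsTo_correspondence m n q, Spo.injOn_correspondence m n q,
      Spo.surjOn_correspondence hq⟩⟩
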